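/- Let $m>1$ and $n>0$ be integers, $A=\{a_1,\dots,a_m\}$ and $F=F(A)$ the free group on $A$. *Genericity.* Consider $n$-tuples $(r_1,\dots,r_n)$ of nontrivial cyclically reduced words in $F$. A class $P$ of such tuples (equivalently, of presentations $\langle a_1,\dots,a_m\mid r_1,\dots,r_n\rangle$) is *exponentially $(m,n)$-generic* if the proportion $\rho_P(t)$ of tuples in $P$ among all such tuples with $|r_i|\le t$ for all $i$ tends to $1$ as $t\to\infty$, and there is $0\le c<1$ with $1-\rho_P(t)\le c^t$ for all sufficiently large $t$. *Readability.* An *$F$-graph* is a graph (loops and multiple edges allowed) whose oriented edges are labelled by $A\cup A^{-1}$, inverse edges having inverse labels; it is *folded* if no two distinct oriented edges have the same origin and the same label. A reduced word $w$ of length $l>0$ is *$\mu$-readable* if it is the label of a reduced path in some finite connected $F$-graph $\Gamma$ with at most $\mu l$ edges and with $\pi_1(\Gamma)$ of rank at most $m-1$. It is *$(\mu,L)$-readable* if it is the label of a path in some finite connected folded $F$-graph $\Gamma$ with at most $\mu l$ edges, with $\pi_1(\Gamma)$ of rank at most $L$, and with at least one vertex of degree less than $2m$. *The class.* Let $L\ge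 m$ be an integer and $\lambda,\mu$ real numbers with $0<\mu\le 1$ and $0<\lambda\le \mu/(15L+3\mu)$; call such $(\lambda,\mu,L)$ admissible. Let $P_{m,n}=P(\lambda,\mu,L,m,n)$ be the class of all presentations $\langle a_1,\dots,a_m\mid r_1,\dots,r_n\rangle$ where the $r_i$ are nontrivial cyclically reduced words such that (1) $(r_1,\dots,r_n)$ satisfies the small cancellation condition $C'(\lambda)$; (2) no $r_i$ is a proper power in $F$; (3) if $w$ is a subword of a cyclic permutation of some $r_i$ and $|w|\ge |r_i|/2$, then $w$ is neither $(\mu,L)$-readable nor $\mu$-readable; (4) $|r_i|>m$ for all $i$. **Theorem.** (A) For every $L\ge m$ there is $\mu_0>0$ such that for all admissible $(\lambda,\mu,L)$ with $\mu\le\mu_0$ the class $P(\lambda,\mu,L,m,n)$ is exponentially $(m,n)$-generic. (B) For all admissible $(\lambda,\mu,L)$ and every group $G=\langle a_1,\dots,a_m\mid r_1,\dots,r_n\rangle$ given by a presentation in $P(\lambda,\mu,L,m,n)$: - for every group $H$ generated by $m$ elements and every homomorphism $\phi:H\to G$, either $\phi(H)=G$ or $\phi(H)$ is free; moreover, $G$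 itself is the one and only non-free subgroup of $G$ that can be generated by $m$ elements; - every automorphism of $G$ is induced by an automorphism of $F(a_1,\dots,a_m)$; - $G$ is co-Hopfian, that is, every injective endomorphism of $G$ is onto. -/

import Mathlib

noncomputable section

namespace GenericGroups

/-! ## Presentations and exponential genericity -/

/-- A letter of `A ∪ A⁻¹`: `(a, true)` is the generator `a`, `(a, false)` its inverse. -/
abbrev Letter (m : ℕ) : Type := Fin m × Bool

/-- An ordered `n`-tuple `(r₁, …, rₙ)` in `F(a₁, …, a_m)`, seen as the list of relators of
`⟨a₁, …, a_m | r₁, …, rₙ⟩`. The word of an element of the free group is its reduced word. -/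
abbrev Relators (m n : ℕ) : Type := Fin n → FreeGroup (Fin m)

/-- All relators are nontrivial and cyclically reduced. -/
def IsCyclicallyReducedTuple {m n : ℕ} (r : Relators m n) : Prop :=
  ∀ i, r i ≠ 1 ∧ FreeGroup.IsCyclicallyReduced (r i).toWord

/-- The presentations with nontrivial cyclically reduced relators of length at most `t`. -/
def presentationsUpTo (m n t : ℕ) : Set (Relators m n) :=
  {r | IsCyclicallyReducedTuple r ∧ ∀ i, (r i).norm ≤ t}

/-- `N_P(m, n, t) / N(m, n, t)`. -/
def proportion {m n : ℕ} (P : Set (Relators m n)) (t : ℕ) : ℝ :=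
  ((P ∩ presentationsUpTo m n t).ncard : ℝ) / ((presentationsUpTo m n t).ncard : ℝ)

/-- `P` is exponentially `(m, n)`-generic. -/
def IsExponentiallyGeneric {m n : ℕ} (P : Set (Relators m n)) : Prop :=
  Filter.Tendsto (proportion P) Filter.atTop (nhds 1) ∧
    ∃ c : ℝ, 0 ≤ c ∧ c < 1 ∧ ∀ᶠ t in Filter.atTop, 1 - proportion P t ≤ c ^ t

/-- The group `⟨a₁, …, a_m | r₁, …, rₙ⟩`. -/
abbrev PresGroup {m n : ℕ} (r : Relators m n) : Type := PresentedGroup (Set.range r)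

/-! ## Labelled graphs -/

/-- A graph with edges labelled by `A ∪ A⁻¹` such that inverse edges have inverse labels. Of each
pair of mutually inverse oriented edges exactly one is labelled by a generator; `E` is the type of
these, so `E` counts unoriented edges. Multiple edges and loops are allowed. -/
structure FGraph (m : ℕ) where
  V : Type
  E : Type
  src : E → V
  tgt : E → V
  lab : E → Fin m

namespace FGraph

variable {m : ℕ} (Γ : FGraph m)

/-- Oriented edges: `(e, true)` is `e`, and `(e, false)` is `e` traversed backwards. -/
abbrev OEdge : Type := Γ.E × Bool

def origin (d : Γ.OEdge) : Γ.V := if d.2 then Γ.src d.1 else Γ.tgt d.1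

def terminus (d : Γ.OEdge) : Γ.V := if d.2 then Γ.tgt d.1 else Γ.src d.1

def oLabel (d : Γ.OEdge) : Letter m := (Γ.lab d.1, d.2)

/-- `Γ.IsPath x p y`: the list `p` of oriented edges is an edge-path from `x` to `y`. -/
def IsPath : Γ.V → List Γ.OEdge → Γ.V → Prop
  | x, [], y => x = y
  | x, d :: p, y => Γ.origin d = x ∧ IsPath (Γ.terminus d) p y

/-- The label of an edge-path. -/
def pathLabel (p : List Γ.OEdge) : List (Letter m) := p.map Γ.oLabel

/-- An edge-path is reduced if no edge in it is followed by its inverse edge. (This is Mathlib's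
notion of a reduced word, applied to the alphabet of edges.) -/
def IsReducedPath (p : List Γ.OEdge) : Prop := FreeGroup.IsReduced p

def IsFinite : Prop := Finite Γ.V ∧ Finite Γ.E

def IsConnected : Prop := Nonempty Γ.V ∧ ∀ x y, ∃ p, Γ.IsPath x p y

/-- No two distinct oriented edges have the same origin and the same label. -/
def IsFolded : Prop :=
  ∀ d d' : Γ.OEdge, Γ.origin d = Γ.origin d' → Γ.oLabel d = Γ.oLabel d' → d = d'

/-- The number of oriented edges issuing from `v`; a loop counts twice. -/
def degree (v : Γ.V) : ℕ := Nat.card {d : Γ.OEdge // Γ.origin d = v}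

/-- The rank of the free group `π₁(Γ)` of a finite connected graph, that is one minus its Euler
characteristic. -/
def rank : ℤ := (Nat.card Γ.E : ℤ) - (Nat.card Γ.V : ℤ) + 1

end FGraph

/-! ## Readability and the small cancellation condition -/

/-- `w` is `μ`-readable. -/
def IsReadable {m : ℕ} (μ : ℝ) (w : List (Letter m)) : Prop :=
  ∃ Γ : FGraph m, Γ.IsFinite ∧ Γ.IsConnected ∧
    (Nat.card Γ.E : ℝ) ≤ μ * (w.length : ℝ) ∧
    Γ.rank ≤ (m : ℤ) - 1 ∧
    ∃ x p y, Γ.IsPath x p y ∧ Γ.IsReducedPath p ∧ Γ.pathLabel p = w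

/-- `w` is `(μ, L)`-readable. -/
def IsReadableL {m : ℕ} (μ : ℝ) (L : ℕ) (w : List (Letter m)) : Prop :=
  ∃ Γ : FGraph m, Γ.IsFinite ∧ Γ.IsConnected ∧ Γ.IsFolded ∧
    (Nat.card Γ.E : ℝ) ≤ μ * (w.length : ℝ) ∧
    Γ.rank ≤ (L : ℤ) ∧
    (∃ x p y, Γ.IsPath x p y ∧ Γ.pathLabel p = w) ∧
    ∃ v, Γ.degree v < 2 * m

/-- The symmetrized closure of the tuple: all cyclic permutations of the words `rᵢ` and `rᵢ⁻¹`. -/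
def symmetrized {m n : ℕ} (r : Relators m n) : Set (List (Letter m)) :=
  {s | ∃ i, s ~r (r i).toWord ∨ s ~r ((r i)⁻¹).toWord}

/-- The `C'(lam)` small cancellation condition: a common initial segment `u` of two distinct
elements of the symmetrized closure (a piece) is shorter than `lam` times either of them. -/
def SmallCancellation {m n : ℕ} (lam : ℝ) (r : Relators m n) : Prop :=
  ∀ s ∈ symmetrized r, ∀ s' ∈ symmetrized r, s ≠ s' →
    ∀ u : List (Letter m), u <+: s → u <+: s' → (u.length : ℝ) < lam * (s.length : ℝ)

/-- `g` is a proper power. -/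
def IsProperPower {m : ℕ} (g : FreeGroup (Fin m)) : Prop :=
  ∃ (h : FreeGroup (Fin m)) (k : ℕ), 2 ≤ k ∧ g = h ^ k

/-- The `(lam, μ, L)`-condition on a tuple. -/
def SatisfiesCondition {m n : ℕ} (lam μ : ℝ) (L : ℕ) (r : Relators m n) : Prop :=
  SmallCancellation lam r ∧
  (∀ i, ¬ IsProperPower (r i)) ∧
  ∀ i, ∀ s : List (Letter m), s ~r (r i).toWord → ∀ w : List (Letter m), w <:+: s →
    ((r i).norm : ℝ) / 2 ≤ (w.length : ℝ) → ¬ IsReadableL μ L w ∧ ¬ IsReadable μ w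

/-- The standing constraints on the parameters. (They imply
`μ / (15 L + 3 μ) ≤ μ / (15 m + 3 μ) < 1 / 6`.) -/
def AdmissibleParameters (m L : ℕ) (lam μ : ℝ) : Prop :=
  m ≤ L ∧ 0 < μ ∧ μ ≤ 1 ∧ 0 < lam ∧ lam ≤ μ / (15 * (L : ℝ) + 3 * μ)

/-- The class `P_{m,n}` with parameters `lam, μ, L`: nontrivial cyclically reduced relators which
satisfy the `(lam, μ, L)`-condition and are longer than the number of generators. -/
def genericClass (m n : ℕ) (lam μ : ℝ) (L : ℕ) : Set (Relators m n) :=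
  {r | IsCyclicallyReducedTuple r ∧ SatisfiesCondition lam μ L r ∧ ∀ i, m < (r i).norm}

/-! ## Group-theoretic notions -/

/-- `H` is generated by (at most) `m` elements. -/
def IsGeneratedBy (m : ℕ) (H : Type*) [Group H] : Prop :=
  ∃ h : Fin m → H, Subgroup.closure (Set.range h) = ⊤

/-- Every injective endomorphism is onto. -/
def IsCoHopfian (G : Type*) [Group G] : Prop :=
  ∀ φ : G →* G, Function.Injective φ → Function.Surjective φ

/-- The automorphism `α` of `⟨a₁, …, a_m | r₁, …, rₙ⟩` is induced by an automorphism of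
`F(a₁, …, a_m)`. -/
def IsFreelyInduced {m n : ℕ} (r : Relators m n) (α : PresGroup r ≃* PresGroup r) : Prop :=
  ∃ β : FreeGroup (Fin m) ≃* FreeGroup (Fin m), ∀ x : FreeGroup (Fin m),
    α (PresentedGroup.mk (Set.range r) x) = PresentedGroup.mk (Set.range r) (β x)

end GenericGroups

end

/-! Rigidity (B) follows the graph method of Arzhantseva and Ol'shanskii. Given a homomorphism from
a free group of rank k ≤ m to G, wedge together loops labelled by lifts of the images of the
generators. This is a labelled graph of rank at most k whose fundamental group maps onto the image
(`exists_carries`). Among the graphs that carry the homomorphism up to conjugation, keep decreasing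
the number of edges by three moves: fold; prune a vertex of degree one; shorten.

The third move is the heart of the matter (`Carries.surjective_or_shorten`). Suppose a folded graph
reads a relator except for a remainder d of length at most 4 lam times that of the relator. The
subgraph spanned by this path is a rose with m petals, and then the lift is onto the free group;
otherwise it has a vertex of degree below 2m, and non-readability forces it to have many edges. As
the rank is bounded, many edges yield a long stretch whose inner vertices have degree two
(`exists_stretch`). The stretch is too long to be a piece, so the path traverses it only once
(`stretch_once`), and it can be exchanged for the shorter path d without changing the homomorphism
to G (`exists_shortening`).

When no move applies, either the lift is surjective or the graph reads no large part of a relator.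
In the latter case Greendlinger's lemma shows that its fundamental group embeds in G, so the image
is free. The same analysis with k < m shows that G needs m generators. Together with the Hopf
property of free groups this proves that G is not free, and the assertions about subgroups,
automorphisms and injective endomorphisms follow quickly.

Greendlinger's lemma (`greendlinger`) is proved without planar diagrams. From one vertex, repeatedly
attach all missing relator loops to a folded graph. Small cancellation keeps the graph folded and
saturated, meaning that a readable part of length 2 lam |s| of a relator s already lies on a closed
loop. A reduced path that leaves the old graph and comes back must run along nearly all of an
attached relator. An element of the normal closure is a closed path once enough layers are present,
so it contains a large part of some relator.

Genericity (A) is a count. Relators of length at most t/2, long repetitions inside a relator and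
long coincidences between two relators are exponentially rare, because part of the word is
determined by the rest. For readability, a folded graph with at most L vertices of full degree has a
short unreadable continuation after every edge, so it reads exponentially few words from each vertex
(`LGraph.Folded.card_readable_le`). Counting graphs is replaced by counting cosets of subgroups with
L short generators; for small μ the number of these cosets is outweighed by the rarity of the words
in each (`card_readablePrefixes_mul_le`). -/

noncomputable section

namespace GenericGroups

/-! ## Words -/

section Words

variable {α : Type*}

/-- The inverse letter. -/
def flipL (x : α × Bool) : α × Bool := (x.1, !x.2)

@[simp] theorem flipL_flipL (x : α × Bool) : flipL (flipL x) = x := by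
  simp [flipL]

theorem flipL_ne (x : α × Bool) : flipL x ≠ x := by
  intro h
  have := congrArg Prod.snd h
  simp [flipL] at this

theorem eq_flipL_iff {x y : α × Bool} : y = flipL x ↔ x.1 = y.1 ∧ x.2 ≠ y.2 := by
  obtain ⟨a, b⟩ := x
  obtain ⟨c, d⟩ := y
  simp only [flipL, Prod.mk.injEq]
  cases b <;> cases d <;> simp <;> exact eq_comm

open FreeGroup (IsReduced invRev)

@[simp] theorem invRev_nil' : invRev ([] : List (α × Bool)) = [] := rfl

theorem invRev_singleton' (x : α × Bool) : invRev [x] = [flipL x] := rfl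

theorem invRev_cons' (x : α × Bool) (w : List (α × Bool)) :
    invRev (x :: w) = invRev w ++ [flipL x] := by
  rw [FreeGroup.invRev_cons, invRev_singleton']

theorem invRev_concat' (x : α × Bool) (w : List (α × Bool)) :
    invRev (w ++ [x]) = flipL x :: invRev w := by
  rw [FreeGroup.invRev_append, invRev_singleton']; rfl

theorem isReduced_cons_cons' {x y : α × Bool} {w : List (α × Bool)} :
    IsReduced (x :: y :: w) ↔ y ≠ flipL x ∧ IsReduced (y :: w) := by
  rw [FreeGroup.isReduced_cons_cons, Ne, eq_flipL_iff]
  tauto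

theorem IsReduced.tail' {x : α × Bool} {w : List (α × Bool)} (h : IsReduced (x :: w)) :
    IsReduced w :=
  h.infix ⟨[x], [], by simp⟩

theorem IsReduced.left {u v : List (α × Bool)} (h : IsReduced (u ++ v)) : IsReduced u :=
  h.infix ⟨[], v, by simp⟩

theorem IsReduced.right {u v : List (α × Bool)} (h : IsReduced (u ++ v)) : IsReduced v :=
  h.infix ⟨u, [], by simp⟩

theorem not_isReduced_cancel {x : α × Bool} {u v : List (α × Bool)} :
    ¬ IsReduced (u ++ x :: flipL x :: v) := by
  intro h
  exact (isReduced_cons_cons'.1 (IsReduced.right h)).1 rfl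

theorem isReduced_invRev {w : List (α × Bool)} : IsReduced (invRev w) ↔ IsReduced w := by
  have key : ∀ w : List (α × Bool), IsReduced w → IsReduced (invRev w) := by
    intro w h
    rw [FreeGroup.isReduced_iff_not_step] at h ⊢
    intro L hL
    apply h (invRev L)
    have := hL.invRev
    rwa [FreeGroup.invRev_invRev] at this
  exact ⟨fun h => by simpa using key _ h, key w⟩

/-- Free groups are torsion free, hence contain no involution. -/
theorem invRev_ne_self {w : List (α × Bool)} (hw : IsReduced w) (hne : w ≠ []) :
    invRev w ≠ w := by
  intro h
  apply hne
  have h2 : (FreeGroup.mk w)⁻¹ = FreeGroup.mk w := by rw [FreeGroup.inv_mk, h]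
  have h3 : (FreeGroup.mk w) ^ 2 = 1 := by
    rw [pow_two]; nth_rewrite 1 [← h2]; exact inv_mul_cancel _
  have h4 : FreeGroup.mk w = 1 :=
    IsMulTorsionFree.pow_left_injective two_ne_zero (by simpa using h3)
  classical
  have h5 := congrArg FreeGroup.toWord h4
  rwa [FreeGroup.toWord_mk, hw.reduce_eq, FreeGroup.toWord_one] at h5

theorem invRev_eq_iff {u v : List (α × Bool)} : invRev u = v ↔ u = invRev v := by
  constructor
  · rintro rfl; simp
  · rintro rfl; simp

theorem invRev_eq_nil {u : List (α × Bool)} : invRev u = [] ↔ u = [] := by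
  rw [invRev_eq_iff]; rfl

/-- A symmetrized set of reduced words with the metric small cancellation condition. -/
structure SmallCancellationSet (lam : ℝ) (S : Set (List (α × Bool))) : Prop where
  red : ∀ s ∈ S, IsReduced s
  rot : ∀ a b, a ++ b ∈ S → b ++ a ∈ S
  inv : ∀ s ∈ S, invRev s ∈ S
  piece : ∀ s ∈ S, ∀ s' ∈ S, ∀ u, u <+: s → u <+: s' → lam * (s.length : ℝ) ≤ u.length → s = s'
  one_lt : ∀ s ∈ S, 1 < lam * (s.length : ℝ)
  pos : 0 < lam
  le : lam ≤ 1 / 33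
  letters : ∀ x, ∃ t, x :: t ∈ S

end Words

/-! ## Partial actions of a free group and Greendlinger's lemma -/

section Greendlinger

open FreeGroup (IsReduced invRev)

variable {α : Type*} {V : Type*}

/-- `Run E a w b`: the word `w` can be read from `a` to `b` along the edges of `E`. -/
def Run (E : V → α × Bool → V → Prop) : V → List (α × Bool) → V → Prop
  | a, [], b => a = b
  | a, x :: w, b => ∃ c, E a x c ∧ Run E c w b

/-- A folded graph: edges come in inverse pairs and are determined by origin and label. -/
structure PartialAction (E : V → α × Bool → V → Prop) : Prop where
  symm : ∀ a x b, E a x b → E b (flipL x) a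
  func : ∀ a x b c, E a x b → E a x c → b = c

theorem run_append {E : V → α × Bool → V → Prop} {u v : List (α × Bool)} {a b : V} :
    Run E a (u ++ v) b ↔ ∃ c, Run E a u c ∧ Run E c v b := by
  induction u generalizing a with
  | nil => simp [Run]
  | cons x u ih =>
    simp only [List.cons_append, Run, ih]
    constructor
    · rintro ⟨c, h1, d, h2, h3⟩; exact ⟨d, ⟨c, h1, h2⟩, h3⟩
    · rintro ⟨d, ⟨c, h1, h2⟩, h3⟩; exact ⟨c, h1, d, h2, h3⟩

theorem run_singleton {E : V → α × Bool → V → Prop} {x : α × Bool} {a b : V} :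
    Run E a [x] b ↔ E a x b := by
  simp [Run]

theorem run_map {V' : Type*} {E : V → α × Bool → V → Prop} {E' : V' → α × Bool → V' → Prop}
    (f : V → V') (hf : ∀ a x b, E a x b → E' (f a) x (f b)) {a b : V} {w : List (α × Bool)}
    (h : Run E a w b) : Run E' (f a) w (f b) := by
  induction w generalizing a with
  | nil => exact congrArg f h
  | cons x w ih =>
    obtain ⟨c, h1, h2⟩ := h
    exact ⟨f c, hf _ _ _ h1, ih h2⟩

namespace PartialAction

variable {E : V → α × Bool → V → Prop} (hE : PartialAction E)
include hE

theorem run_func {w : List (α × Bool)} {a b c : V} (h : Run E a w b) (h' : Run E a w c) :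
    b = c := by
  induction w generalizing a with
  | nil => exact h.symm.trans h'
  | cons x w ih =>
    obtain ⟨d, h1, h2⟩ := h
    obtain ⟨e, h3, h4⟩ := h'
    obtain rfl := hE.func _ _ _ _ h1 h3
    exact ih h2 h4

theorem run_invRev {w : List (α × Bool)} {a b : V} (h : Run E a w b) : Run E b (invRev w) a := by
  induction w generalizing a with
  | nil => exact h.symm
  | cons x w ih =>
    obtain ⟨d, h1, h2⟩ := h
    rw [invRev_cons', run_append]
    exact ⟨d, ih h2, a, hE.symm _ _ _ h1, rfl⟩

theorem run_cofunc {w : List (α × Bool)} {a b c : V} (h : Run E a w c) (h' : Run E b w c) :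
    a = b :=
  hE.run_func (hE.run_invRev h) (hE.run_invRev h')

theorem run_rotate {u v : List (α × Bool)} {a b : V} (h : Run E a (u ++ v) a) (hb : Run E a u b) :
    Run E b (v ++ u) b := by
  obtain ⟨c, h1, h2⟩ := run_append.1 h
  obtain rfl := hE.run_func h1 hb
  exact run_append.2 ⟨a, h2, hb⟩

/-- In a folded graph a cancelling pair of letters leads back to the vertex where it began. -/
theorem run_of_step {w w' : List (α × Bool)} (h : FreeGroup.Red.Step w w') {a b : V}
    (hr : Run E a w b) : Run E a w' b := by
  obtain ⟨⟩ := h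
  rename_i L1 L2 x c
  obtain ⟨d, h1, e, h2, f, h3, h4⟩ := run_append.1 hr
  have h2' := hE.symm _ _ _ h2
  obtain rfl := hE.func _ _ _ _ h2' h3
  exact run_append.2 ⟨d, h1, h4⟩

theorem run_of_red {w w' : List (α × Bool)} (h : FreeGroup.Red w w') {a b : V}
    (hr : Run E a w b) : Run E a w' b := by
  induction h with
  | refl => exact hr
  | tail _ hs ih => exact hE.run_of_step hs ih

end PartialAction

/-- Long enough parts of relators that can be read lie on closed relator loops. -/
def Saturated (lam : ℝ) (S : Set (List (α × Bool))) (E : V → α × Bool → V → Prop) : Prop :=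
  ∀ s ∈ S, ∀ u, u <+: s → 2 * lam * (s.length : ℝ) ≤ u.length → ∀ v v', Run E v u v' → Run E v s v

/-- `γ` is the unreadable part of a relator loop, to be attached from `y` to `z`. -/
structure Arc (S : Set (List (α × Bool))) (E : V → α × Bool → V → Prop) (y : V)
    (γ β : List (α × Bool)) (z : V) : Prop where
  mem : γ ++ β ∈ S
  run : Run E z β y
  ne : γ ≠ []
  head : ∀ x t, γ = x :: t → ∀ a, ¬ E y x a
  last : ∀ x t, γ = t ++ [x] → ∀ a, ¬ E a x z

namespace Arc

variable {S : Set (List (α × Bool))} {E : V → α × Bool → V → Prop} {lam : ℝ}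
  (hS : SmallCancellationSet lam S) (hE : PartialAction E) (hsat : Saturated lam S E)
include hS hE

theorem symm {y z : V} {γ β : List (α × Bool)} (h : Arc S E y γ β z) :
    Arc S E z (invRev γ) (invRev β) y where
  mem := by
    have := hS.inv _ (hS.rot _ _ h.mem)
    rwa [FreeGroup.invRev_append] at this
  run := hE.run_invRev h.run
  ne := fun h' => h.ne (invRev_eq_nil.1 h')
  head := by
    intro x t hx a ha
    rw [invRev_eq_iff, invRev_cons'] at hx
    exact h.last _ _ hx a (hE.symm _ _ _ ha)
  last := by
    intro x t hx a ha
    rw [invRev_eq_iff, invRev_concat'] at hx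
    exact h.head _ _ hx a (hE.symm _ _ _ ha)

include hsat in
-- If the readable part were longer, saturation would close the whole relator loop, and then the
-- first letter of the missing part could be read.
theorem length_lt {y z : V} {γ β : List (α × Bool)} (h : Arc S E y γ β z) :
    (β.length : ℝ) < 2 * lam * ((γ ++ β).length : ℝ) := by
  by_contra! hc
  have h1 := hS.rot _ _ h.mem
  have h2 := hsat _ h1 β ⟨γ, rfl⟩ (by rw [List.length_append, add_comm, ← List.length_append]; exact hc) _ _ h.run
  obtain ⟨c, h3, h4⟩ := run_append.1 h2
  obtain rfl := hE.run_func h3 h.run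
  obtain ⟨x, t, rfl⟩ := List.exists_cons_of_ne_nil h.ne
  obtain ⟨d, h5, -⟩ := h4
  exact h.head _ _ rfl _ h5

/-- Small cancellation makes the two relators equal. The arcs then end at the same letter: if one
were longer, its last letter would belong to the readable part of the other. -/
theorem unique {y z z' : V} {γ β γ' β' : List (α × Bool)} (h : Arc S E y γ β z)
    (h' : Arc S E y γ' β' z') {p : List (α × Bool)} (hp : p <+: γ) (hp' : p <+: γ')
    (hl : lam * ((γ ++ β).length : ℝ) ≤ p.length) : γ = γ' ∧ β = β' ∧ z = z' := by
  have heq : γ ++ β = γ' ++ β' := hS.piece _ h.mem _ h'.mem p (hp.trans (List.prefix_append _ _))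
    (hp'.trans (List.prefix_append _ _)) hl
  have key : ∀ {z z' : V} {γ β γ' β' : List (α × Bool)}, Arc S E y γ β z → Arc S E y γ' β' z' →
      γ ++ β = γ' ++ β' → ∀ c, γ = γ' ++ c → γ = γ' := by
    intro z z' γ β γ' β' h h' heq c hc
    rcases List.eq_nil_or_concat c with rfl | ⟨c', x, rfl⟩
    · simpa using hc
    · exfalso
      subst hc
      have hb : β' = c' ++ [x] ++ β := by simpa using heq.symm
      have := h'.run
      rw [hb] at this
      obtain ⟨d, h1, h2⟩ := run_append.1 this
      obtain ⟨e, h3, h4⟩ := run_append.1 h1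
      obtain rfl := hE.run_cofunc h2 h.run
      exact h.last x (γ' ++ c') (by simp) e (run_singleton.1 h4)
  have hγ : γ = γ' := by
    rcases List.append_eq_append_iff.1 heq with ⟨c, hc, -⟩ | ⟨c, hc, -⟩
    · exact (key h' h heq.symm c hc).symm
    · exact key h h' heq c hc
  subst hγ
  have hβ : β = β' := by simpa using heq
  subst hβ
  exact ⟨rfl, rfl, hE.run_cofunc h.run h'.run⟩

end Arc

/-- The length of the half of `γ` hanging at its origin. -/
def halfLength (γ : List (α × Bool)) : ℕ :=
  open Classical in
  if WellOrderingRel γ (invRev γ) then γ.length / 2 else (γ.length - 1) / 2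

/-- Each inner vertex of an arc must be named from exactly one of its two feet. For an arc of even
length the well-order decides which foot gets the middle vertex; the summand 1 is the edge joining
the two halves. -/
theorem halfLength_add {γ : List (α × Bool)} (hne : γ ≠ []) (hr : IsReduced γ) :
    halfLength γ + halfLength (invRev γ) + 1 = γ.length := by
  have hpos : 0 < γ.length := List.length_pos_iff.2 hne
  have hne' := invRev_ne_self hr hne
  unfold halfLength
  rw [FreeGroup.invRev_invRev, FreeGroup.invRev_length]
  rcases trichotomous_of (WellOrderingRel (α := List (α × Bool))) γ (invRev γ) with h | h | h
  · have h' : ¬ WellOrderingRel (invRev γ) γ := asymm_of _ h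
    rw [if_pos h, if_neg h']; omega
  · exact absurd h.symm hne'
  · have h' : ¬ WellOrderingRel γ (invRev γ) := asymm_of _ h
    rw [if_pos h, if_neg h']; omega

theorem le_halfLength (γ : List (α × Bool)) : γ.length ≤ 2 * halfLength γ + 2 := by
  unfold halfLength; split_ifs <;> omega

/-- The vertex `(y, q)` lies on a new arc. -/
def OnArc (S : Set (List (α × Bool))) (E : V → α × Bool → V → Prop) (y : V)
    (q : List (α × Bool)) : Prop :=
  ∃ γ β z, Arc S E y γ β z ∧ q <+: γ ∧ q.length ≤ halfLength γ

/-- The graph obtained from `E` by attaching all the missing relator loops. -/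
inductive Attach (S : Set (List (α × Bool))) (E : V → α × Bool → V → Prop) :
    V × List (α × Bool) → α × Bool → V × List (α × Bool) → Prop
  | old {y x z} : E y x z → Attach S E (y, []) x (z, [])
  | up {y q x} : OnArc S E y (q ++ [x]) → Attach S E (y, q) x (y, q ++ [x])
  | down {y q x} : OnArc S E y (q ++ [x]) → Attach S E (y, q ++ [x]) (flipL x) (y, q)
  | mid {y p x t β z} : Arc S E y (p ++ x :: t) β z → p.length = halfLength (p ++ x :: t) →
      Attach S E (y, p) x (z, invRev t)

end Greendlinger

/-! ### Attaching the missing relator loops to a saturated folded graph -/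

section Greendlinger

open FreeGroup (IsReduced invRev)

variable {α : Type*} {V : Type*}

variable {S : Set (List (α × Bool))} {E : V → α × Bool → V → Prop} {lam : ℝ}
  (hS : SmallCancellationSet lam S) (hE : PartialAction E) (hsat : Saturated lam S E)
include hS hE hsat

theorem Arc.lt_length {y z : V} {γ β : List (α × Bool)} (h : Arc S E y γ β z) :
    (1 - 2 * lam) * ((γ ++ β).length : ℝ) < γ.length := by
  have := h.length_lt hS hE hsat
  rw [List.length_append] at this ⊢
  push_cast at this ⊢
  linarith

/-- Each half remains longer than a piece even after the part near its foot, where different arcs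
may share an initial segment, has been cut off. -/
theorem Arc.le_half {y z : V} {γ β : List (α × Bool)} (h : Arc S E y γ β z) :
    3 * lam * ((γ ++ β).length : ℝ) ≤ halfLength γ := by
  have h1 := h.lt_length hS hE hsat
  have h2 : (γ.length : ℝ) ≤ 2 * halfLength γ + 2 := by exact_mod_cast le_halfLength γ
  have h3 := hS.one_lt _ h.mem
  have h4 := hS.le
  have h5 : (0 : ℝ) ≤ ((γ ++ β).length : ℝ) := Nat.cast_nonneg _
  nlinarith

theorem Arc.half_pos {y z : V} {γ β : List (α × Bool)} (h : Arc S E y γ β z) :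
    0 < halfLength γ := by
  have h1 := h.le_half hS hE hsat
  have h3 := hS.one_lt _ h.mem
  have : (0 : ℝ) < halfLength γ := by linarith
  exact_mod_cast this

/-- Uniqueness of arcs in terms of an initial segment of half the length. -/
theorem Arc.unique_half {y z z' : V} {γ β γ' β' p : List (α × Bool)} (h : Arc S E y γ β z)
    (h' : Arc S E y γ' β' z') (hp : p <+: γ) (hp' : p <+: γ') (hl : halfLength γ ≤ p.length) :
    γ = γ' ∧ β = β' ∧ z = z' := by
  refine h.unique hS hE h' hp hp' ?_
  have h1 := h.le_half hS hE hsat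
  have h2 : (halfLength γ : ℝ) ≤ p.length := by exact_mod_cast hl
  have h3 := hS.one_lt _ h.mem
  linarith

/-- Two edges with the same origin and label could clash in few ways: an arc starts with a letter
unreadable at its foot, relators are reduced, and two arcs that agree up to the middle coincide. -/
theorem attach_func_aux {a b c : V × List (α × Bool)} {x : α × Bool} (h : Attach S E a x b)
    (h' : Attach S E a x c) : b = c := by
  have noup : ∀ {y z : V} {x : α × Bool}, E y x z → ¬ OnArc S E y [x] := by
    rintro y z x hx ⟨γ, β, z', hγ, ⟨t, rfl⟩, -⟩
    exact hγ.head x t rfl _ hx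
  have updown : ∀ {y : V} {q : List (α × Bool)} {x : α × Bool},
      ¬ OnArc S E y ((q ++ [flipL x]) ++ [x]) := by
    rintro y q x ⟨γ, β, z', hγ, ⟨t, ht⟩, -⟩
    have hr := hS.red _ hγ.mem
    rw [← ht] at hr
    have : IsReduced (q ++ flipL x :: flipL (flipL x) :: (t ++ β)) := by simpa using hr
    exact not_isReduced_cancel this
  have upmid : ∀ {y : V} {p t β : List (α × Bool)} {x : α × Bool} {z : V},
      Arc S E y (p ++ x :: t) β z → p.length = halfLength (p ++ x :: t) →
      ¬ OnArc S E y (p ++ [x]) := by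
    rintro y p t β x z hγ hl ⟨γ', β', z', hγ', hp, hl'⟩
    obtain ⟨rfl, -, -⟩ := hγ.unique_half hS hE hsat hγ' (p := p ++ [x]) ⟨t, by simp⟩ hp (by simp; omega)
    simp at hl'; omega
  have midpos : ∀ {y : V} {t β : List (α × Bool)} {x : α × Bool} {z : V},
      Arc S E y ([] ++ x :: t) β z → ([] : List (α × Bool)).length = halfLength ([] ++ x :: t) →
      False := by
    intro y t β x z hγ hl
    have := hγ.half_pos hS hE hsat
    rw [← hl] at this
    simp at this
  have downmid : ∀ {y : V} {q t β : List (α × Bool)} {x : α × Bool} {z : V},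
      ¬ Arc S E y ((q ++ [x]) ++ flipL x :: t) β z := by
    intro y q t β x z hγ
    have hr := hS.red _ hγ.mem
    have : IsReduced (q ++ x :: flipL x :: (t ++ β)) := by simpa using hr
    exact not_isReduced_cancel this
  cases h with
  | old h1 =>
    generalize ha : (_, []) = a at h'
    cases h' with
    | old h2 =>
      obtain ⟨rfl, -⟩ := Prod.mk.inj ha
      rw [hE.func _ _ _ _ h1 h2]
    | up h2 =>
      obtain ⟨rfl, rfl⟩ := Prod.mk.inj ha
      exact absurd h2 (noup h1)
    | down h2 => simp at ha
    | mid h2 h3 =>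
      obtain ⟨rfl, rfl⟩ := Prod.mk.inj ha
      exact (midpos h2 h3).elim
  | up h1 =>
    generalize ha : (_, _) = a at h'
    cases h' with
    | old h2 =>
      obtain ⟨rfl, rfl⟩ := Prod.mk.inj ha
      exact absurd h1 (noup h2)
    | up h2 =>
      obtain ⟨rfl, rfl⟩ := Prod.mk.inj ha
      rfl
    | down h2 =>
      obtain ⟨rfl, rfl⟩ := Prod.mk.inj ha
      rename_i x
      have h1' := h1
      rw [← flipL_flipL x] at h1'
      simp only [flipL_flipL] at h1'
      exact absurd (by simpa using h1) (updown (x := flipL x) (q := _) (y := _))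
    | mid h2 h3 =>
      obtain ⟨rfl, rfl⟩ := Prod.mk.inj ha
      exact absurd h1 (upmid h2 h3)
  | @down y q x h1 =>
    generalize ha : (_, _) = a at h'
    generalize hx : flipL x = x' at h'
    cases h' with
    | old h2 => simp at ha
    | up h2 =>
      obtain ⟨rfl, rfl⟩ := Prod.mk.inj ha
      subst hx
      exact absurd (by simpa using h2) (updown (x := flipL x) (q := q) (y := y))
    | @down y' q' x' h2 =>
      obtain ⟨rfl, h3⟩ := Prod.mk.inj ha
      obtain ⟨rfl, -⟩ := List.append_inj' h3 rfl
      rfl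
    | mid h2 h3 =>
      obtain ⟨rfl, rfl⟩ := Prod.mk.inj ha
      subst hx
      exact absurd h2 downmid
  | @mid y p x t β z h1 h1' =>
    generalize ha : (_, _) = a at h'
    generalize hx : x = x' at h'
    cases h' with
    | old h2 =>
      obtain ⟨rfl, rfl⟩ := Prod.mk.inj ha
      exact (midpos h1 h1').elim
    | up h2 =>
      obtain ⟨rfl, rfl⟩ := Prod.mk.inj ha
      subst hx
      exact absurd h2 (upmid h1 h1')
    | @down y' q' x' h2 =>
      obtain ⟨rfl, rfl⟩ := Prod.mk.inj ha
      subst hx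
      exact absurd h1 downmid
    | @mid y' p' x' t' β' z' h2 h2' =>
      obtain ⟨rfl, rfl⟩ := Prod.mk.inj ha
      subst hx
      obtain ⟨h3, rfl, rfl⟩ := h1.unique_half hS hE hsat h2 (p := p ++ [x]) ⟨t, by simp⟩
        ⟨t', by simp⟩ (by simp; omega)
      simp at h3
      rw [h3]

theorem attach_partialAction : PartialAction (Attach S E) where
  func := fun _ _ _ _ h h' => attach_func_aux hS hE hsat h h'
  symm := by
    intro a x b h
    cases h with
    | old h => exact .old (hE.symm _ _ _ h)
    | up h => exact .down h
    | down h => rw [flipL_flipL]; exact .up h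
    -- The reverse of a middle edge is the middle edge of the inverse arc, because the two half
    -- lengths and this edge add up to the length of the arc.
    | @mid y p x t β z h hl =>
      have h2 := h.symm hS hE
      have h3 : invRev (p ++ x :: t) = invRev t ++ flipL x :: invRev p := by
        rw [FreeGroup.invRev_append, invRev_cons']; simp
      have h4 := halfLength_add h.ne (IsReduced.left (hS.red _ h.mem))
      rw [h3] at h2 h4
      have := Attach.mid h2 (by simp at h4 ⊢; omega)
      rwa [FreeGroup.invRev_invRev] at this

omit hS hE hsat in
theorem run_up {y z : V} {γ β : List (α × Bool)} (h : Arc S E y γ β z) {p : List (α × Bool)}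
    (hp : p <+: γ) (hl : p.length ≤ halfLength γ) : Run (Attach S E) (y, []) p (y, p) := by
  induction p using List.reverseRecOn with
  | nil => rfl
  | append_singleton p x ih =>
    refine run_append.2 ⟨(y, p), ih ((List.prefix_append _ _).trans hp) (by simp at hl; omega), ?_⟩
    exact run_singleton.2 (.up ⟨γ, β, z, h, hp, hl⟩)

/-- The path climbs one half, crosses the middle edge and comes down the half that is named from the
other foot. -/
theorem run_arc {y z : V} {γ β : List (α × Bool)} (h : Arc S E y γ β z) :
    Run (Attach S E) (y, []) γ (z, []) := by
  have h4 := halfLength_add h.ne (IsReduced.left (hS.red _ h.mem))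
  obtain ⟨p, x, t, rfl, hp⟩ : ∃ p x t, γ = p ++ x :: t ∧ p.length = halfLength γ := by
    have hlt : halfLength γ < γ.length := by omega
    refine ⟨γ.take (halfLength γ), γ[halfLength γ], γ.drop (halfLength γ + 1), ?_, ?_⟩
    · rw [List.getElem_cons_drop, List.take_append_drop]
    · simp; omega
  have h3 : invRev (p ++ x :: t) = invRev t ++ flipL x :: invRev p := by
    rw [FreeGroup.invRev_append, invRev_cons']; simp
  have h5 := h.symm hS hE
  rw [h3] at h4 h5
  refine run_append.2 ⟨_, run_up h ⟨_, rfl⟩ hp.le, _, .mid h hp, ?_⟩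
  have := (attach_partialAction hS hE hsat).run_invRev (run_up h5 (p := invRev t) ⟨_, rfl⟩ (by
    simp at h4 ⊢; omega))
  rwa [FreeGroup.invRev_invRev] at this

omit hS hE hsat in
theorem run_old {y z : V} {w : List (α × Bool)} (h : Run E y w z) :
    Run (Attach S E) (y, []) w (z, []) :=
  run_map (fun y => (y, [])) (fun _ _ _ h => .old h) h

theorem run_arc_loop {y z : V} {γ β : List (α × Bool)} (h : Arc S E y γ β z) :
    Run (Attach S E) (y, []) (γ ++ β) (y, []) :=
  run_append.2 ⟨_, run_arc hS hE hsat h, run_old h.run⟩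

/-- All relator loops are closed at old vertices. -/
theorem run_loop (y : V) {s : List (α × Bool)} (hs : s ∈ S) :
    Run (Attach S E) (y, []) s (y, []) := by
  have hpos : ∀ s ∈ S, 2 * lam * (s.length : ℝ) ≤ s.length := by
    intro s _
    have := hS.le
    have h5 : (0 : ℝ) ≤ (s.length : ℝ) := Nat.cast_nonneg _
    nlinarith
  -- the longest readable prefix
  have h1 : ∀ w : List (α × Bool), (∃ z, Run E y w z) ∨
      ∃ u x t z, w = u ++ x :: t ∧ Run E y u z ∧ ∀ a, ¬ E z x a := by
    intro w
    induction w using List.reverseRecOn with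
    | nil => exact .inl ⟨y, rfl⟩
    | append_singleton w x ih =>
      rcases ih with ⟨z, hz⟩ | ⟨u, x', t, z, rfl, h1, h2⟩
      · by_cases hx : ∃ a, E z x a
        · obtain ⟨a, ha⟩ := hx
          exact .inl ⟨a, run_append.2 ⟨z, hz, run_singleton.2 ha⟩⟩
        · exact .inr ⟨w, x, [], z, rfl, hz, fun a ha => hx ⟨a, ha⟩⟩
      · exact .inr ⟨u, x', t ++ [x], z, by simp, h1, h2⟩
  -- Symmetrically, the longest suffix that can be read into `y`. What is left between the two is
  -- the arc.
  have h2 : ∀ w : List (α × Bool), (∃ z, Run E z w y) ∨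
      ∃ u x t z, w = u ++ x :: t ∧ Run E z t y ∧ ∀ a, ¬ E a x z := by
    intro w
    induction w with
    | nil => exact .inl ⟨y, rfl⟩
    | cons x w ih =>
      rcases ih with ⟨z, hz⟩ | ⟨u, x', t, z, rfl, h1, h2⟩
      · by_cases hx : ∃ a, E a x z
        · obtain ⟨a, ha⟩ := hx
          exact .inl ⟨a, z, ha, hz⟩
        · exact .inr ⟨[], x, w, z, rfl, hz, fun a ha => hx ⟨a, ha⟩⟩
      · exact .inr ⟨x :: u, x', t, z, by simp, h1, h2⟩
  rcases h1 s with ⟨z, hz⟩ | ⟨u, x, t, y1, rfl, hu, hx⟩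
  · exact run_old (hsat s hs s (List.prefix_refl s) (hpos s hs) _ _ hz)
  have hrot := hS.rot _ _ hs
  rcases h2 (x :: t) with ⟨z, hz⟩ | ⟨v, x', t', z, hv, ht', hx'⟩
  -- A relator readable as a whole from some vertex is closed by saturation, so the letter `x` would
  -- be readable after all.
  · exfalso
    have h3 := hsat _ hrot _ (List.prefix_refl _) (hpos _ hrot) _ _ (run_append.2 ⟨y, hz, hu⟩)
    have h4 := run_append.1 (hE.run_rotate h3 hz)
    obtain ⟨d, hd, a, ha, -⟩ := h4
    obtain rfl := hE.run_func hu hd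
    exact hx a ha
  -- The readable suffix followed by the readable prefix passes through `y` and serves as the old
  -- part of the rotated relator.
  · have harc : Arc S E y1 (v ++ [x']) (t' ++ u) z :=
      { mem := by
          rw [hv] at hrot
          simpa using hrot
        run := run_append.2 ⟨y, ht', hu⟩
        ne := by simp
        head := by
          intro x1 t1 h a ha
          cases v with
          | nil =>
            simp at h hv
            rw [← h.1, ← hv.1] at ha
            exact hx a ha
          | cons b v =>
            simp at h hv
            rw [← h.1, ← hv.1] at ha
            exact hx a ha
        last := by
          intro x1 t1 h a ha
          obtain ⟨-, h⟩ := List.append_inj' h rfl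
          simp at h
          rw [← h] at ha
          exact hx' a ha }
    have h5 := run_arc_loop hS hE hsat harc
    have h6 : (v ++ [x']) ++ (t' ++ u) = (x :: t) ++ u := by rw [hv]; simp
    rw [h6] at h5
    obtain ⟨c, h7, h8⟩ := run_append.1 h5
    have h9 := (attach_partialAction hS hE hsat).run_cofunc h8 (run_old hu)
    subst h9
    exact run_append.2 ⟨_, h8, h7⟩

omit hsat in
/-- Descent: a reduced path going down an arc follows it until near to its foot. -/
theorem descent {y z : V} {p t β : List (α × Bool)} {x : α × Bool}
    (h : Arc S E y (p ++ x :: t) β z) (hp : p.length ≤ halfLength (p ++ x :: t))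
    {w : List (α × Bool)} (hw : IsReduced (flipL x :: w)) {v : V × List (α × Bool)}
    (hr : Run (Attach S E) (y, p) w v) :
    (∃ p', p = p' ++ invRev w ∧ v = (y, p')) ∨
    ∃ p1 p2, p = p1 ++ p2 ∧ (p1.length : ℝ) < lam * ((p ++ x :: t ++ β).length : ℝ) ∧
      invRev p2 <+: w := by
  have hlam := hS.pos
  induction p using List.reverseRecOn generalizing x t w with
  | nil =>
    right
    refine ⟨[], [], rfl, ?_, List.nil_prefix⟩
    have := hS.one_lt _ h.mem
    simpa using lt_trans zero_lt_one this
  | append_singleton p x0 ih =>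
    -- Below height lam times the length of the relator several arcs may share their edges and
    -- control is lost; above it the position determines the arc.
    by_cases hlt : (((p ++ [x0]).length : ℕ) : ℝ) < lam * ((p ++ [x0] ++ x :: t ++ β).length : ℝ)
    · exact .inr ⟨p ++ [x0], [], by simp, hlt, List.nil_prefix⟩
    rw [not_lt] at hlt
    cases w with
    | nil => exact .inl ⟨p ++ [x0], by simp, hr.symm⟩
    | cons x1 w =>
      obtain ⟨c, hc, hr⟩ := hr
      generalize ha : (y, p ++ [x0]) = a at hc
      cases hc with
      | old h2 => simp at ha
      | up h2 =>
        obtain ⟨rfl, rfl⟩ := Prod.mk.inj ha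
        obtain ⟨γ', β', z', hγ', hpre, hl⟩ := h2
        -- Moving up again would continue along the same arc, which cancels the letter just read.
        obtain ⟨rfl, -, -⟩ := h.unique hS hE hγ' (p := p ++ [x0]) ⟨_, rfl⟩
          ((List.prefix_append _ _).trans hpre) hlt
        obtain ⟨t', ht'⟩ := hpre
        simp at ht'
        rw [ht'.1] at hw
        exact absurd hw (by rw [isReduced_cons_cons']; simp)
      | mid h2 h3 =>
        obtain ⟨rfl, rfl⟩ := Prod.mk.inj ha
        obtain ⟨h4, -, -⟩ := h.unique hS hE h2 (p := p ++ [x0]) ⟨_, rfl⟩ ⟨_, rfl⟩ hlt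
        simp at h4
        rw [h4.1] at hw
        exact absurd hw (by rw [isReduced_cons_cons']; simp)
      | @down y' q' x' h2 =>
        obtain ⟨rfl, h3⟩ := Prod.mk.inj ha
        obtain ⟨rfl, h3⟩ := List.append_inj' h3 rfl
        simp at h3
        subst h3
        have hassoc : p ++ [x0] ++ x :: t = p ++ x0 :: (x :: t) := by simp
        have h' := h
        rw [hassoc] at h'
        rcases ih h' (by rw [← hassoc]; rw [List.length_append] at hp; omega) (IsReduced.tail' hw) hr with
          ⟨p', rfl, rfl⟩ | ⟨p1, p2, rfl, h4, h5⟩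
        · refine .inl ⟨p', ?_, rfl⟩
          rw [invRev_cons']; simp
        · refine .inr ⟨p1, p2 ++ [x0], by simp, ?_, ?_⟩
          · rw [hassoc]; exact h4
          · rw [invRev_concat']
            exact List.cons_prefix_cons.2 ⟨rfl, h5⟩

end Greendlinger

/-! ### Saturation persists, and returning paths contain large parts of relators -/

section Greendlinger

open FreeGroup (IsReduced invRev)

variable {α : Type*} {V : Type*}

variable {S : Set (List (α × Bool))} {E : V → α × Bool → V → Prop} {lam : ℝ}

/-- If a path labelled by part of a relator follows a closed relator loop for long enough, then the
relator is read along a closed loop. -/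
theorem PartialAction.closed_of_overlap (hS : SmallCancellationSet lam S) (hE : PartialAction E)
    {s s1 a c d : List (α × Bool)} {v v1 v' : V} (hs : s ∈ S) (hu : a ++ c ++ d <+: s)
    (hr : Run E v (a ++ c ++ d) v') (ha : Run E v a v1) (hs1 : s1 ∈ S) (hc : c <+: s1)
    (hl : Run E v1 s1 v1) (hlen : lam * (s.length : ℝ) ≤ c.length ∨
      lam * (s1.length : ℝ) ≤ c.length) : Run E v s v := by
  obtain ⟨e, rfl⟩ := hu
  have hrot : c ++ (d ++ e ++ a) ∈ S := by
    have := hS.rot a (c ++ d ++ e) (by simpa using hs)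
    simpa using this
  have heq : c ++ (d ++ e ++ a) = s1 := by
    rcases hlen with h | h
    · refine hS.piece _ hrot _ hs1 c (List.prefix_append _ _) hc ?_
      convert h using 3
      simp; omega
    · exact (hS.piece _ hs1 _ hrot c hc (List.prefix_append _ _) h).symm
  subst heq
  have h1 : Run E v1 ((c ++ d ++ e) ++ a) v1 := by simpa using hl
  obtain ⟨w, h2, h3⟩ := run_append.1 h1
  obtain rfl := hE.run_cofunc h3 ha
  have := run_append.2 ⟨_, ha, h2⟩
  simpa using this

/-- A reduced path using only edges going up or down first goes down, and then up. -/
theorem down_up {y : V} {q w : List (α × Bool)} {v : V × List (α × Bool)}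
    (hw : IsReduced w) (hr : Run (Attach S E) (y, q) w v)
    (hold : ∀ a b z, w = a ++ b → ¬ Run (Attach S E) (y, q) a (z, []))
    (hmid : ∀ a b x p t β z y', w = a ++ x :: b → Run (Attach S E) (y, q) a (y', p) →
      Arc S E y' (p ++ x :: t) β z → p.length ≠ halfLength (p ++ x :: t)) :
    ∃ a b r, w = a ++ b ∧ q = r ++ invRev a ∧ Run (Attach S E) (y, q) a (y, r) ∧
      (a ≠ [] → OnArc S E y q) ∧ (b ≠ [] → OnArc S E y (r ++ b)) := by
  induction w generalizing q with
  | nil => exact ⟨[], [], q, rfl, by simp, rfl, by simp, by simp⟩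
  | cons x w ih =>
    obtain ⟨c, hc, hr⟩ := hr
    have hw' := IsReduced.tail' hw
    have hstep := hc
    generalize ha : (y, q) = a at hc
    cases hc with
    | old h2 =>
      obtain ⟨rfl, rfl⟩ := Prod.mk.inj ha
      exact absurd rfl (hold [] (x :: w) y rfl)
    | up h2 =>
      obtain ⟨rfl, rfl⟩ := Prod.mk.inj ha
      obtain ⟨a, b, r, rfl, hq, hra, ha', hb'⟩ := ih hw' hr
        (fun a b z hab hz => hold (x :: a) b z (by simp [hab]) ⟨_, hstep, hz⟩)
        (fun a b x' p t β z y' hab h3 h4 => hmid (x :: a) b x' p t β z y' (by simp [hab])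
          ⟨_, hstep, h3⟩ h4)
      cases a with
      | nil =>
        refine ⟨[], x :: b, q, rfl, by simp, rfl, by simp, fun _ => ?_⟩
        simp at hq
        subst hq
        by_cases hb : b = []
        · subst hb; exact h2
        · simpa using hb' hb
      | cons x' a =>
        exfalso
        rw [invRev_cons', ← List.append_assoc] at hq
        obtain ⟨-, h5⟩ := List.append_inj' hq rfl
        simp at h5
        subst h5
        have : IsReduced (flipL x' :: x' :: (a ++ b)) := hw
        rw [isReduced_cons_cons'] at this
        simp at this
    | @down y' q' x' h2 =>
      obtain ⟨rfl, rfl⟩ := Prod.mk.inj ha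
      obtain ⟨a, b, r, rfl, rfl, hra, ha', hb'⟩ := ih hw' hr
        (fun a b z hab hz => hold (_ :: a) b z (by simp [hab]) ⟨_, hstep, hz⟩)
        (fun a b x' p t β z y' hab h3 h4 => hmid (_ :: a) b x' p t β z y' (by simp [hab])
          ⟨_, hstep, h3⟩ h4)
      exact ⟨flipL x' :: a, b, r, rfl, by rw [invRev_cons']; simp, ⟨_, hstep, hra⟩, fun _ => h2, hb'⟩
    | mid h2 h3 =>
      obtain ⟨rfl, rfl⟩ := Prod.mk.inj ha
      exact absurd h3 (hmid [] w x _ _ _ _ _ rfl rfl h2)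

variable (hS : SmallCancellationSet lam S) (hE : PartialAction E) (hsat : Saturated lam S E)
include hS hE hsat

/-- The relator loop through a vertex on an arc. -/
theorem run_loop_of_onArc {y : V} {q : List (α × Bool)} (h : OnArc S E y q) :
    ∃ e, q ++ e ∈ S ∧ Run (Attach S E) (y, []) (q ++ e) (y, []) ∧
      Run (Attach S E) (y, []) q (y, q) := by
  obtain ⟨γ, β, z, hγ, ⟨t, rfl⟩, hl⟩ := h
  exact ⟨t ++ β, by simpa using hγ.mem, run_loop hS hE hsat y (by simpa using hγ.mem),
    run_up hγ ⟨t, rfl⟩ hl⟩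

/-- The path meets an old vertex, crosses the middle of an arc, or goes down and then up over one
foot. In the last case one of the two legs has at least half of the length 2 lam |s|, hence is not a
piece. In each case a sufficient overlap with a closed relator loop identifies the relators. -/
theorem attach_saturated : Saturated lam S (Attach S E) := by
  intro s hs u hu hlen v v' hr
  have hP := attach_partialAction hS hE hsat
  have hured : IsReduced u := (hS.red s hs).infix hu.isInfix
  by_contra hcon
  -- no vertex of the path is old
  have hold : ∀ a b z, u = a ++ b → ¬ Run (Attach S E) v a (z, []) := by
    rintro a b z rfl ha
    obtain ⟨e, rfl⟩ := hu
    apply hcon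
    have h1 : b ++ e ++ a ∈ S := hS.rot a (b ++ e) (by simpa using hs)
    obtain ⟨w, h2, h3⟩ := run_append.1 (run_loop hS hE hsat z h1)
    obtain rfl := hP.run_cofunc h3 ha
    have := run_append.2 ⟨_, ha, h2⟩
    simpa using this
  have key := fun {s1 a c d} {v1} => hP.closed_of_overlap (s := s) (s1 := s1) (a := a) (c := c)
    (d := d) (v := v) (v1 := v1) (v' := v') hS hs
  -- no edge in the middle of an arc is used
  have hmid : ∀ a b x p t β z y', u = a ++ x :: b → Run (Attach S E) v a (y', p) →
      Arc S E y' (p ++ x :: t) β z → p.length ≠ halfLength (p ++ x :: t) := by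
    rintro a b x p t β z y' rfl ha harc hp
    apply hcon
    have h4 := halfLength_add harc.ne (IsReduced.left (hS.red _ harc.mem))
    have h3 : invRev (p ++ x :: t) = invRev t ++ flipL x :: invRev p := by
      rw [FreeGroup.invRev_append, invRev_cons']; simp
    have harc' := harc.symm hS hE
    have hhalf := harc.le_half hS hE hsat
    have hhalf' := harc'.le_half hS hE hsat
    rw [h3] at h4 harc' hhalf'
    have hlp := hS.one_lt _ harc.mem
    rw [← hp] at hhalf
    have ht : (invRev t).length = halfLength (invRev t ++ flipL x :: invRev p) := by
      simp at h4 ⊢; omega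
    rw [← ht] at hhalf'
    have hstep := Attach.mid harc hp
    obtain ⟨v1, ha1, hb1⟩ := run_append.1 hr
    obtain rfl := hP.run_func ha1 ha
    obtain ⟨v2, hx, hb⟩ := hb1
    obtain rfl := hP.func _ _ _ _ hx hstep
    have hb2 := descent hS hE harc' ht.le
      (by rw [flipL_flipL]; exact IsReduced.right hured) hb
    have ha2 := descent hS hE harc hp.le (w := invRev a) (by
      have : IsReduced (a ++ [x]) := hured.infix ⟨[], b, by simp⟩
      rw [← isReduced_invRev, invRev_concat'] at this
      exact this) (hP.run_invRev ha)
    have hloop := run_arc_loop hS hE hsat harc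
    have hup := run_up harc (p := p) ⟨_, rfl⟩ hp.le
    rcases hb2 with ⟨t', ht', rfl⟩ | ⟨p1, p2, hp12, hp1, hp2⟩
    · rcases ha2 with ⟨p', hp', rfl⟩ | ⟨p1, p2, hp12, hp1, hp2⟩
      · -- the whole path lies on the arc
        rw [FreeGroup.invRev_invRev] at hp'
        rw [invRev_eq_iff, FreeGroup.invRev_append, FreeGroup.invRev_invRev] at ht'
        subst hp' ht'
        have hup' := run_up harc (p := p') ⟨a ++ x :: (b ++ invRev t'), by simp⟩ (by
          rw [← hp]; simp)
        refine key (s1 := (a ++ x :: b) ++ (invRev t' ++ β ++ p')) (a := []) (c := a ++ x :: b)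
          (d := []) (by simpa using hu) (by simpa using hr) rfl ?_ ⟨_, rfl⟩ ?_ (.inl ?_)
        · have := hS.rot p' (a ++ x :: b ++ (invRev t' ++ β)) (by simpa using harc.mem)
          simpa using this
        · have := hP.run_rotate (u := p') (v := a ++ x :: b ++ (invRev t' ++ β))
            (by simpa using hloop) hup'
          simpa using this
        · have := hS.one_lt s hs
          linarith
      · -- long overlap at the end of `a`
        obtain ⟨e, he⟩ := hp2
        rw [eq_comm, invRev_eq_iff, FreeGroup.invRev_append, FreeGroup.invRev_invRev] at he
        subst he hp12
        have hup' := run_up harc (p := p1) ⟨p2 ++ x :: t, by simp⟩ (by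
          rw [← hp]; simp)
        obtain ⟨v3, h5, h6⟩ := run_append.1 ha
        have h7 := hP.run_rotate (u := p1) (v := p2 ++ (x :: t ++ β)) (by simpa using hloop) hup'
        obtain ⟨v4, h8, -⟩ := run_append.1 h7
        obtain ⟨v5, h8', -⟩ := run_append.1 h8
        have hup2 := hP.run_func (run_append.2 ⟨_, hup', h8'⟩) hup
        subst hup2
        obtain rfl := hP.run_cofunc h6 h8'
        refine key (s1 := p2 ++ (x :: t ++ β) ++ p1) (a := invRev e) (c := p2) (d := x :: b)
          hu hr h5 ?_ ⟨_, by rw [List.append_assoc]⟩ h7 (.inr ?_)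
        · exact hS.rot p1 _ (by simpa using harc.mem)
        · simp only [List.length_append, List.length_cons, Nat.cast_add, Nat.cast_one] at *
          nlinarith
    · -- long overlap at the beginning of `b`
      obtain ⟨e, rfl⟩ := hp2
      obtain ⟨v3, h5, h6⟩ := run_append.1 hb
      rw [invRev_eq_iff, FreeGroup.invRev_append] at hp12
      subst hp12
      have hx' : Run (Attach S E) (y', []) (p ++ [x]) (z, invRev (invRev p2 ++ invRev p1)) :=
        run_append.2 ⟨_, hup, run_singleton.2 hstep⟩
      have h7 := hP.run_rotate (u := p ++ [x]) (v := invRev p2 ++ invRev p1 ++ β)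
        (by simpa using hloop) hx'
      refine key (s1 := invRev p2 ++ invRev p1 ++ β ++ (p ++ [x])) (a := a ++ [x])
        (c := invRev p2) (d := e) (by simpa using hu) (by simpa using hr)
        (run_append.2 ⟨_, ha, run_singleton.2 hstep⟩) ?_ ⟨invRev p1 ++ (β ++ (p ++ [x])), by simp only [List.append_assoc]⟩
        h7 (.inr ?_)
      · exact hS.rot (p ++ [x]) _ (by simpa using harc.mem)
      · simp only [List.length_append, List.length_cons, Nat.cast_add, Nat.cast_one,
          FreeGroup.invRev_length, List.length_nil, Nat.cast_zero] at *
        nlinarith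
  -- No old vertex and no middle edge remain, so the path stays in the tree of half arcs hanging
  -- from one foot.
  obtain ⟨y, q⟩ := v
  obtain ⟨a, b, r, rfl, hq, hra, ha, hb⟩ := down_up hured hr hold hmid
  have hlen' : lam * (s.length : ℝ) ≤ a.length ∨ lam * (s.length : ℝ) ≤ b.length := by
    rw [List.length_append] at hlen
    push_cast at hlen
    by_contra! h
    linarith [h.1, h.2]
  have h1 := hS.one_lt s hs
  apply hcon
  rcases hlen' with h | h
  · have hane : a ≠ [] := by
      rintro rfl
      simp at h; linarith
    obtain ⟨e, he, hloop, hup⟩ := run_loop_of_onArc hS hE hsat (ha hane)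
    have h2 := hP.run_invRev (hP.run_rotate hloop hup)
    refine key (s1 := invRev (e ++ q)) (a := []) (c := a) (d := b) hu hr rfl
      (hS.inv _ (hS.rot _ _ he)) ?_ h2 (.inl h)
    subst hq
    simp [FreeGroup.invRev_append]
  · have hbne : b ≠ [] := by
      rintro rfl
      simp at h; linarith
    obtain ⟨e, he, hloop, hup⟩ := run_loop_of_onArc hS hE hsat (hb hbne)
    obtain ⟨γ, β, z, hγ, hpre, hl⟩ := hb hbne
    have hup' := run_up hγ (p := r) ((List.prefix_append _ _).trans hpre) (by simp at hl; omega)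
    have h2 := hP.run_rotate (u := r) (v := b ++ e) (by simpa using hloop) hup'
    exact key (s1 := b ++ e ++ r) (a := a) (c := b) (d := []) (by simpa using hu)
      (by simpa using hr) hra (hS.rot _ _ (by simpa using he))
      ⟨_, by rw [List.append_assoc]⟩ h2 (.inl h)

/-- A reduced path that starts up an arc cannot turn back, so it crosses the middle and follows the
other half at least to height lam |s| above the foot. The arc is longer than (1 - 2 lam) |s|, which
leaves more than (1 - 3 lam) |s|. -/
theorem big_piece_of_up {y y2 : V} {q w : List (α × Bool)} {x : α × Bool}
    (hon : OnArc S E y (q ++ [x])) (hw : IsReduced (x :: w))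
    (hr : Run (Attach S E) (y, q ++ [x]) w (y2, [])) :
    ∃ s ∈ S, ∃ c, c <+: s ∧ c <+: q ++ [x] ++ w ∧ (1 - 3 * lam) * (s.length : ℝ) < c.length := by
  induction w generalizing q x with
  | nil => simp [Run] at hr
  | cons x1 w ih =>
    obtain ⟨c, hc, hr⟩ := hr
    generalize ha : (y, q ++ [x]) = a at hc
    cases hc with
    | old h2 => simp at ha
    | up h2 =>
      obtain ⟨rfl, rfl⟩ := Prod.mk.inj ha
      obtain ⟨s, hs, c, h3, h4, h5⟩ := ih h2 (IsReduced.tail' hw) hr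
      exact ⟨s, hs, c, h3, by simpa using h4, h5⟩
    | @down y' q' x' h2 =>
      obtain ⟨rfl, h3⟩ := Prod.mk.inj ha
      obtain ⟨rfl, h3⟩ := List.append_inj' h3 rfl
      simp at h3
      subst h3
      rw [isReduced_cons_cons'] at hw
      exact absurd rfl hw.1
    | @mid y' p x' t β z harc hp =>
      obtain ⟨rfl, rfl⟩ := Prod.mk.inj ha
      have h4 := halfLength_add harc.ne (IsReduced.left (hS.red _ harc.mem))
      have h3 : invRev (q ++ [x] ++ x1 :: t) = invRev t ++ flipL x1 :: invRev (q ++ [x]) := by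
        rw [FreeGroup.invRev_append, invRev_cons']; simp
      have harc' := harc.symm hS hE
      rw [h3] at h4 harc'
      have ht : (invRev t).length = halfLength (invRev t ++ flipL x1 :: invRev (q ++ [x])) := by
        simp at h4 hp ⊢; omega
      have hbig := harc.lt_length hS hE hsat
      have hpos := hS.one_lt _ harc.mem
      rcases descent hS hE harc' ht.le (by rw [flipL_flipL]; exact IsReduced.tail' hw) hr with
        ⟨t', ht', h5⟩ | ⟨p1, p2, hp12, hp1, e, he⟩
      · obtain ⟨rfl, rfl⟩ := Prod.mk.inj h5
        rw [invRev_eq_iff] at ht'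
        simp at ht'
        subst ht'
        refine ⟨_, harc.mem, _, ⟨β, rfl⟩, List.prefix_rfl, ?_⟩
        linarith
      · rw [invRev_eq_iff, FreeGroup.invRev_append] at hp12
        subst hp12 he
        refine ⟨_, harc.mem, q ++ [x] ++ x1 :: invRev p2, ⟨invRev p1 ++ β, by simp⟩,
          ⟨e, by simp⟩, ?_⟩
        simp only [List.length_append, List.length_cons, Nat.cast_add, Nat.cast_one,
          FreeGroup.invRev_length, List.length_nil, Nat.cast_zero] at *
        nlinarith

/-- A reduced path between old vertices is old, or contains a large part of a relator. -/
theorem run_old_or_big_piece {y y2 : V} {w : List (α × Bool)} (hw : IsReduced w)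
    (hr : Run (Attach S E) (y, []) w (y2, [])) :
    Run E y w y2 ∨
    ∃ s ∈ S, ∃ c, c <+: s ∧ c <:+: w ∧ (1 - 3 * lam) * (s.length : ℝ) < c.length := by
  induction w generalizing y with
  | nil => exact .inl (Prod.mk.inj hr).1
  | cons x w ih =>
    obtain ⟨c, hc, hr⟩ := hr
    generalize ha : (y, []) = a at hc
    cases hc with
    | old h2 =>
      obtain ⟨rfl, -⟩ := Prod.mk.inj ha
      rcases ih (IsReduced.tail' hw) hr with h | ⟨s, hs, c, h3, h4, h5⟩
      · exact .inl ⟨_, h2, h⟩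
      · exact .inr ⟨s, hs, c, h3, h4.trans ⟨[x], [], by simp⟩, h5⟩
    | up h2 =>
      obtain ⟨rfl, rfl⟩ := Prod.mk.inj ha
      obtain ⟨s, hs, c, h3, h4, h5⟩ := big_piece_of_up hS hE hsat h2 hw hr
      exact .inr ⟨s, hs, c, h3, h4.isInfix, h5⟩
    | down h2 => simp at ha
    | mid h2 h3 =>
      obtain ⟨rfl, rfl⟩ := Prod.mk.inj ha
      have := h2.half_pos hS hE hsat
      rw [← h3] at this
      simp at this

end Greendlinger

/-- The pieces of relators which are almost whole relators. -/
def HasBigPiece {α : Type*} (lam : ℝ) (S : Set (List (α × Bool))) (w : List (α × Bool)) : Prop :=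
  ∃ s ∈ S, ∃ c, c <+: s ∧ c <:+: w ∧ (1 - 3 * lam) * (s.length : ℝ) < c.length

/-! ### Greendlinger's lemma by iterated attachment -/

section GreendlingerFinal

open FreeGroup (IsReduced invRev)

variable {α : Type} {S : Set (List (α × Bool))} {lam : ℝ}

/-- The k-th graph arises from a point by attaching k layers of relators. It stands in for a ball of
the Cayley graph: short words are readable, relators close up in its interior, and closed reduced
paths obey Greendlinger's lemma. -/
theorem exists_layer (hS : SmallCancellationSet lam S) (k : ℕ) :
    ∃ (V : Type) (E : V → α × Bool → V → Prop) (v0 : V), PartialAction E ∧ Saturated lam S E ∧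
      (∀ w : List (α × Bool), w.length ≤ k → ∃ v, Run E v0 w v) ∧
      (∀ w : List (α × Bool), w.length < k → ∀ v, Run E v0 w v → ∀ s ∈ S, Run E v s v) ∧
      (∀ w, IsReduced w → w ≠ [] → Run E v0 w v0 → HasBigPiece lam S w) := by
  induction k with
  | zero =>
    refine ⟨Unit, fun _ _ _ => False, (), ⟨fun _ _ _ h => h.elim, fun _ _ _ _ h => h.elim⟩, ?_,
      ?_, ?_, ?_⟩
    · intro s hs u hu hl v v' hr
      cases u with
      | nil =>
        have := hS.one_lt s hs
        simp at hl
        linarith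
      | cons x u => obtain ⟨c, hc, -⟩ := hr; exact hc.elim
    · intro w hw
      have : w = [] := List.length_eq_zero_iff.1 (Nat.le_zero.1 hw)
      subst this
      exact ⟨(), rfl⟩
    · intro w hw; omega
    · intro w _ hne hr
      cases w with
      | nil => exact absurd rfl hne
      | cons x u => obtain ⟨c, hc, -⟩ := hr; exact hc.elim
  | succ k ih =>
    obtain ⟨V, E, v0, hE, hsat, h1, h2, h3⟩ := ih
    have hP := attach_partialAction hS hE hsat
    have hread : ∀ w : List (α × Bool), w.length ≤ k → ∃ v, Run (Attach S E) (v0, []) w (v, []) := by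
      intro w hw
      obtain ⟨v, hv⟩ := h1 w hw
      exact ⟨v, run_old hv⟩
    refine ⟨V × List (α × Bool), Attach S E, (v0, []), hP, attach_saturated hS hE hsat, ?_, ?_, ?_⟩
    · intro w hw
      rcases List.eq_nil_or_concat w with rfl | ⟨w, x, rfl⟩
      · exact ⟨_, rfl⟩
      · obtain ⟨v, hv⟩ := hread w (by simp at hw; omega)
        obtain ⟨t, ht⟩ := hS.letters x
        obtain ⟨c, hc, -⟩ := run_loop hS hE hsat v ht
        exact ⟨c, by simpa using run_append.2 ⟨_, hv, run_singleton.2 hc⟩⟩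
    · intro w hw v hv s hs
      obtain ⟨v', hv'⟩ := hread w (by omega)
      obtain rfl := hP.run_func hv hv'
      exact run_loop hS hE hsat v' hs
    · intro w hw hne hr
      rcases run_old_or_big_piece hS hE hsat hw hr with h | h
      · exact h3 w hw hne h
      · exact h

/-- **Greendlinger's lemma**: a nontrivial element of the normal closure of the relators contains
a large part of a relator. -/
theorem greendlinger [DecidableEq α] (hS : SmallCancellationSet lam S) {R : Set (FreeGroup α)}
    (hR : ∀ r ∈ R, r.toWord ∈ S) {g : FreeGroup α} (hg : g ∈ Subgroup.normalClosure R)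
    (hne : g ≠ 1) : HasBigPiece lam S g.toWord := by
  -- A product of conjugates of relators involves only finitely many conjugating words, so it closes
  -- up in every graph with enough layers.
  have key : ∃ K : ℕ, ∀ (V : Type) (E : V → α × Bool → V → Prop) (v0 : V), PartialAction E →
      (∀ w : List (α × Bool), w.length ≤ K → ∃ v, Run E v0 w v) →
      (∀ w : List (α × Bool), w.length < K → ∀ v, Run E v0 w v → ∀ s ∈ S, Run E v s v) →
      Run E v0 g.toWord v0 := by
    clear hne
    induction hg using Subgroup.closure_induction with
    | mem x hx =>
      obtain ⟨r, hr, hx⟩ := Group.mem_conjugatesOfSet_iff.1 hx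
      obtain ⟨u, rfl⟩ := isConj_iff.1 hx
      refine ⟨u.toWord.length + 1, fun V E v0 hE h1 h2 => ?_⟩
      obtain ⟨v, hv⟩ := h1 u.toWord (by omega)
      have hl := h2 _ (by omega) v hv _ (hR r hr)
      have h3 : Run E v0 (u.toWord ++ r.toWord ++ invRev u.toWord) v0 :=
        run_append.2 ⟨v, run_append.2 ⟨v, hv, hl⟩, hE.run_invRev hv⟩
      have h4 : (u * r * u⁻¹).toWord = FreeGroup.reduce (u.toWord ++ r.toWord ++ invRev u.toWord) := by
        rw [FreeGroup.toWord_mul, FreeGroup.toWord_mul, FreeGroup.toWord_inv]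
        conv_rhs => rw [← FreeGroup.reduce_append_reduce_reduce]
        conv_lhs => rw [← FreeGroup.reduce_append_reduce_reduce]
        rw [FreeGroup.reduce.idem]
      rw [h4]
      exact hE.run_of_red FreeGroup.reduce.red h3
    | one => exact ⟨0, fun V E v0 hE h1 h2 => by rw [FreeGroup.toWord_one]; rfl⟩
    | mul x y _ _ hx hy =>
      obtain ⟨K, hK⟩ := hx
      obtain ⟨K', hK'⟩ := hy
      refine ⟨max K K', fun V E v0 hE h1 h2 => ?_⟩
      rw [FreeGroup.toWord_mul]
      refine hE.run_of_red FreeGroup.reduce.red (run_append.2 ⟨v0, ?_, ?_⟩)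
      · exact hK V E v0 hE (fun w hw => h1 w (by omega)) (fun w hw => h2 w (by omega))
      · exact hK' V E v0 hE (fun w hw => h1 w (by omega)) (fun w hw => h2 w (by omega))
    | inv x _ hx =>
      obtain ⟨K, hK⟩ := hx
      refine ⟨K, fun V E v0 hE h1 h2 => ?_⟩
      rw [FreeGroup.toWord_inv]
      exact hE.run_invRev (hK V E v0 hE h1 h2)
  obtain ⟨K, hK⟩ := key
  obtain ⟨V, E, v0, hE, -, h1, h2, h3⟩ := exists_layer hS K
  exact h3 _ FreeGroup.isReduced_toWord (fun h => hne (FreeGroup.toWord_eq_nil_iff.1 h))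
    (hK V E v0 hE h1 h2)

end GreendlingerFinal

/-! ## The symmetrized set of relators -/

section Symmetrized

open FreeGroup (IsReduced invRev IsCyclicallyReduced)

theorem IsCyclicallyReduced.rotate_append {α : Type*} {a b : List (α × Bool)}
    (h : IsCyclicallyReduced (a ++ b)) : IsCyclicallyReduced (b ++ a) := by
  rcases List.eq_nil_or_concat a with rfl | ⟨a, x, rfl⟩
  · simpa using h
  rcases List.eq_nil_or_concat b with rfl | ⟨b, y, rfl⟩
  · simpa using h
  have hred := h.1
  have hcyc := h.2
  constructor
  · unfold FreeGroup.IsReduced at hred ⊢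
    rw [List.isChain_append] at hred ⊢
    refine ⟨hred.2.1, hred.1, ?_⟩
    intro x' hx' y' hy'
    refine hcyc x' ?_ y' ?_
    · simp only [List.concat_eq_append, List.getLast?_concat] at hx'
      rw [List.concat_eq_append (as := b), ← List.append_assoc, List.getLast?_concat]
      exact hx'
    · cases a <;> simpa using hy'
  · intro x' hx' y' hy'
    unfold FreeGroup.IsReduced at hred
    rw [List.isChain_append] at hred
    rw [List.concat_eq_append (as := a), ← List.append_assoc, List.getLast?_concat] at hx'
    refine hred.2.2 x' (by rw [List.concat_eq_append, List.getLast?_concat]; exact hx') y' ?_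
    cases b <;> simpa using hy'

theorem exists_append_of_isRotated {β : Type*} {s s' : List β} (h : s ~r s') :
    ∃ a b, s = a ++ b ∧ s' = b ++ a := by
  obtain ⟨n, hn, rfl⟩ := List.isRotated_iff_mod.1 h
  exact ⟨s.take n, s.drop n, (List.take_append_drop n s).symm,
    List.rotate_eq_drop_append_take hn⟩

theorem IsCyclicallyReduced.of_isRotated {α : Type*} {s s' : List (α × Bool)}
    (h : IsCyclicallyReduced s) (h' : s ~r s') : IsCyclicallyReduced s' := by
  obtain ⟨a, b, rfl, rfl⟩ := exists_append_of_isRotated h'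
  exact IsCyclicallyReduced.rotate_append h

theorem IsCyclicallyReduced.invRev' {α : Type*} {s : List (α × Bool)}
    (h : IsCyclicallyReduced s) : IsCyclicallyReduced (invRev s) := by
  refine ⟨isReduced_invRev.2 h.1, ?_⟩
  intro a ha b hb hab
  have h1 : flipL b ∈ s.getLast? := by
    simp only [invRev, List.head?_reverse, List.getLast?_map, Option.mem_def,
      Option.map_eq_some_iff] at hb
    obtain ⟨c, hc, rfl⟩ := hb
    simpa [flipL] using hc
  have h2 : flipL a ∈ s.head? := by
    simp only [invRev, List.getLast?_reverse, List.head?_map, Option.mem_def,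
      Option.map_eq_some_iff] at ha
    obtain ⟨c, hc, rfl⟩ := ha
    simpa [flipL] using hc
  have := h.2 _ h1 _ h2 hab.symm
  simpa [flipL] using this.symm

theorem isRotated_invRev {α : Type*} {s s' : List (α × Bool)} (h : s ~r s') :
    invRev s ~r invRev s' := by
  obtain ⟨a, b, rfl, rfl⟩ := exists_append_of_isRotated h
  rw [FreeGroup.invRev_append, FreeGroup.invRev_append]
  exact List.isRotated_append

/-- Commuting words are powers of a common word. -/
theorem exists_common_root {β : Type*} (a b : List β) (h : a ++ b = b ++ a) :
    ∃ (t : List β) (i j : ℕ), a = (List.replicate i t).flatten ∧ b = (List.replicate j t).flatten := by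
  induction hn : a.length + b.length using Nat.strong_induction_on generalizing a b with
  | _ n ih =>
    by_cases ha : a = []
    · exact ⟨b, 0, 1, by simp [ha], by simp⟩
    by_cases hb : b = []
    · exact ⟨a, 1, 0, by simp, by simp [hb]⟩
    have hla := List.length_pos_iff.2 ha
    have hlb := List.length_pos_iff.2 hb
    -- Euclid's algorithm: the shorter word is a prefix of the longer one and commutes with what
    -- remains.
    rcases List.append_eq_append_iff.1 h with ⟨c, rfl, hc⟩ | ⟨c, rfl, hc⟩
    · obtain ⟨t, i, j, hi, hj⟩ := ih (a.length + c.length) (by simp at hn; omega) a c hc rfl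
      · refine ⟨t, i, i + j, hi, ?_⟩
        rw [List.replicate_add, List.flatten_append, ← hi, ← hj]
    · obtain ⟨t, i, j, hi, hj⟩ := ih (b.length + c.length) (by simp at hn; omega) b c hc rfl
      · refine ⟨t, i + j, i, ?_, hi⟩
        rw [List.replicate_add, List.flatten_append, ← hi, ← hj]

/-- A word equal to a nontrivial rotation of itself is a proper power. -/
theorem exists_power_of_rotation_eq {α : Type*} {a b : List (α × Bool)} (ha : a ≠ []) (hb : b ≠ [])
    (h : a ++ b = b ++ a) :
    ∃ (g : FreeGroup α) (k : ℕ), 2 ≤ k ∧ FreeGroup.mk (a ++ b) = g ^ k := by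
  obtain ⟨t, i, j, rfl, rfl⟩ := exists_common_root a b h
  refine ⟨FreeGroup.mk t, i + j, ?_, ?_⟩
  · rcases i with _ | i
    · simp at ha
    rcases j with _ | j
    · simp at hb
    omega
  · rw [FreeGroup.pow_mk, List.replicate_add, List.flatten_append]

theorem isConj_mk_of_isRotated {α : Type*} {s s' : List (α × Bool)} (h : s ~r s') :
    IsConj (FreeGroup.mk s) (FreeGroup.mk s') := by
  obtain ⟨a, b, rfl, rfl⟩ := exists_append_of_isRotated h
  rw [isConj_iff, ← FreeGroup.mul_mk, ← FreeGroup.mul_mk]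
  exact ⟨(FreeGroup.mk a)⁻¹, by group⟩

/-- A reduced word is not a rotation of its inverse. -/
theorem not_isRotated_invRev {α : Type*} {s : List (α × Bool)} (hs : IsReduced s) (hne : s ≠ []) :
    ¬ s ~r invRev s := by
  intro h
  obtain ⟨a, b, h1, h2⟩ := exists_append_of_isRotated h
  subst h1
  rw [FreeGroup.invRev_append] at h2
  obtain ⟨hb, ha⟩ := List.append_inj h2 (by simp)
  have ha' : a = [] := by
    by_contra hne
    exact invRev_ne_self (IsReduced.left hs) hne ha
  have hb' : b = [] := by
    by_contra hne
    exact invRev_ne_self (IsReduced.right hs) hne hb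
  simp [ha', hb'] at hne

variable {m n : ℕ} {r : Relators m n}

theorem mem_symmetrized_of_isRotated {s s' : List (Letter m)} (hs : s ∈ symmetrized r)
    (h : s ~r s') : s' ∈ symmetrized r := by
  obtain ⟨i, hi | hi⟩ := hs
  · exact ⟨i, .inl (h.symm.trans hi)⟩
  · exact ⟨i, .inr (h.symm.trans hi)⟩

theorem mem_symmetrized_self (i : Fin n) : (r i).toWord ∈ symmetrized r :=
  ⟨i, .inl (List.IsRotated.refl _)⟩

theorem invRev_mem_symmetrized {s : List (Letter m)} (hs : s ∈ symmetrized r) :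
    invRev s ∈ symmetrized r := by
  obtain ⟨i, hi | hi⟩ := hs
  · refine ⟨i, .inr ?_⟩
    rw [FreeGroup.toWord_inv]
    exact isRotated_invRev hi
  · refine ⟨i, .inl ?_⟩
    rw [FreeGroup.toWord_inv] at hi
    simpa using isRotated_invRev hi

theorem isCyclicallyReduced_of_mem_symmetrized (hr : IsCyclicallyReducedTuple r)
    {s : List (Letter m)} (hs : s ∈ symmetrized r) : IsCyclicallyReduced s := by
  obtain ⟨i, hi | hi⟩ := hs
  · exact IsCyclicallyReduced.of_isRotated (hr i).2 hi.symm
  · rw [FreeGroup.toWord_inv] at hi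
    exact IsCyclicallyReduced.of_isRotated (IsCyclicallyReduced.invRev' (hr i).2) hi.symm

theorem length_of_mem_symmetrized {s : List (Letter m)} {i : Fin n}
    (hi : s ~r (r i).toWord ∨ s ~r ((r i)⁻¹).toWord) : s.length = (r i).norm := by
  rcases hi with hi | hi
  · exact hi.perm.length_eq
  · rw [hi.perm.length_eq]
    exact FreeGroup.norm_inv_eq

theorem ne_nil_of_mem_symmetrized (hr : IsCyclicallyReducedTuple r)
    {s : List (Letter m)} (hs : s ∈ symmetrized r) : s ≠ [] := by
  rintro rfl
  obtain ⟨i, hi⟩ := hs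
  have := length_of_mem_symmetrized hi
  exact (hr i).1 (FreeGroup.norm_eq_zero.1 this.symm)

theorem IsProperPower.of_isConj {g h : FreeGroup (Fin m)} (hg : IsProperPower g)
    (hc : IsConj g h) : IsProperPower h := by
  obtain ⟨x, k, hk, rfl⟩ := hg
  obtain ⟨c, rfl⟩ := isConj_iff.1 hc
  exact ⟨c * x * c⁻¹, k, hk, by rw [conj_pow]⟩

theorem IsProperPower.inv {g : FreeGroup (Fin m)} (hg : IsProperPower g) : IsProperPower g⁻¹ := by
  obtain ⟨x, k, hk, rfl⟩ := hg
  exact ⟨x⁻¹, k, hk, by rw [inv_pow]⟩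

theorem rotation_ne_of_not_isProperPower (hp : ∀ i, ¬ IsProperPower (r i))
    {a b : List (Letter m)} (hs : a ++ b ∈ symmetrized r) (ha : a ≠ []) (hb : b ≠ []) :
    a ++ b ≠ b ++ a := by
  intro h
  have hpow : IsProperPower (FreeGroup.mk (a ++ b)) := exists_power_of_rotation_eq ha hb h
  obtain ⟨i, hi | hi⟩ := hs
  · apply hp i
    have := hpow.of_isConj (isConj_mk_of_isRotated hi)
    rwa [FreeGroup.mk_toWord] at this
  · apply hp i
    have := (hpow.of_isConj (isConj_mk_of_isRotated hi)).inv
    rwa [FreeGroup.mk_toWord, inv_inv] at this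

theorem isReducedPath_of_isReduced {Γ : FGraph m} {p : List Γ.OEdge}
    (h : IsReduced (Γ.pathLabel p)) : Γ.IsReducedPath p := by
  unfold FGraph.IsReducedPath FreeGroup.IsReduced
  unfold FreeGroup.IsReduced FGraph.pathLabel at h
  rw [List.isChain_map] at h
  refine h.imp ?_
  intro d d' hd hdd
  exact hd (by rw [FGraph.oLabel, FGraph.oLabel, hdd])

/-- A reduced word missing a generator is readable in a rose. -/
theorem isReadable_of_missing_letter {μ : ℝ} {w : List (Letter m)} (hw : IsReduced w) (a : Fin m)
    (ha : ∀ x ∈ w, x.1 ≠ a) (hlen : (m : ℝ) ≤ μ * w.length) : IsReadable μ w := by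
  have hm : 0 < m := a.pos
  have hcard : Nat.card {b : Fin m // b ≠ a} = m - 1 := by
    rw [Nat.card_eq_fintype_card, Fintype.card_subtype_compl]
    simp
  let Γ : FGraph m :=
    { V := Unit, E := {b : Fin m // b ≠ a}, src := fun _ => (), tgt := fun _ => (), lab := fun b => b.1 }
  have hpath : ∀ p : List Γ.OEdge, Γ.IsPath () p () := by
    intro p
    induction p with
    | nil => rfl
    | cons d p ih => exact ⟨rfl, ih⟩
  have hlab : ∃ p : List Γ.OEdge, Γ.pathLabel p = w := by
    clear hw hlen
    induction w with
    | nil => exact ⟨[], rfl⟩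
    | cons x w ih =>
      obtain ⟨p, hp⟩ := ih (fun y hy => ha y (List.mem_cons_of_mem _ hy))
      refine ⟨(⟨x.1, ha x List.mem_cons_self⟩, x.2) :: p, ?_⟩
      simp only [FGraph.pathLabel, List.map_cons] at hp ⊢
      rw [hp]
      rfl
  obtain ⟨p, hp⟩ := hlab
  refine ⟨Γ, ⟨inferInstanceAs (Finite Unit), inferInstanceAs (Finite {b : Fin m // b ≠ a})⟩,
    ⟨⟨()⟩, fun x y => ⟨[], rfl⟩⟩, ?_, ?_, (), p, (), hpath p, ?_, hp⟩
  · change (Nat.card {b : Fin m // b ≠ a} : ℝ) ≤ _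
    rw [hcard]
    refine le_trans ?_ hlen
    exact_mod_cast Nat.sub_le m 1
  · change ((Nat.card {b : Fin m // b ≠ a} : ℕ) : ℤ) - (Nat.card Unit : ℤ) + 1 ≤ _
    rw [hcard]
    simp
    omega
  · exact isReducedPath_of_isReduced (by rw [hp]; exact hw)

/-- From L ≥ 2 and μ ≤ 1 one gets 15 L ≥ 30 μ, so the bound on lam is at most μ / (33 μ). -/
theorem lam_le_of_admissible {L : ℕ} {lam μ : ℝ} (hm : 1 < m) (h : AdmissibleParameters m L lam μ) :
    lam ≤ 1 / 33 := by
  obtain ⟨h1, h2, h3, h4, h5⟩ := h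
  have hL : (2 : ℝ) ≤ L := by exact_mod_cast (show 2 ≤ L by omega)
  refine h5.trans ?_
  rw [div_le_div_iff₀ (by positivity) (by norm_num)]
  nlinarith

/-- A relator longer than m uses some generator twice, up to sign. This makes a single letter a
piece, and pieces are shorter than lam |s|. -/
theorem one_lt_of_genericClass {L : ℕ} {lam μ : ℝ} (hr : r ∈ genericClass m n lam μ L)
    {s : List (Letter m)} (hs : s ∈ symmetrized r) : 1 < lam * (s.length : ℝ) := by
  obtain ⟨hcyc, ⟨hsc, hp, -⟩, hlen⟩ := hr
  obtain ⟨i, hi⟩ := hs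
  rw [length_of_mem_symmetrized hi]
  clear hi s
  set w := (r i).toWord with hw
  have hwS : w ∈ symmetrized r := mem_symmetrized_self i
  have hwlen : m < w.length := hlen i
  obtain ⟨j, k, hjk, heq⟩ := Fintype.exists_ne_map_eq_of_card_lt
    (fun j : Fin w.length => (w.get j).1) (by simpa using hwlen)
  wlog hlt : j < k generalizing j k
  · exact this k j hjk.symm heq.symm (lt_of_le_of_ne (not_lt.1 hlt) hjk.symm)
  -- decompose the word
  obtain ⟨p, x, q, y, t, hdec, hxy⟩ : ∃ p x q y t, w = p ++ x :: (q ++ y :: t) ∧ x.1 = y.1 := by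
    have h1 : w = w.take j ++ w[(j : ℕ)] :: w.drop (j + 1) := by
      rw [List.getElem_cons_drop, List.take_append_drop]
    have hkl : (k : ℕ) - (j + 1) < (w.drop (j + 1)).length := by
      rw [List.length_drop]
      have := k.2
      have : (j : ℕ) < k := hlt
      omega
    have h2 : w.drop (j + 1) = (w.drop (j + 1)).take (k - (j + 1)) ++
        (w.drop (j + 1))[(k : ℕ) - (j + 1)] :: (w.drop (j + 1)).drop (k - (j + 1) + 1) := by
      rw [List.getElem_cons_drop, List.take_append_drop]
    refine ⟨_, _, _, _, _, h1.trans (by rw [h2]), ?_⟩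
    have h3 : (w.drop (j + 1))[(k : ℕ) - (j + 1)] = w[(k : ℕ)] := by
      rw [List.getElem_drop]
      congr 1
      have : (j : ℕ) < k := hlt
      omega
    rw [h3]
    exact heq
  have hs1 : x :: (q ++ y :: t) ++ p ∈ symmetrized r :=
    mem_symmetrized_of_isRotated hwS (by rw [hdec]; exact List.isRotated_append)
  have hnorm : (x :: (q ++ y :: t) ++ p).length = (r i).norm := by
    change _ = w.length
    rw [hdec]; simp; omega
  rw [← hnorm]
  have main : ∀ s' ∈ symmetrized r, (x :: (q ++ y :: t) ++ p) ≠ s' → [x] <+: s' →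
      1 < lam * ((x :: (q ++ y :: t) ++ p).length : ℝ) := by
    intro s' hs' hne hpre
    have := hsc _ hs1 s' hs' hne [x] ⟨_, rfl⟩ hpre
    simpa using this
  by_cases h : x = y
  · subst h
    refine main (x :: t ++ p ++ x :: q) ?_ ?_ ⟨t ++ p ++ x :: q, by simp⟩
    · refine mem_symmetrized_of_isRotated hs1 ?_
      have : x :: (q ++ x :: t) ++ p = (x :: q) ++ (x :: t ++ p) := by simp
      rw [this]
      exact List.isRotated_append
    -- The two rotations starting at the two occurrences differ, since the relator is not a proper
    -- power.
    · have := rotation_ne_of_not_isProperPower hp (a := x :: q) (b := x :: t ++ p)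
        (by simpa using hs1) (by simp) (by simp)
      simpa using this
  · have hy : y = flipL x := by
      rw [eq_flipL_iff]
      exact ⟨hxy, fun h2 => h (Prod.ext hxy h2)⟩
    -- For occurrences of opposite sign, rotate `y` to the end; the inverse word then starts with
    -- `x`.
    have hrot : (x :: (q ++ y :: t) ++ p) ~r (t ++ p ++ x :: q ++ [y]) := by
      have : x :: (q ++ y :: t) ++ p = (x :: q ++ [y]) ++ (t ++ p) := by simp
      rw [this]
      have h2 : t ++ p ++ x :: q ++ [y] = (t ++ p) ++ (x :: q ++ [y]) := by simp
      rw [h2]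
      exact List.isRotated_append
    have hhead : invRev (t ++ p ++ x :: q ++ [y]) = x :: invRev (t ++ p ++ x :: q) := by
      rw [invRev_concat', hy, flipL_flipL]
    refine main _ (invRev_mem_symmetrized (mem_symmetrized_of_isRotated hs1 hrot)) ?_ ?_
    · intro h1
      have h2 := isRotated_invRev hrot
      rw [← h1] at h2
      exact not_isRotated_invRev (isCyclicallyReduced_of_mem_symmetrized hcyc hs1).1
        (by simp) h2.symm
    · rw [hhead]
      exact ⟨_, rfl⟩

theorem mul_length_lt_of_genericClass {L : ℕ} {lam μ : ℝ} (hadm : AdmissibleParameters m L lam μ)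
    {s : ℝ} (hs : 1 < lam * s) : 15 * (L : ℝ) + 3 * μ < μ * s := by
  obtain ⟨h1, h2, h3, h4, h5⟩ := hadm
  have hs0 : 0 < s := by
    by_contra h
    nlinarith
  have hden : (0 : ℝ) < 15 * (L : ℝ) + 3 * μ := by positivity
  rw [le_div_iff₀ hden] at h5
  by_contra! h
  nlinarith [mul_le_mul_of_nonneg_right h5 hs0.le]

theorem smallCancellationSet_symmetrized {L : ℕ} {lam μ : ℝ} (hm : 1 < m) (hn : 0 < n)
    (hadm : AdmissibleParameters m L lam μ) (hr : r ∈ genericClass m n lam μ L) :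
    SmallCancellationSet lam (symmetrized r) where
  red := fun s hs => (isCyclicallyReduced_of_mem_symmetrized hr.1 hs).1
  rot := fun a b hs => mem_symmetrized_of_isRotated hs List.isRotated_append
  inv := fun s hs => invRev_mem_symmetrized hs
  piece := by
    intro s hs s' hs' u hu hu' hl
    by_contra hne
    exact absurd hl (not_le.2 (hr.2.1.1 s hs s' hs' hne u hu hu'))
  one_lt := fun s hs => one_lt_of_genericClass hr hs
  pos := hadm.2.2.2.1
  le := lam_le_of_admissible hm hadm
  letters := by
    intro x
    have hS : (r ⟨0, hn⟩).toWord ∈ symmetrized r := mem_symmetrized_self _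
    -- A relator that omits a generator is readable in a rose with m - 1 petals, against condition
    -- (3).
    have key : ∃ y ∈ (r ⟨0, hn⟩).toWord, y.1 = x.1 := by
      by_contra! hcon
      have h1 := one_lt_of_genericClass hr hS
      have h2 := mul_length_lt_of_genericClass hadm h1
      refine (hr.2.1.2.2 ⟨0, hn⟩ _ (List.IsRotated.refl _) _ List.infix_rfl ?_).2
        (isReadable_of_missing_letter FreeGroup.isReduced_toWord x.1 hcon ?_)
      · have : (0 : ℝ) ≤ ((r ⟨0, hn⟩).norm : ℝ) := Nat.cast_nonneg _
        change _ ≤ ((r ⟨0, hn⟩).norm : ℝ)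
        linarith
      · have h3 : (m : ℝ) ≤ L := by exact_mod_cast hadm.1
        have h4 : (0 : ℝ) ≤ L := Nat.cast_nonneg _
        linarith [hadm.2.1]
    obtain ⟨y, hy, hyx⟩ := key
    obtain ⟨p, q, hpq⟩ := List.append_of_mem hy
    rw [hpq] at hS
    have hrot : y :: q ++ p ∈ symmetrized r := mem_symmetrized_of_isRotated hS List.isRotated_append
    by_cases h : y = x
    · subst h; exact ⟨_, hrot⟩
    · have hx : x = flipL y := by
        rw [eq_flipL_iff]
        exact ⟨hyx, fun h2 => h (Prod.ext hyx h2)⟩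
      have h2 := invRev_mem_symmetrized (mem_symmetrized_of_isRotated (s' := q ++ p ++ [y]) hrot
        (by simpa using List.isRotated_append (l := [y]) (l' := q ++ p)))
      rw [invRev_concat', ← hx] at h2
      exact ⟨_, h2⟩

theorem hasBigPiece_of_mk_eq_one {L : ℕ} {lam μ : ℝ} (hm : 1 < m) (hn : 0 < n)
    (hadm : AdmissibleParameters m L lam μ) (hr : r ∈ genericClass m n lam μ L)
    {g : FreeGroup (Fin m)} (hg : PresentedGroup.mk (Set.range r) g = 1) (hne : g ≠ 1) :
    HasBigPiece lam (symmetrized r) g.toWord := by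
  refine greendlinger (smallCancellationSet_symmetrized hm hn hadm hr) (R := Set.range r) ?_ ?_ hne
  · rintro _ ⟨i, rfl⟩
    exact mem_symmetrized_self i
  · rwa [PresentedGroup.mk_eq_one_iff] at hg

end Symmetrized

/-! ## Group labelled graphs -/

section Reach

variable {V K V' K' : Type*} [Group K] [Group K']

/-- `Reach S u g w`: there is a path from `u` to `w` along the labelled edges in `S` with label
`g`. -/
inductive Reach (S : Set (V × K × V)) : V → K → V → Prop
  | refl (u) : Reach S u 1 u
  | fwd {u g v k w} : Reach S u g v → (v, k, w) ∈ S → Reach S u (g * k) w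
  | bwd {u g v k w} : Reach S u g v → (w, k, v) ∈ S → Reach S u (g * k⁻¹) w

namespace Reach

variable {S S' : Set (V × K × V)} {u v w : V} {g h k : K}

theorem trans (h1 : Reach S u g v) (h2 : Reach S v h w) : Reach S u (g * h) w := by
  induction h2 with
  | refl => simpa using h1
  | fwd _ he ih => rw [← mul_assoc]; exact ih.fwd he
  | bwd _ he ih => rw [← mul_assoc]; exact ih.bwd he

theorem edge (h : (u, k, w) ∈ S) : Reach S u k w := by
  simpa using (Reach.refl u).fwd h

theorem symm (h1 : Reach S u g v) : Reach S v g⁻¹ u := by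
  induction h1 with
  | refl => simpa using Reach.refl _
  | fwd _ he ih =>
    rw [mul_inv_rev]
    refine Reach.trans ?_ ih
    simpa using (Reach.refl _).bwd he
  | bwd _ he ih =>
    rw [mul_inv_rev, inv_inv]
    exact (edge he).trans ih

/-- Transport along a map of vertices, up to a gauge `τ`. -/
theorem gauge {S' : Set (V' × K' × V')} (φ : V → V') (ψ : K →* K') (τ : V → K')
    (hφ : ∀ p k q, (p, k, q) ∈ S → Reach S' (φ p) (τ p * ψ k * (τ q)⁻¹) (φ q))
    (h : Reach S u g w) : Reach S' (φ u) (τ u * ψ g * (τ w)⁻¹) (φ w) := by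
  induction h with
  | refl => simpa using Reach.refl _
  | @fwd g v k w _ he ih =>
    have := ih.trans (hφ _ _ _ he)
    convert this using 1
    rw [map_mul]; group
  | @bwd g v k w _ he ih =>
    have := ih.trans (hφ _ _ _ he).symm
    convert this using 1
    rw [map_mul, map_inv]; group

theorem map {S' : Set (V' × K' × V')} (φ : V → V') (ψ : K →* K')
    (hφ : ∀ p k q, (p, k, q) ∈ S → Reach S' (φ p) (ψ k) (φ q))
    (h : Reach S u g w) : Reach S' (φ u) (ψ g) (φ w) := by
  have := h.gauge (S' := S') φ ψ (fun _ => 1) (by simpa using hφ)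
  simpa using this

theorem mono_reach (hS : ∀ p k q, (p, k, q) ∈ S → Reach S' p k q) (h : Reach S u g w) :
    Reach S' u g w :=
  h.map id (MonoidHom.id K) hS

theorem mono (hS : S ⊆ S') (h : Reach S u g w) : Reach S' u g w :=
  h.mono_reach fun _ _ _ he => edge (hS he)

/-- Lifting paths along a partial quotient map. -/
theorem lift_of_quotient {S' : Set (V' × K × V')} (φ : V → V')
    (hφ : ∀ p k q, (p, k, q) ∈ S' → ∃ p' q', φ p' = p ∧ φ q' = q ∧ Reach S p' k q')
    (hφ' : ∀ p q, φ p = φ q → Reach S p 1 q) {a b : V'} (h : Reach S' a g b) :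
    ∀ u v, φ u = a → φ v = b → Reach S u g v := by
  induction h with
  | refl => exact fun u v h1 h2 => hφ' u v (h1.trans h2.symm)
  | fwd _ he ih =>
    intro u v h1 h2
    obtain ⟨p', q', h3, h4, h5⟩ := hφ _ _ _ he
    simpa using ((ih u p' h1 h3).trans h5).trans (hφ' q' v (h4.trans h2.symm))
  | bwd _ he ih =>
    intro u v h1 h2
    obtain ⟨p', q', h3, h4, h5⟩ := hφ _ _ _ he
    simpa using ((ih u q' h1 h4).trans h5.symm).trans (hφ' p' v (h3.trans h2.symm))

end Reach

/-- The group of labels of closed paths. -/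
def Loops (S : Set (V × K × V)) (x : V) : Subgroup K where
  carrier := {g | Reach S x g x}
  one_mem' := .refl x
  mul_mem' := fun h1 h2 => h1.trans h2
  inv_mem' := fun h => h.symm

theorem mem_loops {S : Set (V × K × V)} {x : V} {g : K} : g ∈ Loops S x ↔ Reach S x g x := Iff.rfl

theorem mem_loops_conj {S : Set (V × K × V)} {x y : V} {g h : K} (hxy : Reach S x h y) :
    h * g * h⁻¹ ∈ Loops S x ↔ g ∈ Loops S y := by
  constructor
  · intro hg
    have := (hxy.symm.trans hg).trans hxy
    rw [mem_loops]
    convert this using 1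
    group
  · intro hg
    exact (hxy.trans hg).trans hxy.symm

end Reach

/-! ## Finite graphs labelled by generators -/

/-- A finite graph with oriented edges labelled by generators. -/
structure LGraph (m : ℕ) (V : Type*) where
  verts : Finset V
  edges : Finset (V × Fin m × V)
  src_mem : ∀ e ∈ edges, e.1 ∈ verts
  tgt_mem : ∀ e ∈ edges, e.2.2 ∈ verts

namespace LGraph

variable {m : ℕ} {V : Type*} (Γ : LGraph m V)

/-- `Γ.Adj u x w`: there is an oriented edge with label `x` from `u` to `w`. -/
def Adj (u : V) (x : Letter m) (w : V) : Prop :=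
  if x.2 then (u, x.1, w) ∈ Γ.edges else (w, x.1, u) ∈ Γ.edges

/-- The edges labelled by elements of the free group. -/
def gens : Set (V × FreeGroup (Fin m) × V) :=
  {t | ∃ u a w, (u, a, w) ∈ Γ.edges ∧ t = (u, FreeGroup.of a, w)}

def Folded : Prop := PartialAction Γ.Adj

def Connected : Prop := ∀ u ∈ Γ.verts, ∀ w ∈ Γ.verts, ∃ g, Reach Γ.gens u g w

variable {Γ}

theorem adj_true {u w : V} {a : Fin m} : Γ.Adj u (a, true) w ↔ (u, a, w) ∈ Γ.edges := by
  simp [Adj]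

theorem adj_false {u w : V} {a : Fin m} : Γ.Adj u (a, false) w ↔ (w, a, u) ∈ Γ.edges := by
  simp [Adj]

theorem adj_flip {u w : V} {x : Letter m} : Γ.Adj w (flipL x) u ↔ Γ.Adj u x w := by
  obtain ⟨a, b⟩ := x
  cases b <;> simp [Adj, flipL]

theorem Adj.mem_left {u w : V} {x : Letter m} (h : Γ.Adj u x w) : u ∈ Γ.verts := by
  obtain ⟨a, b⟩ := x
  cases b
  · exact Γ.tgt_mem _ (adj_false.1 h)
  · exact Γ.src_mem _ (adj_true.1 h)

theorem Adj.mem_right {u w : V} {x : Letter m} (h : Γ.Adj u x w) : w ∈ Γ.verts :=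
  (adj_flip.2 h).mem_left

theorem mem_gens {u w : V} {g : FreeGroup (Fin m)} :
    (u, g, w) ∈ Γ.gens ↔ ∃ a, (u, a, w) ∈ Γ.edges ∧ g = FreeGroup.of a := by
  constructor
  · rintro ⟨u', a, w', h1, h2⟩
    obtain ⟨rfl, rfl, rfl⟩ : u = u' ∧ g = FreeGroup.of a ∧ w = w' := by simpa using h2
    exact ⟨a, h1, rfl⟩
  · rintro ⟨a, h1, rfl⟩
    exact ⟨u, a, w, h1, rfl⟩

theorem Adj.reach {u w : V} {x : Letter m} (h : Γ.Adj u x w) :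
    Reach Γ.gens u (FreeGroup.mk [x]) w := by
  obtain ⟨a, b⟩ := x
  cases b
  · have := (Reach.edge (S := Γ.gens) (mem_gens.2 ⟨a, adj_false.1 h, rfl⟩)).symm
    exact this
  · exact Reach.edge (mem_gens.2 ⟨a, adj_true.1 h, rfl⟩)

theorem reach_of_run {u w : V} {l : List (Letter m)} (h : Run Γ.Adj u l w) :
    Reach Γ.gens u (FreeGroup.mk l) w := by
  induction l generalizing u with
  | nil => obtain rfl := h; exact .refl _
  | cons x l ih =>
    obtain ⟨c, h1, h2⟩ := h
    have := h1.reach.trans (ih h2)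
    rwa [FreeGroup.mul_mk] at this

theorem exists_run_of_reach {u w : V} {g : FreeGroup (Fin m)} (h : Reach Γ.gens u g w) :
    ∃ l, Run Γ.Adj u l w ∧ FreeGroup.mk l = g := by
  induction h with
  | refl => exact ⟨[], rfl, rfl⟩
  | fwd _ he ih =>
    obtain ⟨l, h1, rfl⟩ := ih
    obtain ⟨a, h2, rfl⟩ := mem_gens.1 he
    exact ⟨l ++ [(a, true)], run_append.2 ⟨_, h1, run_singleton.2 (adj_true.2 h2)⟩,
      FreeGroup.mul_mk.symm⟩
  | bwd _ he ih =>
    obtain ⟨l, h1, rfl⟩ := ih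
    obtain ⟨a, h2, rfl⟩ := mem_gens.1 he
    exact ⟨l ++ [(a, false)], run_append.2 ⟨_, h1, run_singleton.2 (adj_false.2 h2)⟩,
      FreeGroup.mul_mk.symm⟩

theorem folded_iff : Γ.Folded ↔ ∀ u x w w', Γ.Adj u x w → Γ.Adj u x w' → w = w' :=
  ⟨fun h => h.func, fun h => ⟨fun _ _ _ h => adj_flip.2 h, h⟩⟩

theorem _root_.GenericGroups.run_reduce {X : Type*} {E : X → Letter m → X → Prop}
    (hE : PartialAction E) {a b : X} {l : List (Letter m)} (h : Run E a l b) :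
    Run E a (FreeGroup.mk l).toWord b := by
  rw [FreeGroup.toWord_mk]
  exact hE.run_of_red FreeGroup.reduce.red h

/-- The reason for folding: membership in the fundamental group can be tested by reading the reduced
word. -/
theorem Folded.run_toWord (hΓ : Γ.Folded) {u w : V} {g : FreeGroup (Fin m)}
    (h : Reach Γ.gens u g w) : Run Γ.Adj u g.toWord w := by
  obtain ⟨l, h1, rfl⟩ := exists_run_of_reach h
  exact run_reduce hΓ h1

theorem run_mem_verts {u w : V} {l : List (Letter m)} (h : Run Γ.Adj u l w) (hu : u ∈ Γ.verts) :
    w ∈ Γ.verts := by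
  induction l generalizing u with
  | nil => obtain rfl := h; exact hu
  | cons x l ih =>
    obtain ⟨c, h1, h2⟩ := h
    exact ih h2 h1.mem_right

/-! ### Oriented edges and degrees -/

variable (Γ) in
/-- The oriented edges, as triples (origin, label, terminus). -/
def oedges [DecidableEq V] : Finset (V × Letter m × V) :=
  Γ.edges.image (fun e => (e.1, (e.2.1, true), e.2.2)) ∪
    Γ.edges.image (fun e => (e.2.2, (e.2.1, false), e.1))

variable [DecidableEq V]

theorem mem_oedges {u w : V} {x : Letter m} : (u, x, w) ∈ Γ.oedges ↔ Γ.Adj u x w := by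
  obtain ⟨a, b⟩ := x
  unfold oedges
  rw [Finset.mem_union, Finset.mem_image, Finset.mem_image]
  cases b
  · rw [adj_false]
    constructor
    · rintro (⟨⟨p, a', q⟩, h, h2⟩ | ⟨⟨p, a', q⟩, h, h2⟩)
      · simp at h2
      · simp only [Prod.mk.injEq] at h2
        obtain ⟨rfl, ⟨rfl, -⟩, rfl⟩ := h2
        exact h
    · intro h
      exact .inr ⟨_, h, rfl⟩
  · rw [adj_true]
    constructor
    · rintro (⟨⟨p, a', q⟩, h, h2⟩ | ⟨⟨p, a', q⟩, h, h2⟩)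
      · simp only [Prod.mk.injEq] at h2
        obtain ⟨rfl, ⟨rfl, -⟩, rfl⟩ := h2
        exact h
      · simp at h2
    · intro h
      exact .inl ⟨_, h, rfl⟩

theorem card_oedges : Γ.oedges.card = 2 * Γ.edges.card := by
  unfold oedges
  rw [Finset.card_union_of_disjoint, Finset.card_image_of_injective, Finset.card_image_of_injective]
  · omega
  · rintro ⟨p, a, q⟩ ⟨p', a', q'⟩ h
    simp only [Prod.mk.injEq] at h ⊢
    tauto
  · rintro ⟨p, a, q⟩ ⟨p', a', q'⟩ h
    simp only [Prod.mk.injEq] at h ⊢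
    tauto
  · rw [Finset.disjoint_left]
    rintro t h1 h2
    rw [Finset.mem_image] at h1 h2
    obtain ⟨e, -, rfl⟩ := h1
    obtain ⟨e', -, h⟩ := h2
    simp at h

variable (Γ) in
/-- The oriented edges issuing from a vertex. -/
def out (v : V) : Finset (V × Letter m × V) := Γ.oedges.filter (fun t => t.1 = v)

variable (Γ) in
def deg (v : V) : ℕ := (Γ.out v).card

theorem mem_out {u v w : V} {x : Letter m} : (u, x, w) ∈ Γ.out v ↔ Γ.Adj u x w ∧ u = v := by
  rw [out, Finset.mem_filter, mem_oedges]

theorem sum_deg : ∑ v ∈ Γ.verts, Γ.deg v = 2 * Γ.edges.card := by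
  rw [← card_oedges]
  unfold deg out
  rw [← Finset.card_eq_sum_card_fiberwise]
  rintro ⟨u, x, w⟩ h
  exact (mem_oedges.1 h).mem_left

variable (Γ) in
/-- The rank is at most `k`. -/
def RankLE (k : ℕ) : Prop := Γ.edges.card + 1 ≤ Γ.verts.card + k

/-- The sum is minus twice the Euler characteristic. It controls how many vertices can have degree
different from two. -/
theorem sum_deg_sub_le {k : ℕ} (h : Γ.RankLE k) :
    ∑ v ∈ Γ.verts, ((Γ.deg v : ℤ) - 2) ≤ 2 * (k : ℤ) - 2 := by
  rw [Finset.sum_sub_distrib]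
  have := sum_deg (Γ := Γ)
  have h2 : ∑ v ∈ Γ.verts, (Γ.deg v : ℤ) = 2 * Γ.edges.card := by exact_mod_cast this
  rw [h2]
  unfold RankLE at h
  simp
  omega

theorem Folded.deg_le (hΓ : Γ.Folded) (v : V) : Γ.deg v ≤ 2 * m := by
  have h1 : (Γ.out v).card ≤ (Finset.univ : Finset (Letter m)).card := by
    refine Finset.card_le_card_of_injOn (fun t => t.2.1) (fun _ _ => Finset.mem_univ _) ?_
    rintro ⟨u, x, w⟩ h ⟨u', x', w'⟩ h' heq
    rw [Finset.mem_coe, mem_out] at h h'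
    obtain ⟨h, rfl⟩ := h
    obtain ⟨h', rfl⟩ := h'
    obtain rfl : x = x' := heq
    rw [hΓ.func _ _ _ _ h h']
  unfold deg
  refine h1.trans ?_
  rw [Finset.card_univ, Fintype.card_prod, Fintype.card_fin, Fintype.card_bool]
  omega

theorem Folded.adj_of_deg (hΓ : Γ.Folded) {v : V} (hv : 2 * m ≤ Γ.deg v) (x : Letter m) :
    ∃ w, Γ.Adj v x w := by
  have h1 : (Γ.out v).image (fun t => t.2.1) = Finset.univ := by
    rw [← Finset.card_eq_iff_eq_univ, Finset.card_image_of_injOn]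
    · rw [Fintype.card_prod, Fintype.card_fin, Fintype.card_bool]
      have := hΓ.deg_le v
      unfold deg at hv this
      omega
    · rintro ⟨u, x, w⟩ h ⟨u', x', w'⟩ h' heq
      rw [Finset.mem_coe, mem_out] at h h'
      obtain ⟨h, rfl⟩ := h
      obtain ⟨h', rfl⟩ := h'
      obtain rfl : x = x' := heq
      rw [hΓ.func _ _ _ _ h h']
  have h2 : x ∈ (Γ.out v).image (fun t => t.2.1) := by rw [h1]; exact Finset.mem_univ _
  rw [Finset.mem_image] at h2
  obtain ⟨⟨u, x', w⟩, h3, rfl⟩ := h2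
  obtain ⟨h4, rfl⟩ := mem_out.1 h3
  exact ⟨w, h4⟩

/-! ### Folding -/

/-- Identify the ends of two edges with the same origin and label. Exactly one vertex and at least
one edge disappear, so the rank cannot grow; path labels are unchanged because the identified
vertices were already joined by a path with trivial label. -/
theorem exists_fold (hΓ : ¬ Γ.Folded) :
    ∃ (Γ' : LGraph m V) (φ : V → V), Γ'.edges.card < Γ.edges.card ∧
      (∀ k, Γ.RankLE k → Γ'.RankLE k) ∧ (∀ u ∈ Γ.verts, φ u ∈ Γ'.verts) ∧
      (∀ u x w, Γ.Adj u x w → Γ'.Adj (φ u) x (φ w)) ∧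
      (∀ u v g, Reach Γ'.gens (φ u) g (φ v) ↔ Reach Γ.gens u g v) ∧
      (∀ v ∈ Γ'.verts, ∃ u ∈ Γ.verts, φ u = v) := by
  rw [folded_iff] at hΓ
  push Not at hΓ
  obtain ⟨u, x, w, w', h1, h2, hne⟩ := hΓ
  let φ : V → V := fun z => if z = w' then w else z
  have hφw : φ w = w := by simp [φ]
  have hφw' : φ w' = w := by simp [φ]
  have hφne : ∀ z, z ≠ w' → φ z = z := fun z hz => by simp [φ, hz]
  have hφmem : ∀ z ∈ Γ.verts, φ z ∈ Γ.verts.erase w' := by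
    intro z hz
    by_cases h : z = w'
    · subst h; rw [hφw']; exact Finset.mem_erase.2 ⟨hne, h1.mem_right⟩
    · rw [hφne z h]; exact Finset.mem_erase.2 ⟨h, hz⟩
  let Γ' : LGraph m V :=
    { verts := Γ.verts.erase w'
      edges := Γ.edges.image (fun e => (φ e.1, e.2.1, φ e.2.2))
      src_mem := by
        intro e he
        obtain ⟨e', he', rfl⟩ := Finset.mem_image.1 he
        exact hφmem _ (Γ.src_mem _ he')
      tgt_mem := by
        intro e he
        obtain ⟨e', he', rfl⟩ := Finset.mem_image.1 he
        exact hφmem _ (Γ.tgt_mem _ he') }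
  have hadj : ∀ u x w, Γ.Adj u x w → Γ'.Adj (φ u) x (φ w) := by
    rintro u ⟨a, b⟩ w h
    cases b
    · rw [adj_false] at h ⊢
      exact Finset.mem_image_of_mem _ h
    · rw [adj_true] at h ⊢
      exact Finset.mem_image_of_mem _ h
  have hlt : Γ'.edges.card < Γ.edges.card := by
    refine lt_of_le_of_ne Finset.card_image_le ?_
    intro heq
    have hinj := Finset.card_image_iff.1 heq
    obtain ⟨a, b⟩ := x
    cases b
    · rw [adj_false] at h1 h2
      have := hinj h1 h2 (by simp [hφw, hφw'])
      simp at this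
      exact hne this
    · rw [adj_true] at h1 h2
      have := hinj h1 h2 (by simp [hφw, hφw'])
      simp at this
      exact hne this
  have hone : Reach Γ.gens w 1 w' := by
    have := h1.reach.symm.trans h2.reach
    rwa [inv_mul_cancel] at this
  refine ⟨Γ', φ, hlt, ?_, hφmem, hadj, ?_, ?_⟩
  · intro k hk
    have h3 : (Γ.verts.erase w').card = Γ.verts.card - 1 := Finset.card_erase_of_mem h2.mem_right
    have h4 : 0 < Γ.verts.card := Finset.card_pos.2 ⟨_, h2.mem_right⟩
    unfold RankLE at hk ⊢
    change _ ≤ (Γ.verts.erase w').card + k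
    omega
  · intro p q g
    constructor
    · intro h
      refine Reach.lift_of_quotient (S := Γ.gens) φ ?_ ?_ h p q rfl rfl
      · intro p k q hpq
        obtain ⟨a, ha, rfl⟩ := mem_gens.1 hpq
        obtain ⟨⟨p', a', q'⟩, he, heq⟩ := Finset.mem_image.1 ha
        simp only [Prod.mk.injEq] at heq
        obtain ⟨h3, rfl, h4⟩ := heq
        exact ⟨p', q', h3, h4, .edge (mem_gens.2 ⟨_, he, rfl⟩)⟩
      · intro p q hpq
        by_cases hp : p = w'
        · by_cases hq : q = w'
          · rw [hp, hq]; exact .refl _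
          · rw [hφne q hq, hp, hφw'] at hpq
            rw [← hpq, hp]
            simpa using hone.symm
        · by_cases hq : q = w'
          · rw [hφne p hp, hq, hφw'] at hpq
            rw [hpq, hq]; exact hone
          · rw [hφne p hp, hφne q hq] at hpq
            rw [hpq]; exact .refl _
    · intro h
      refine h.map (S' := Γ'.gens) φ (MonoidHom.id _) ?_
      intro p k q hpq
      obtain ⟨a, ha, rfl⟩ := mem_gens.1 hpq
      exact .edge (mem_gens.2 ⟨a, Finset.mem_image_of_mem _ ha, rfl⟩)
  · intro v hv
    have hv' := Finset.mem_erase.1 hv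
    exact ⟨v, hv'.2, hφne v hv'.1⟩

/-! ### Pruning -/

/-- Remove an edge and a vertex. -/
def prune (Γ : LGraph m V) (v : V) (e : V × Fin m × V)
    (h : ∀ e' ∈ Γ.edges, e' ≠ e → e'.1 ≠ v ∧ e'.2.2 ≠ v) : LGraph m V where
  verts := Γ.verts.erase v
  edges := Γ.edges.erase e
  src_mem := by
    intro e' he'
    obtain ⟨h1, h2⟩ := Finset.mem_erase.1 he'
    exact Finset.mem_erase.2 ⟨(h e' h2 h1).1, Γ.src_mem _ h2⟩
  tgt_mem := by
    intro e' he'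
    obtain ⟨h1, h2⟩ := Finset.mem_erase.1 he'
    exact Finset.mem_erase.2 ⟨(h e' h2 h1).2, Γ.tgt_mem _ h2⟩

/-- The removed edge is the only one at `v`. Slide `v` along it to its other end and compensate by a
gauge at `v`; paths between other vertices keep their labels. -/
theorem reach_prune {v : V} {e : V × Fin m × V}
    (h : ∀ e' ∈ Γ.edges, e' ≠ e → e'.1 ≠ v ∧ e'.2.2 ≠ v)
    (hev : (e.1 = v ∧ e.2.2 ≠ v) ∨ (e.2.2 = v ∧ e.1 ≠ v)) (he : e ∈ Γ.edges) {p q : V}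
    (hp : p ≠ v) (hq : q ≠ v) {g : FreeGroup (Fin m)} :
    Reach (Γ.prune v e h).gens p g q ↔ Reach Γ.gens p g q := by
  constructor
  · refine Reach.mono ?_
    rintro ⟨p, g, q⟩ hpq
    obtain ⟨a, ha, rfl⟩ := mem_gens.1 hpq
    exact mem_gens.2 ⟨a, Finset.mem_of_mem_erase ha, rfl⟩
  · intro hr
    obtain ⟨s, a, t⟩ := e
    let o : V := if s = v then t else s
    let c : FreeGroup (Fin m) := if s = v then (FreeGroup.of a)⁻¹ else FreeGroup.of a
    have := hr.gauge (S' := (Γ.prune v (s, a, t) h).gens) (fun z => if z = v then o else z)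
      (MonoidHom.id _) (fun z => if z = v then c else 1) ?_
    · simpa [hp, hq] using this
    · intro p k q hpq
      obtain ⟨b, hb, rfl⟩ := mem_gens.1 hpq
      by_cases heq : (p, b, q) = (s, a, t)
      · simp only [Prod.mk.injEq] at heq
        obtain ⟨rfl, rfl, rfl⟩ := heq
        rcases hev with ⟨h1, h2⟩ | ⟨h1, h2⟩
        · simp only at h1 h2
          simp only [h1, if_true, if_neg h2, o, c, MonoidHom.id_apply]
          simpa using Reach.refl _
        · simp only at h1 h2
          simp only [h1, if_true, if_neg h2, o, c, MonoidHom.id_apply]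
          simpa using Reach.refl _
      · have h3 := h _ hb heq
        simp only [if_neg h3.1, if_neg h3.2, MonoidHom.id_apply]
        simp only [one_mul, inv_one, mul_one]
        exact .edge (mem_gens.2 ⟨b, Finset.mem_erase.2 ⟨heq, hb⟩, rfl⟩)

end LGraph

namespace LGraph

variable {m : ℕ} {V : Type*}

/-- The edge underlying an oriented edge. -/
def edgeOf (u : V) (x : Letter m) (w : V) : V × Fin m × V :=
  if x.2 then (u, x.1, w) else (w, x.1, u)

theorem adj_iff_edgeOf {Γ : LGraph m V} {u w : V} {x : Letter m} :
    Γ.Adj u x w ↔ edgeOf u x w ∈ Γ.edges := by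
  unfold Adj edgeOf
  split_ifs <;> rfl

theorem edgeOf_flip (u : V) (x : Letter m) (w : V) : edgeOf w (flipL x) u = edgeOf u x w := by
  obtain ⟨a, b⟩ := x
  cases b <;> simp [edgeOf, flipL]

theorem edgeOf_eq_iff {u w u' w' : V} {x x' : Letter m} :
    edgeOf u x w = edgeOf u' x' w' ↔
      (u = u' ∧ x = x' ∧ w = w') ∨ (u = w' ∧ x = flipL x' ∧ w = u') := by
  obtain ⟨a, b⟩ := x
  obtain ⟨a', b'⟩ := x'
  cases b <;> cases b' <;> simp [edgeOf, flipL] <;> tauto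

theorem edgeOf_fst (u : V) (x : Letter m) (w : V) :
    ((edgeOf u x w).1 = u ∧ (edgeOf u x w).2.2 = w) ∨
      ((edgeOf u x w).1 = w ∧ (edgeOf u x w).2.2 = u) := by
  unfold edgeOf
  split_ifs <;> simp

/-! ### Adding edges and paths -/

section Attach

variable [DecidableEq V] {Γ : LGraph m V}

/-- Add an oriented edge (and its end points). -/
def addEdge (Γ : LGraph m V) (u : V) (x : Letter m) (w : V) : LGraph m V where
  verts := insert u (insert w Γ.verts)
  edges := insert (edgeOf u x w) Γ.edges
  src_mem := by
    intro e he
    rcases Finset.mem_insert.1 he with rfl | he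
    · rcases edgeOf_fst u x w with h | h <;> simp [h]
    · simp [Γ.src_mem _ he]
  tgt_mem := by
    intro e he
    rcases Finset.mem_insert.1 he with rfl | he
    · rcases edgeOf_fst u x w with h | h <;> simp [h]
    · simp [Γ.tgt_mem _ he]

theorem adj_addEdge_self {u w : V} {x : Letter m} : (Γ.addEdge u x w).Adj u x w :=
  adj_iff_edgeOf.2 (Finset.mem_insert_self _ _)

omit [DecidableEq V] in
theorem gens_subset_of_edges_subset {Γ' : LGraph m V} (h : Γ.edges ⊆ Γ'.edges) :
    Γ.gens ⊆ Γ'.gens := by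
  rintro ⟨p, k, q⟩ hpq
  obtain ⟨a, ha, rfl⟩ := mem_gens.1 hpq
  exact mem_gens.2 ⟨a, h ha, rfl⟩

theorem gens_addEdge {u w : V} {x : Letter m} {p q : V} {k : FreeGroup (Fin m)}
    (h : (p, k, q) ∈ (Γ.addEdge u x w).gens) :
    (p, k, q) ∈ Γ.gens ∨ (p = u ∧ q = w ∧ k = FreeGroup.mk [x]) ∨
      (p = w ∧ q = u ∧ k = (FreeGroup.mk [x])⁻¹) := by
  obtain ⟨a, ha, rfl⟩ := mem_gens.1 h
  rcases Finset.mem_insert.1 ha with h | h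
  · obtain ⟨b, c⟩ := x
    cases c
    · simp only [edgeOf, Prod.mk.injEq] at h
      obtain ⟨rfl, rfl, rfl⟩ := h
      exact .inr (.inr ⟨rfl, rfl, by rw [FreeGroup.inv_mk]; rfl⟩)
    · simp only [edgeOf, Prod.mk.injEq] at h
      obtain ⟨rfl, rfl, rfl⟩ := h
      exact .inr (.inl ⟨rfl, rfl, rfl⟩)
  · exact .inl (mem_gens.2 ⟨a, h, rfl⟩)

/-- Attach a path with a given label. -/
theorem exists_attach [Infinite V] (Γ : LGraph m V) {u w : V} (hu : u ∈ Γ.verts)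
    (hw : w ∈ Γ.verts) {c : List (Letter m)} (hc : c ≠ []) :
    ∃ Γ' : LGraph m V, Γ.verts ⊆ Γ'.verts ∧ Γ.edges ⊆ Γ'.edges ∧
      Γ'.edges.card ≤ Γ.edges.card + c.length ∧
      Γ'.verts.card + 1 = Γ.verts.card + c.length ∧
      (∀ y ∈ Γ.verts, ∀ z ∈ Γ.verts, ∀ g, Reach Γ'.gens y g z ↔
        Reach (Γ.gens ∪ {(u, FreeGroup.mk c, w)}) y g z) ∧
      (∀ v ∈ Γ'.verts, ∃ y ∈ Γ.verts, ∃ g, Reach Γ'.gens v g y) ∧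
      (∀ e ∈ Γ'.edges, e ∈ Γ.edges ∨ ((e.1 = u ∨ e.1 = w ∨ e.1 ∉ Γ.verts) ∧
        (e.2.2 = u ∨ e.2.2 = w ∨ e.2.2 ∉ Γ.verts))) := by
  induction c generalizing Γ u with
  | nil => exact absurd rfl hc
  | cons x c ih =>
    by_cases hc' : c = []
    · subst hc'
      have hverts : (Γ.addEdge u x w).verts = Γ.verts := by
        simp [addEdge, hu, hw]
      refine ⟨Γ.addEdge u x w, hverts.ge, Finset.subset_insert _ _, Finset.card_insert_le _ _,
        by rw [hverts]; rfl, ?_, ?_, ?_⟩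
      · intro y _ z _ g
        constructor
        · refine Reach.mono_reach ?_
          intro p k q h
          rcases gens_addEdge h with h | ⟨rfl, rfl, rfl⟩ | ⟨rfl, rfl, rfl⟩
          · exact .edge (.inl h)
          · exact .edge (.inr rfl)
          · exact (Reach.edge (S := Γ.gens ∪ {(q, FreeGroup.mk [x], p)}) (.inr rfl)).symm
        · refine Reach.mono_reach ?_
          rintro p k q (h | h)
          · exact .edge (gens_subset_of_edges_subset (Finset.subset_insert _ _) h)
          · simp only [Set.mem_singleton_iff, Prod.mk.injEq] at h
            obtain ⟨rfl, rfl, rfl⟩ := h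
            exact adj_addEdge_self.reach
      · intro v hv
        rw [hverts] at hv
        exact ⟨v, hv, 1, .refl _⟩
      · intro e he
        rcases Finset.mem_insert.1 he with rfl | he
        · rcases edgeOf_fst u x w with h | h <;> simp [h]
        · exact .inl he
    · obtain ⟨n, hn⟩ := Infinite.exists_notMem_finset Γ.verts
      have hun : u ≠ n := fun h => hn (h ▸ hu)
      have hwn : w ≠ n := fun h => hn (h ▸ hw)
      have hverts : (Γ.addEdge u x n).verts = insert n Γ.verts := by
        simp [addEdge, hu]
      obtain ⟨Γ', h1, h2, h3, h4, h5, h6, h7⟩ := ih (Γ.addEdge u x n) (u := n)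
        (by simp [hverts]) (by simp [hverts, hw]) hc'
      have hsub : Γ.verts ⊆ (Γ.addEdge u x n).verts := by rw [hverts]; exact Finset.subset_insert _ _
      refine ⟨Γ', hsub.trans h1, (Finset.subset_insert _ _).trans h2, ?_, ?_, ?_, ?_, ?_⟩
      · have : (Γ.addEdge u x n).edges.card ≤ Γ.edges.card + 1 := Finset.card_insert_le _ _
        simp; omega
      · rw [hverts, Finset.card_insert_of_notMem hn] at h4
        simp; omega
      · intro y hy z hz g
        rw [h5 y (hsub hy) z (hsub hz)]
        constructor
        · intro hr
          -- Contract the first edge of the new path: the new vertex `n` moves to `u`, with the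
          -- label of that edge as gauge.
          have := hr.gauge (S' := Γ.gens ∪ {(u, FreeGroup.mk (x :: c), w)})
            (fun v => if v = n then u else v) (MonoidHom.id _)
            (fun v => if v = n then FreeGroup.mk [x] else 1) ?_
          · have hyn : y ≠ n := fun h => hn (h ▸ hy)
            have hzn : z ≠ n := fun h => hn (h ▸ hz)
            simpa [hyn, hzn] using this
          · rintro p k q (h | h)
            · rcases gens_addEdge h with h | ⟨rfl, rfl, rfl⟩ | ⟨rfl, rfl, rfl⟩
              · obtain ⟨a, ha, rfl⟩ := mem_gens.1 h
                have hpn : p ≠ n := fun h' => hn (h' ▸ Γ.src_mem _ ha)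
                have hqn : q ≠ n := fun h' => hn (h' ▸ Γ.tgt_mem _ ha)
                simp only [if_neg hpn, if_neg hqn, MonoidHom.id_apply, one_mul, inv_one, mul_one]
                exact .edge (.inl h)
              · simp only [if_neg hun, if_true, MonoidHom.id_apply, one_mul, mul_inv_cancel]
                exact .refl _
              · simp only [if_neg hun, if_true, MonoidHom.id_apply, mul_inv_cancel, inv_one, mul_one]
                exact .refl _
            · simp only [Set.mem_singleton_iff, Prod.mk.injEq] at h
              obtain ⟨rfl, rfl, rfl⟩ := h
              simp only [if_true, if_neg hwn, MonoidHom.id_apply, inv_one, mul_one, FreeGroup.mul_mk]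
              exact .edge (.inr rfl)
        · refine Reach.mono_reach ?_
          rintro p k q (h | h)
          · exact .edge (.inl (gens_subset_of_edges_subset (Finset.subset_insert _ _) h))
          · simp only [Set.mem_singleton_iff, Prod.mk.injEq] at h
            obtain ⟨rfl, rfl, rfl⟩ := h
            have h8 : Reach ((Γ.addEdge p x n).gens ∪ {(n, FreeGroup.mk c, q)}) p
                (FreeGroup.mk [x]) n := adj_addEdge_self.reach.mono Set.subset_union_left
            have h9 := h8.trans (.edge (.inr rfl))
            rwa [FreeGroup.mul_mk] at h9
      · intro v hv
        obtain ⟨y, hy, g, hg⟩ := h6 v hv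
        rw [hverts] at hy
        rcases Finset.mem_insert.1 hy with rfl | hy
        · exact ⟨u, hu, _, hg.trans ((adj_addEdge_self.reach.mono
            (gens_subset_of_edges_subset h2)).symm)⟩
        · exact ⟨y, hy, g, hg⟩
      · have aux : ∀ z, (z = n ∨ z = w ∨ z ∉ (Γ.addEdge u x n).verts) →
            (z = u ∨ z = w ∨ z ∉ Γ.verts) := by
          rintro z (rfl | rfl | h)
          · exact .inr (.inr hn)
          · exact .inr (.inl rfl)
          · exact .inr (.inr fun h' => h (hsub h'))
        intro e he
        rcases h7 e he with h | ⟨h, h'⟩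
        · rcases Finset.mem_insert.1 h with rfl | h
          · right
            rcases edgeOf_fst u x n with h | h <;> simp [h, hn]
          · exact .inl h
        · exact .inr ⟨aux _ h, aux _ h'⟩

end Attach

/-! ### Subgraphs -/

theorem exists_crossing {Γ : LGraph m V} {W : Set V} {u w : V} {l : List (Letter m)}
    (h : Run Γ.Adj u l w) (hu : u ∈ W) (hw : w ∉ W) : ∃ p x q, Γ.Adj p x q ∧ p ∈ W ∧ q ∉ W := by
  induction l generalizing u with
  | nil => obtain rfl := h; exact absurd hu hw
  | cons x l ih =>
    obtain ⟨c, h1, h2⟩ := h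
    by_cases hc : c ∈ W
    · exact ih h2 hc
    · exact ⟨u, x, c, h1, hu, hc⟩

theorem Connected.exists_crossing {Γ : LGraph m V} (hΓ : Γ.Connected) {W : Set V} {u w : V}
    (hu : u ∈ Γ.verts) (hw : w ∈ Γ.verts) (huW : u ∈ W) (hwW : w ∉ W) :
    ∃ p x q, Γ.Adj p x q ∧ p ∈ W ∧ q ∉ W := by
  obtain ⟨g, hg⟩ := hΓ u hu w hw
  obtain ⟨l, hl, -⟩ := exists_run_of_reach hg
  exact LGraph.exists_crossing hl huW hwW

/-- Enlarge `W` one vertex at a time along a crossing edge; each new vertex uses up an edge that did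
not lie inside the previous set. -/
theorem Connected.card_le_of_subset [DecidableEq V] {Γ : LGraph m V} (hΓ : Γ.Connected)
    {W : Finset V} (hW : W ⊆ Γ.verts) (hne : W.Nonempty) :
    Γ.verts.card ≤ W.card + (Γ.edges.filter (fun e => ¬ (e.1 ∈ W ∧ e.2.2 ∈ W))).card := by
  induction hn : Γ.verts.card - W.card generalizing W with
  | zero => omega
  | succ n ih =>
    obtain ⟨u, hu⟩ := hne
    obtain ⟨w, hw, hwW⟩ : ∃ w ∈ Γ.verts, w ∉ W := by
      by_contra! hcon
      have := Finset.card_le_card (show Γ.verts ⊆ W from hcon)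
      omega
    obtain ⟨p, x, q, hadj, hp, hq⟩ := hΓ.exists_crossing (W := (W : Set V)) (hW hu) hw
      (by simpa using hu) (by simpa using hwW)
    simp only [Finset.mem_coe] at hp hq
    have h1 := ih (W := insert q W) (Finset.insert_subset hadj.mem_right hW) ⟨q, by simp⟩
      (by rw [Finset.card_insert_of_notMem hq]; omega)
    rw [Finset.card_insert_of_notMem hq] at h1
    have h2 : (Γ.edges.filter (fun e => ¬ (e.1 ∈ insert q W ∧ e.2.2 ∈ insert q W))).card <
        (Γ.edges.filter (fun e => ¬ (e.1 ∈ W ∧ e.2.2 ∈ W))).card := by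
      refine Finset.card_lt_card (Finset.ssubset_iff_of_subset ?_ |>.2 ⟨edgeOf p x q, ?_, ?_⟩)
      · intro e he
        rw [Finset.mem_filter] at he ⊢
        refine ⟨he.1, fun h => he.2 ⟨by simp [h.1], by simp [h.2]⟩⟩
      · rw [Finset.mem_filter]
        refine ⟨adj_iff_edgeOf.1 hadj, ?_⟩
        rcases edgeOf_fst p x q with h | h <;> simp [h, hq]
      · rw [Finset.mem_filter]
        push Not
        intro _
        rcases edgeOf_fst p x q with h | h <;> simp [h, hp]
    omega

/-- The missing vertices are outnumbered by, or equal in number to, the edges outside the subgraph,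
so dropping both does not increase the rank. The subgraph itself need not be connected. -/
theorem Connected.rankLE_of_subgraph [DecidableEq V] {Γ Δ : LGraph m V} (hΓ : Γ.Connected)
    (hV : Δ.verts ⊆ Γ.verts) (hE : Δ.edges ⊆ Γ.edges) (hne : Δ.verts.Nonempty) {k : ℕ}
    (hk : Γ.RankLE k) : Δ.RankLE k := by
  have h1 := hΓ.card_le_of_subset hV hne
  have h2 : (Γ.edges.filter (fun e => ¬ (e.1 ∈ Δ.verts ∧ e.2.2 ∈ Δ.verts))).card +
      Δ.edges.card ≤ Γ.edges.card := by
    rw [← Finset.card_union_of_disjoint]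
    · exact Finset.card_le_card (Finset.union_subset (Finset.filter_subset _ _) hE)
    · rw [Finset.disjoint_left]
      intro e he he'
      exact (Finset.mem_filter.1 he).2 ⟨Δ.src_mem _ he', Δ.tgt_mem _ he'⟩
  unfold RankLE at hk ⊢
  omega

/-! ### Walks -/

/-- The word `ω i, …, ω (i + k - 1)`. -/
def _root_.GenericGroups.seg {β : Type*} (ω : ℕ → β) (i k : ℕ) : List β :=
  (List.range k).map fun j => ω (i + j)

section Seg

variable {β : Type*} (ω : ℕ → β)

@[simp] theorem _root_.GenericGroups.length_seg (i k : ℕ) : (seg ω i k).length = k := by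
  simp [seg]

theorem _root_.GenericGroups.seg_succ (i k : ℕ) : seg ω i (k + 1) = seg ω i k ++ [ω (i + k)] := by
  simp [seg, List.range_succ]

theorem _root_.GenericGroups.seg_add (i k l : ℕ) :
    seg ω i (k + l) = seg ω i k ++ seg ω (i + k) l := by
  induction l with
  | zero => simp [seg]
  | succ l ih => rw [← add_assoc, seg_succ, ih, seg_succ, List.append_assoc, add_assoc]

theorem _root_.GenericGroups.seg_congr {ω ω' : ℕ → β} {i j k : ℕ}
    (h : ∀ l < k, ω (i + l) = ω' (j + l)) : seg ω i k = seg ω' j k := by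
  unfold seg
  apply List.map_congr_left
  intro l hl
  exact h l (List.mem_range.1 hl)

theorem _root_.GenericGroups.invRev_seg {α : Type*} {ω ω' : ℕ → α × Bool} {i j k : ℕ}
    (h : ∀ l < k, ω (i + l) = flipL (ω' (j + (k - 1 - l)))) :
    seg ω i k = FreeGroup.invRev (seg ω' j k) := by
  induction k generalizing i with
  | zero => rfl
  | succ k ih =>
    have h0 := h 0 (by omega)
    have h1 : seg ω i (k + 1) = ω (i + 0) :: seg ω (i + 1) k := by
      rw [add_comm k 1, seg_add]; rfl
    rw [seg_succ ω' j, invRev_concat', h1, h0]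
    congr 1
    apply ih
    intro l hl
    have := h (l + 1) (by omega)
    rw [show i + 1 + l = i + (l + 1) by ring, this]
    congr 3
    omega

theorem _root_.GenericGroups.exists_seg {β : Type*} [Nonempty β] (l : List β) :
    ∃ ω : ℕ → β, seg ω 0 l.length = l := by
  refine ⟨fun i => l.getD i (Classical.arbitrary β), ?_⟩
  apply List.ext_getElem
  · simp
  · intro i h1 h2
    simp [seg, h2]

end Seg

variable {Γ : LGraph m V}

/-- `ν` is a walk of length `N` with label `ω`. -/
def IsWalk (Γ : LGraph m V) (ν : ℕ → V) (ω : ℕ → Letter m) (N : ℕ) : Prop :=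
  ∀ i < N, Γ.Adj (ν i) (ω i) (ν (i + 1))

theorem run_seg {E : V → Letter m → V → Prop} {ν : ℕ → V} {ω : ℕ → Letter m} {i k : ℕ}
    (h : ∀ j, i ≤ j → j < i + k → E (ν j) (ω j) (ν (j + 1))) :
    Run E (ν i) (seg ω i k) (ν (i + k)) := by
  induction k with
  | zero => rfl
  | succ k ih =>
    rw [seg_succ, run_append]
    exact ⟨_, ih fun j h1 h2 => h j h1 (by omega), run_singleton.2 (h _ (by omega) (by omega))⟩

theorem exists_walk {E : V → Letter m → V → Prop} {u w : V} {ω : ℕ → Letter m} {i N : ℕ}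
    (h : Run E u (seg ω i N) w) :
    ∃ ν : ℕ → V, ν 0 = u ∧ ν N = w ∧ ∀ j < N, E (ν j) (ω (i + j)) (ν (j + 1)) := by
  induction N generalizing w with
  | zero => exact ⟨fun _ => u, rfl, h, fun j hj => absurd hj (by omega)⟩
  | succ N ih =>
    rw [seg_succ, run_append] at h
    obtain ⟨c, h1, h2⟩ := h
    obtain ⟨ν, h3, h4, h5⟩ := ih h1
    refine ⟨fun j => if j ≤ N then ν j else w, by simp [h3], by simp, ?_⟩
    intro j hj
    by_cases hjN : j < N
    · simp only [show j ≤ N by omega, show j + 1 ≤ N by omega, if_true]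
      exact h5 j hjN
    · obtain rfl : j = N := by omega
      simp only [le_refl, if_true, show ¬ (j + 1 ≤ j) by omega, if_false, h4]
      exact run_singleton.1 h2

variable [DecidableEq V]

/-- The subgraph spanned by a walk. -/
def support (ν : ℕ → V) (ω : ℕ → Letter m) (N : ℕ) : LGraph m V where
  verts := (Finset.range (N + 1)).image ν
  edges := (Finset.range N).image fun i => edgeOf (ν i) (ω i) (ν (i + 1))
  src_mem := by
    intro e he
    obtain ⟨i, hi, rfl⟩ := Finset.mem_image.1 he
    rw [Finset.mem_range] at hi
    rcases edgeOf_fst (ν i) (ω i) (ν (i + 1)) with h | h <;> rw [h.1] <;>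
      exact Finset.mem_image_of_mem _ (Finset.mem_range.2 (by omega))
  tgt_mem := by
    intro e he
    obtain ⟨i, hi, rfl⟩ := Finset.mem_image.1 he
    rw [Finset.mem_range] at hi
    rcases edgeOf_fst (ν i) (ω i) (ν (i + 1)) with h | h <;> rw [h.2] <;>
      exact Finset.mem_image_of_mem _ (Finset.mem_range.2 (by omega))

section Support

variable {ν : ℕ → V} {ω : ℕ → Letter m} {N : ℕ}

theorem isWalk_support : (support ν ω N).IsWalk ν ω N := fun i hi =>
  adj_iff_edgeOf.2 (Finset.mem_image.2 ⟨i, Finset.mem_range.2 hi, rfl⟩)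

theorem adj_support {u w : V} {x : Letter m} : (support ν ω N).Adj u x w ↔
    ∃ i < N, (ν i = u ∧ ω i = x ∧ ν (i + 1) = w) ∨ (ν i = w ∧ ω i = flipL x ∧ ν (i + 1) = u) := by
  rw [adj_iff_edgeOf]
  simp only [support, Finset.mem_image, Finset.mem_range, edgeOf_eq_iff]

theorem support_edges_subset (h : Γ.IsWalk ν ω N) : (support ν ω N).edges ⊆ Γ.edges := by
  intro e he
  obtain ⟨i, hi, rfl⟩ := Finset.mem_image.1 he
  exact adj_iff_edgeOf.1 (h i (Finset.mem_range.1 hi))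

omit [DecidableEq V] in
theorem isWalk_mem_verts (h : Γ.IsWalk ν ω N) (h0 : ν 0 ∈ Γ.verts) {i : ℕ} (hi : i ≤ N) :
    ν i ∈ Γ.verts := by
  cases i with
  | zero => exact h0
  | succ i => exact (h i (by omega)).mem_right

theorem support_verts_subset (h : Γ.IsWalk ν ω N) (h0 : ν 0 ∈ Γ.verts) :
    (support ν ω N).verts ⊆ Γ.verts := by
  intro v hv
  obtain ⟨i, hi, rfl⟩ := Finset.mem_image.1 hv
  rw [Finset.mem_range] at hi
  exact isWalk_mem_verts h h0 (by omega)

theorem zero_mem_support : ν 0 ∈ (support ν ω N).verts :=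
  Finset.mem_image_of_mem _ (Finset.mem_range.2 (by omega))

theorem support_connected : (support ν ω N).Connected := by
  have h0 : ∀ i ≤ N, ∃ g, Reach (support ν ω N).gens (ν 0) g (ν i) := by
    intro i hi
    have := run_seg (E := (support ν ω N).Adj) (ν := ν) (ω := ω) (i := 0) (k := i)
      fun j _ hj => isWalk_support j (by omega)
    rw [zero_add] at this
    exact ⟨_, reach_of_run this⟩
  intro u hu w hw
  obtain ⟨i, hi, rfl⟩ := Finset.mem_image.1 hu
  obtain ⟨j, hj, rfl⟩ := Finset.mem_image.1 hw
  rw [Finset.mem_range] at hi hj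
  obtain ⟨g, hg⟩ := h0 i (by omega)
  obtain ⟨g', hg'⟩ := h0 j (by omega)
  exact ⟨_, hg.symm.trans hg'⟩

end Support

omit [DecidableEq V] in
theorem Folded.mono {Δ : LGraph m V} (hΓ : Γ.Folded) (h : Δ.edges ⊆ Γ.edges) : Δ.Folded := by
  rw [folded_iff]
  intro u x w w' h1 h2
  exact hΓ.func _ _ _ _ (adj_iff_edgeOf.2 (h (adj_iff_edgeOf.1 h1)))
    (adj_iff_edgeOf.2 (h (adj_iff_edgeOf.1 h2)))

/-- A folded graph of rank at most `m` with full degrees is a rose. -/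
theorem Folded.rose_of_deg {Δ : LGraph m V} (hm : 1 < m) (hf : Δ.Folded) {k : ℕ}
    (hk : Δ.RankLE k) (hkm : k ≤ m) (hdeg : ∀ v ∈ Δ.verts, 2 * m ≤ Δ.deg v) {v : V}
    (hv : v ∈ Δ.verts) : k = m ∧ ∀ x, Δ.Adj v x v := by
  have h1 : Δ.verts.card * (2 * m) ≤ 2 * Δ.edges.card := by
    rw [← sum_deg, ← smul_eq_mul]
    exact Finset.card_nsmul_le_sum _ _ _ hdeg
  have hpos : 0 < Δ.verts.card := Finset.card_pos.2 ⟨v, hv⟩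
  unfold RankLE at hk
  -- Full degrees give at least m edges per vertex; a second vertex would exceed the rank m.
  have h2 : Δ.verts.card * m + 1 ≤ Δ.verts.card + k := by nlinarith
  have h3 : Δ.verts.card = 1 := by
    by_contra h
    have : 2 ≤ Δ.verts.card := by omega
    nlinarith
  rw [h3] at h2
  refine ⟨by omega, fun x => ?_⟩
  obtain ⟨w, hw⟩ := hf.adj_of_deg (hdeg v hv) x
  obtain ⟨z, hz⟩ := Finset.card_eq_one.1 h3
  have h4 := hw.mem_right
  rw [hz, Finset.mem_singleton] at hv h4
  rw [h4, ← hv] at hw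
  exact hw

omit [DecidableEq V] in
theorem reach_of_rose {v : V} (h : ∀ x, Γ.Adj v x v) (g : FreeGroup (Fin m)) :
    Reach Γ.gens v g v := by
  have : ∀ l : List (Letter m), Run Γ.Adj v l v := by
    intro l
    induction l with
    | nil => rfl
    | cons x l ih => exact ⟨v, h x, ih⟩
  have h2 := reach_of_run (this g.toWord)
  rwa [FreeGroup.mk_toWord] at h2

/-! ### Second labels -/

section Dual

variable {K : Type*} [Group K]

omit [DecidableEq V] in
/-- The edges with a second label. -/
def dual (Γ : LGraph m V) (ℓ : V × Fin m × V → K) : Set (V × (FreeGroup (Fin m) × K) × V) :=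
  {t | ∃ e ∈ Γ.edges, t = (e.1, (FreeGroup.of e.2.1, ℓ e), e.2.2)}

variable {ℓ : V × Fin m × V → K}

omit [DecidableEq V] in
theorem dual_fst {u w : V} {t : FreeGroup (Fin m) × K} (h : Reach (Γ.dual ℓ) u t w) :
    Reach Γ.gens u t.1 w := by
  refine h.map id (MonoidHom.fst _ _) ?_
  rintro p k q ⟨⟨p', a, q'⟩, he, heq⟩
  simp only [Prod.mk.injEq] at heq
  obtain ⟨rfl, rfl, rfl⟩ := heq
  exact .edge (mem_gens.2 ⟨a, he, rfl⟩)

omit [DecidableEq V] in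
theorem exists_dual {u w : V} {g : FreeGroup (Fin m)} (h : Reach Γ.gens u g w) :
    ∃ k, Reach (Γ.dual ℓ) u (g, k) w := by
  induction h with
  | refl => exact ⟨1, .refl _⟩
  | fwd _ he ih =>
    obtain ⟨k, hk⟩ := ih
    obtain ⟨a, ha, rfl⟩ := mem_gens.1 he
    exact ⟨_, hk.fwd ⟨_, ha, rfl⟩⟩
  | bwd _ he ih =>
    obtain ⟨k, hk⟩ := ih
    obtain ⟨a, ha, rfl⟩ := mem_gens.1 he
    exact ⟨_, hk.bwd ⟨_, ha, rfl⟩⟩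

omit [DecidableEq V] in
-- Without folding, two paths with the same first label could carry different second labels. With
-- it, the letters act partially on vertices together with accumulated second labels, so the reduced
-- word determines the result.
theorem Folded.dual_unique (hΓ : Γ.Folded) {u w : V} {g : FreeGroup (Fin m)} {k k' : K}
    (h : Reach (Γ.dual ℓ) u (g, k) w) (h' : Reach (Γ.dual ℓ) u (g, k') w) : k = k' := by
  let E : V × K → Letter m → V × K → Prop := fun p x q => Γ.Adj p.1 x q.1 ∧
    q.2 = p.2 * (if x.2 then ℓ (edgeOf p.1 x q.1) else (ℓ (edgeOf p.1 x q.1))⁻¹)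
  have hE : PartialAction E := by
    constructor
    · rintro ⟨p, k⟩ ⟨a, b⟩ ⟨q, k'⟩ ⟨h1, h2⟩
      refine ⟨adj_flip.2 h1, ?_⟩
      simp only at h2
      subst h2
      rw [edgeOf_flip]
      cases b <;> simp [flipL]
    · rintro ⟨p, k⟩ x ⟨q, k1⟩ ⟨q', k2⟩ ⟨h1, h2⟩ ⟨h3, h4⟩
      obtain rfl : q = q' := hΓ.func _ _ _ _ h1 h3
      simp only at h2 h4
      rw [h2, h4]
  have key : ∀ {w : V} {t : FreeGroup (Fin m) × K}, Reach (Γ.dual ℓ) u t w →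
      Run E (u, 1) t.1.toWord (w, t.2) := by
    intro w t ht
    have : ∃ l, Run E (u, 1) l (w, t.2) ∧ FreeGroup.mk l = t.1 := by
      induction ht with
      | refl => exact ⟨[], rfl, rfl⟩
      | fwd _ he ih =>
        obtain ⟨l, h1, h2⟩ := ih
        obtain ⟨⟨p, a, q⟩, he, heq⟩ := he
        simp only [Prod.mk.injEq] at heq
        obtain ⟨rfl, rfl, rfl⟩ := heq
        refine ⟨l ++ [(a, true)], run_append.2 ⟨_, h1, run_singleton.2 ⟨adj_true.2 he, ?_⟩⟩, ?_⟩
        · simp [edgeOf]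
        · rw [← FreeGroup.mul_mk, h2]; rfl
      | bwd _ he ih =>
        obtain ⟨l, h1, h2⟩ := ih
        obtain ⟨⟨p, a, q⟩, he, heq⟩ := he
        simp only [Prod.mk.injEq] at heq
        obtain ⟨rfl, rfl, rfl⟩ := heq
        refine ⟨l ++ [(a, false)], run_append.2 ⟨_, h1, run_singleton.2 ⟨adj_false.2 he, ?_⟩⟩, ?_⟩
        · simp [edgeOf]
        · rw [← FreeGroup.mul_mk, h2]; rfl
    obtain ⟨l, h1, h2⟩ := this
    rw [← h2]
    exact run_reduce hE h1
  have h1 : Run E (u, 1) g.toWord (w, k) := key h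
  have h2 : Run E (u, 1) g.toWord (w, k') := key h'
  exact (Prod.mk.inj (hE.run_func h1 h2)).2

omit [DecidableEq V] in
/-- Transfer of homomorphisms from the first to the second label. -/
theorem Folded.exists_hom (hΓ : Γ.Folded) {ι : Type*} {x : V}
    (f : FreeGroup ι →* FreeGroup (Fin m)) (hf : f.range = Loops Γ.gens x) :
    ∃ f' : FreeGroup ι →* K, (∀ z, Reach (Γ.dual ℓ) x (f z, f' z) x) ∧
      ∀ k, (∃ g, Reach (Γ.dual ℓ) x (g, k) x) ↔ k ∈ f'.range := by
  have hmem : ∀ z, Reach Γ.gens x (f z) x := by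
    intro z
    have : f z ∈ Loops Γ.gens x := by rw [← hf]; exact ⟨z, rfl⟩
    exact this
  choose k hk using fun i => exists_dual (ℓ := ℓ) (hmem (FreeGroup.of i))
  have h1 : ∀ z, Reach (Γ.dual ℓ) x (f z, FreeGroup.lift k z) x := by
    intro z
    have : ((f.prod (FreeGroup.lift k)).range : Subgroup _) ≤ Loops (Γ.dual ℓ) x := by
      have h2 : f.prod (FreeGroup.lift k) =
          FreeGroup.lift (fun i => (f (FreeGroup.of i), k i)) := by
        ext i <;> simp
      rw [h2]
      apply FreeGroup.range_lift_le
      rintro _ ⟨i, rfl⟩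
      exact hk i
    exact this ⟨z, rfl⟩
  refine ⟨FreeGroup.lift k, h1, fun k' => ⟨?_, ?_⟩⟩
  · rintro ⟨g, hg⟩
    have : g ∈ f.range := by rw [hf]; exact dual_fst hg
    obtain ⟨z, rfl⟩ := this
    exact ⟨z, hΓ.dual_unique (h1 z) hg⟩
  · rintro ⟨z, rfl⟩
    exact ⟨_, h1 z⟩

end Dual

end LGraph

namespace LGraph

variable {m : ℕ} {V : Type*} [DecidableEq V] {Γ : LGraph m V}

/-! ### Shortening -/

/-- Delete an edge. -/
def deleteEdge (Γ : LGraph m V) (e : V × Fin m × V) : LGraph m V where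
  verts := Γ.verts
  edges := Γ.edges.erase e
  src_mem := fun e' he' => Γ.src_mem e' (Finset.mem_of_mem_erase he')
  tgt_mem := fun e' he' => Γ.tgt_mem e' (Finset.mem_of_mem_erase he')

theorem adj_deleteEdge {e : V × Fin m × V} {u w : V} {x : Letter m} :
    (Γ.deleteEdge e).Adj u x w ↔ Γ.Adj u x w ∧ edgeOf u x w ≠ e := by
  rw [adj_iff_edgeOf, adj_iff_edgeOf]
  simp [deleteEdge, and_comm]

/-- Replace an edge by a path with the same image in a quotient. -/
theorem Folded.exists_replace (hΓ : Γ.Folded) {p q u w : V} {x : Letter m} (hadj : Γ.Adj p x q)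
    {P Q C : FreeGroup (Fin m)} (hP : Reach (Γ.deleteEdge (edgeOf p x q)).gens u P p)
    (hQ : Reach (Γ.deleteEdge (edgeOf p x q)).gens q Q w) {ι G : Type*} [Group G]
    (π : FreeGroup (Fin m) →* G) (hπ : π P * π (FreeGroup.mk [x]) * π Q * π C = 1)
    (f : FreeGroup ι →* FreeGroup (Fin m)) (hf : f.range = Loops Γ.gens u) :
    (∃ f' : FreeGroup ι →* FreeGroup (Fin m),
      f'.range = Loops ((Γ.deleteEdge (edgeOf p x q)).gens ∪ {(w, C, u)}) u ∧
        π.comp f' = π.comp f) ∧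
    ∀ a b g, Reach Γ.gens a g b →
      ∃ g', Reach ((Γ.deleteEdge (edgeOf p x q)).gens ∪ {(w, C, u)}) a g' b := by
  set e₀ := edgeOf p x q with he₀
  set S := (Γ.deleteEdge e₀).gens ∪ {(w, C, u)} with hS
  set Y := P⁻¹ * C⁻¹ * Q⁻¹ with hY
  -- The second label changes only the edge to be removed: it becomes the label of the detour
  -- through the new path, which has the same image under `π`.
  let ℓ : V × Fin m × V → FreeGroup (Fin m) := fun e =>
    if e = e₀ then (if x.2 then Y else Y⁻¹) else FreeGroup.of e.2.1
  have hYr : Reach S p Y q := by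
    have h1 : Reach S u P p := hP.mono Set.subset_union_left
    have h2 : Reach S q Q w := hQ.mono Set.subset_union_left
    have h3 : Reach S w C u := .edge (.inr rfl)
    exact (h1.symm.trans h3.symm).trans h2.symm
  have hπY : π Y = π (FreeGroup.mk [x]) := by
    have : π (FreeGroup.mk [x]) = (π P)⁻¹ * (π C)⁻¹ * (π Q)⁻¹ := by
      have h1 : π (FreeGroup.mk [x]) = (π P)⁻¹ *
          (π P * π (FreeGroup.mk [x]) * π Q * π C) * (π C)⁻¹ * (π Q)⁻¹ := by group
      rw [h1, hπ]; group
    rw [hY, this]; simp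
  have hE : ∀ a b c, (a, b, c) ∈ Γ.edges → (a, b, c) ≠ e₀ →
      (a, FreeGroup.of b, c) ∈ (Γ.deleteEdge e₀).gens := fun a b c h h' =>
    mem_gens.2 ⟨b, Finset.mem_erase.2 ⟨h', h⟩, rfl⟩
  -- the second labels
  have hsnd : ∀ {a b t}, Reach (Γ.dual ℓ) a t b → Reach S a t.2 b := by
    intro a b t h
    refine h.map id (MonoidHom.snd _ _) ?_
    rintro p' k q' ⟨⟨s, b, t⟩, he, heq⟩
    simp only [Prod.mk.injEq] at heq
    obtain ⟨rfl, rfl, rfl⟩ := heq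
    by_cases h0 : (p', b, q') = e₀
    · have h1 : ℓ (p', b, q') = if x.2 then Y else Y⁻¹ := if_pos h0
      simp only [id, MonoidHom.coe_snd, h1]
      rw [he₀] at h0
      unfold edgeOf at h0
      split_ifs at h0 ⊢
      · simp only [Prod.mk.injEq] at h0
        rw [h0.1, h0.2.2]; exact hYr
      · simp only [Prod.mk.injEq] at h0
        rw [h0.1, h0.2.2]; exact hYr.symm
    · have h1 : ℓ (p', b, q') = FreeGroup.of b := if_neg h0
      simp only [id, MonoidHom.coe_snd, h1]
      exact .edge (.inl (hE _ _ _ he h0))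
  have hquot : ∀ {a b t}, Reach (Γ.dual ℓ) a t b → π t.1 = π t.2 := by
    intro a b t h
    have hone : ∀ e ∈ Γ.edges, π (FreeGroup.of e.2.1) = π (ℓ e) := by
      intro e _
      by_cases h0 : e = e₀
      · have h1 : ℓ e = if x.2 then Y else Y⁻¹ := if_pos h0
        rw [h1, h0, he₀]
        obtain ⟨b, c⟩ := x
        cases c
        · simp only [edgeOf, Bool.false_eq_true, if_false, map_inv, hπY]
          rw [← map_inv, FreeGroup.inv_mk]; rfl
        · simp only [edgeOf, if_true, hπY]; rfl
      · rw [show ℓ e = FreeGroup.of e.2.1 from if_neg h0]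
    induction h with
    | refl => simp
    | fwd _ he ih =>
      obtain ⟨e, he, heq⟩ := he
      simp only [Prod.mk.injEq] at heq
      obtain ⟨-, rfl, -⟩ := heq
      simp [ih, hone e he]
    | bwd _ he ih =>
      obtain ⟨e, he, heq⟩ := he
      simp only [Prod.mk.injEq] at heq
      obtain ⟨-, rfl, -⟩ := heq
      simp [ih, hone e he]
  have hlift0 : ∀ {a b g}, Reach (Γ.deleteEdge e₀).gens a g b → Reach (Γ.dual ℓ) a (g, g) b := by
    intro a b g h
    refine h.map id ((MonoidHom.id _).prod (MonoidHom.id _)) ?_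
    intro a g b h
    obtain ⟨c, hc, rfl⟩ := mem_gens.1 h
    obtain ⟨h1, h2⟩ := Finset.mem_erase.1 hc
    refine .edge ⟨_, h2, ?_⟩
    rw [show ℓ (a, c, b) = FreeGroup.of c from if_neg h1]
    rfl
  have hlift : ∀ {a b g}, Reach S a g b → ∃ h, Reach (Γ.dual ℓ) a (h, g) b := by
    have hstep : ∀ {a g b}, (a, g, b) ∈ S → ∃ h, Reach (Γ.dual ℓ) a (h, g) b := by
      rintro a g b (h | h)
      · exact ⟨g, hlift0 (.edge h)⟩
      · simp only [Set.mem_singleton_iff, Prod.mk.injEq] at h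
        obtain ⟨rfl, rfl, rfl⟩ := h
        have h1 : Reach (Γ.dual ℓ) p (FreeGroup.mk [x], Y) q := by
          obtain ⟨c, d⟩ := x
          cases d
          · have h2 : Reach (Γ.dual ℓ) q (FreeGroup.of c, Y⁻¹) p :=
              .edge ⟨_, adj_false.1 hadj, by simp [ℓ, he₀, edgeOf]⟩
            have h3 := h2.symm
            simp only [Prod.inv_mk, inv_inv] at h3
            rwa [show (FreeGroup.of c)⁻¹ = FreeGroup.mk [(c, false)] by
              rw [FreeGroup.of, FreeGroup.inv_mk]; rfl] at h3
          · exact .edge ⟨_, adj_true.1 hadj, by simp [ℓ, he₀, edgeOf]; rfl⟩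
        -- Conversely the new path is the inverse of the walk through the old edge, read in second
        -- labels, so nothing is lost in the fundamental group.
        have h2 := (((hlift0 hP).trans h1).trans (hlift0 hQ)).symm
        have h3 : ((P, P) * (FreeGroup.mk [x], Y) * (Q, Q))⁻¹ =
            ((P * FreeGroup.mk [x] * Q)⁻¹, g) := by
          simp only [Prod.mk_mul_mk, Prod.inv_mk, Prod.mk.injEq, true_and, hY]
          group
        rw [h3] at h2
        exact ⟨_, h2⟩
    intro a b g h
    induction h with
    | refl => exact ⟨1, .refl _⟩
    | fwd _ he ih =>
      obtain ⟨h, hh⟩ := ih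
      obtain ⟨h', hh'⟩ := hstep he
      exact ⟨_, hh.trans hh'⟩
    | bwd _ he ih =>
      obtain ⟨h, hh⟩ := ih
      obtain ⟨h', hh'⟩ := hstep he
      exact ⟨_, hh.trans hh'.symm⟩
  refine ⟨?_, ?_⟩
  · obtain ⟨f', h1, h2⟩ := hΓ.exists_hom (ℓ := ℓ) f hf
    refine ⟨f', ?_, ?_⟩
    · ext g
      rw [← h2 g, mem_loops]
      exact ⟨fun ⟨_, h⟩ => hsnd h, hlift⟩
    · ext i
      exact (hquot (h1 _)).symm
  · intro a b g h
    obtain ⟨k, hk⟩ := exists_dual (ℓ := ℓ) h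
    exact ⟨k, hsnd hk⟩

/-- Remove a path which ends in a vertex of degree one. -/
theorem exists_prune_path {ν : ℕ → V} {ω : ℕ → Letter m} (K : ℕ)
    (hadj : ∀ j < K, Γ.Adj (ν j) (ω j) (ν (j + 1)))
    (hred : ∀ j, j + 1 < K → ω (j + 1) ≠ flipL (ω j))
    (hout : ∀ j < K, ∀ y w, Γ.Adj (ν j) y w →
      (y = ω j ∧ w = ν (j + 1)) ∨ (0 < j ∧ y = flipL (ω (j - 1)) ∧ w = ν (j - 1))) :
    ∃ Γ' : LGraph m V, Γ'.edges.card + K = Γ.edges.card ∧ Γ'.verts.card + K = Γ.verts.card ∧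
      (∀ e ∈ Γ.edges, e ∉ Γ'.edges → ∃ l < K, e = edgeOf (ν l) (ω l) (ν (l + 1))) ∧
      Γ'.edges ⊆ Γ.edges ∧
      (∀ l < K, edgeOf (ν l) (ω l) (ν (l + 1)) ∉ Γ'.edges) ∧
      (∀ v, v ∈ Γ'.verts ↔ v ∈ Γ.verts ∧ ∀ l < K, v ≠ ν l) ∧
      (∀ l ≤ K, ∀ l' ≤ K, ν l = ν l' → l = l') ∧
      (∀ p q g, (∀ l < K, p ≠ ν l) → (∀ l < K, q ≠ ν l) →
        (Reach Γ'.gens p g q ↔ Reach Γ.gens p g q)) := by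
  induction K with
  | zero =>
    refine ⟨Γ, rfl, rfl, fun e h h' => absurd h h', subset_rfl, by simp, by simp, ?_, by simp⟩
    intro l hl l' hl' _
    omega
  | succ K ih =>
    obtain ⟨Γ', h1, h2, h3, h4, h5, h6, h7, h8⟩ := ih (fun j hj => hadj j (by omega))
      (fun j hj => hred j (by omega)) (fun j hj => hout j (by omega))
    have hKa := hadj K (by omega)
    -- The next edge has not been removed yet: the path has not met an earlier vertex and does not
    -- backtrack.
    have hmem : edgeOf (ν K) (ω K) (ν (K + 1)) ∈ Γ'.edges := by
      by_contra hcon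
      obtain ⟨l, hl, heq⟩ := h3 _ (adj_iff_edgeOf.1 hKa) hcon
      rcases edgeOf_eq_iff.1 heq with ⟨h, -, -⟩ | ⟨h, h', -⟩
      · have := h7 K le_rfl l (by omega) h; omega
      · have := h7 K le_rfl (l + 1) (by omega) h
        subst this
        exact hred l (by omega) h'
    have hne : ν K ≠ ν (K + 1) := by
      intro heq
      have h9 := adj_flip.2 hKa
      rw [← heq] at h9
      rcases hout K (by omega) _ _ h9 with ⟨h, -⟩ | ⟨h, -, h'⟩
      · exact flipL_ne _ h
      · have := h7 K le_rfl (K - 1) (by omega) h'; omega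
    have hinc : ∀ e' ∈ Γ'.edges, e' ≠ edgeOf (ν K) (ω K) (ν (K + 1)) →
        e'.1 ≠ ν K ∧ e'.2.2 ≠ ν K := by
      have key : ∀ y w, Γ'.Adj (ν K) y w →
          edgeOf (ν K) y w = edgeOf (ν K) (ω K) (ν (K + 1)) := by
        intro y w hyw
        have hΓ : Γ.Adj (ν K) y w := adj_iff_edgeOf.2 (h4 (adj_iff_edgeOf.1 hyw))
        rcases hout K (by omega) _ _ hΓ with ⟨rfl, rfl⟩ | ⟨hK, rfl, rfl⟩
        · rfl
        · exfalso
          apply h5 (K - 1) (by omega)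
          rw [show K - 1 + 1 = K by omega, ← edgeOf_flip]
          exact adj_iff_edgeOf.1 hyw
      rintro ⟨s, a, t⟩ he hne'
      refine ⟨?_, ?_⟩
      · rintro rfl
        exact hne' (key (a, true) t (adj_true.2 he))
      · rintro rfl
        exact hne' (key (a, false) s (adj_false.2 he))
    have hKv : ν K ∈ Γ'.verts := (adj_iff_edgeOf.2 hmem).mem_left
    refine ⟨Γ'.prune (ν K) (edgeOf (ν K) (ω K) (ν (K + 1))) hinc, ?_, ?_, ?_, ?_, ?_, ?_, ?_, ?_⟩
    · have := Finset.card_erase_add_one hmem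
      change (Γ'.edges.erase _).card + _ = _
      omega
    · have := Finset.card_erase_add_one hKv
      change (Γ'.verts.erase _).card + _ = _
      omega
    · intro e he he'
      by_cases h : e = edgeOf (ν K) (ω K) (ν (K + 1))
      · exact ⟨K, by omega, h⟩
      · obtain ⟨l, hl, h'⟩ := h3 e he fun h'' => he' (Finset.mem_erase.2 ⟨h, h''⟩)
        exact ⟨l, by omega, h'⟩
    · exact (Finset.erase_subset _ _).trans h4
    · intro l hl h
      obtain ⟨h9, h10⟩ := Finset.mem_erase.1 h
      rcases Nat.lt_succ_iff_lt_or_eq.1 hl with hl | rfl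
      · exact h5 l hl h10
      · exact h9 rfl
    · intro v
      change v ∈ Γ'.verts.erase _ ↔ _
      rw [Finset.mem_erase, h6]
      constructor
      · rintro ⟨h, h', h''⟩
        refine ⟨h', fun l hl => ?_⟩
        rcases Nat.lt_succ_iff_lt_or_eq.1 hl with hl | rfl
        · exact h'' l hl
        · exact h
      · rintro ⟨h, h'⟩
        exact ⟨h' K (by omega), h, fun l hl => h' l (by omega)⟩
    · have hnew : ∀ l ≤ K, ν (K + 1) ≠ ν l := by
        intro l hl h
        rcases Nat.lt_or_eq_of_le hl with hl | rfl
        · exact ((h6 _).1 (adj_iff_edgeOf.2 hmem).mem_right).2 l hl h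
        · exact hne h.symm
      intro l hl l' hl' h
      rcases Nat.lt_or_eq_of_le hl with hl | rfl <;> rcases Nat.lt_or_eq_of_le hl' with hl' | rfl
      · exact h7 l (by omega) l' (by omega) h
      · exact absurd h.symm (hnew l (by omega))
      · exact absurd h (hnew l' (by omega))
      · rfl
    · intro p q g hp hq
      rw [reach_prune hinc ?_ hmem (hp K (by omega)) (hq K (by omega)),
        h8 p q g (fun l hl => hp l (by omega)) (fun l hl => hq l (by omega))]
      rcases edgeOf_fst (ν K) (ω K) (ν (K + 1)) with h | h
      · exact .inl ⟨h.1, by rw [h.2]; exact hne.symm⟩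
      · exact .inr ⟨h.2, by rw [h.1]; exact hne.symm⟩

theorem Folded.out_of_deg_two {v : V} (hv : Γ.deg v = 2) {y y' : Letter m}
    {w w' z : V} {t : Letter m} (h : Γ.Adj v y w) (h' : Γ.Adj v y' w') (hne : y ≠ y')
    (ht : Γ.Adj v t z) : (t = y ∧ z = w) ∨ (t = y' ∧ z = w') := by
  by_contra! hcon
  have h3 : ({(v, y, w), (v, y', w'), (v, t, z)} : Finset (V × Letter m × V)) ⊆ Γ.out v := by
    intro e he
    simp only [Finset.mem_insert, Finset.mem_singleton] at he
    rcases he with rfl | rfl | rfl <;> exact mem_out.2 ⟨‹_›, rfl⟩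
  have h4 := Finset.card_le_card h3
  rw [Finset.card_eq_three.2 ⟨_, _, _, ?_, ?_, ?_, rfl⟩] at h4
  · have : (Γ.out v).card = 2 := hv
    omega
  · simp [hne]
  · simp only [ne_eq, Prod.mk.injEq, true_and, not_and]
    intro h h'
    exact hcon.1 h.symm h'.symm
  · simp only [ne_eq, Prod.mk.injEq, true_and, not_and]
    intro h h'
    exact hcon.2 h.symm h'.symm

/-- Replace a stretch of a reduced walk, whose inner vertices have degree two, by a shorter path
which closes up the rest of the walk. -/
theorem exists_shortening [Infinite V] (hcon : Γ.Connected) (hΓ : Γ.Folded) {k : ℕ}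
    (hk : Γ.RankLE k) {ν : ℕ → V} {ω : ℕ → Letter m} {N i K : ℕ} (hw : Γ.IsWalk ν ω N)
    (hiK : i + K + 1 ≤ N) (hdeg : ∀ j, i < j → j ≤ i + K → Γ.deg (ν j) = 2)
    (hend : ∀ j, i < j → j ≤ i + K → ν j ≠ ν 0 ∧ ν j ≠ ν N)
    (hred : ∀ j, j + 1 < N → ω (j + 1) ≠ flipL (ω j))
    (honce : ∀ j < N, edgeOf (ν j) (ω j) (ν (j + 1)) = edgeOf (ν i) (ω i) (ν (i + 1)) → j = i)
    {c : List (Letter m)} (hc : c ≠ []) (hcK : c.length ≤ K) {ι G : Type*} [Group G]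
    (f : FreeGroup ι →* FreeGroup (Fin m)) (hf : f.range = Loops Γ.gens (ν 0))
    (π : FreeGroup (Fin m) →* G) (hπ : π (FreeGroup.mk (seg ω 0 N)) * π (FreeGroup.mk c) = 1) :
    ∃ (Γ' : LGraph m V) (f' : FreeGroup ι →* FreeGroup (Fin m)),
      Γ'.edges.card < Γ.edges.card ∧ Γ'.Connected ∧ Γ'.RankLE k ∧ ν 0 ∈ Γ'.verts ∧
      f'.range = Loops Γ'.gens (ν 0) ∧ π.comp f' = π.comp f := by
  have hi := hw i (by omega)
  have h0 : ν 0 ∈ Γ.verts := (hw 0 (by omega)).mem_left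
  have hN : ν N ∈ Γ.verts := isWalk_mem_verts hw h0 le_rfl
  set e₀ := edgeOf (ν i) (ω i) (ν (i + 1)) with he₀
  -- Here single traversal is used: the walk before and after step `i` survives the deletion of the
  -- edge.
  have hstep : ∀ j < N, j ≠ i → (Γ.deleteEdge e₀).Adj (ν j) (ω j) (ν (j + 1)) :=
    fun j hj hji => adj_deleteEdge.2 ⟨hw j hj, fun h => hji (honce j hj h)⟩
  have hP : Reach (Γ.deleteEdge e₀).gens (ν 0) (FreeGroup.mk (seg ω 0 i)) (ν i) := by
    have := run_seg (E := (Γ.deleteEdge e₀).Adj) (ν := ν) (ω := ω) (i := 0) (k := i)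
      fun j _ hj => hstep j (by omega) (by omega)
    rw [zero_add] at this
    exact reach_of_run this
  have hQ : Reach (Γ.deleteEdge e₀).gens (ν (i + 1))
      (FreeGroup.mk (seg ω (i + 1) (N - (i + 1)))) (ν N) := by
    have := run_seg (E := (Γ.deleteEdge e₀).Adj) (ν := ν) (ω := ω) (i := i + 1) (k := N - (i + 1))
      fun j _ hj => hstep j (by omega) (by omega)
    rw [show i + 1 + (N - (i + 1)) = N by omega] at this
    exact reach_of_run this
  have hword : seg ω 0 N = seg ω 0 i ++ [ω i] ++ seg ω (i + 1) (N - (i + 1)) := by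
    have h1 : seg ω 0 i ++ [ω i] = seg ω 0 (i + 1) := by rw [seg_succ, zero_add]
    conv_lhs => rw [show N = i + 1 + (N - (i + 1)) by omega, seg_add]
    rw [h1, zero_add]
  obtain ⟨⟨f', hf', hπf⟩, hreach⟩ := hΓ.exists_replace hi hP hQ (C := FreeGroup.mk c) π
    (by rw [← map_mul, ← map_mul, FreeGroup.mul_mk, FreeGroup.mul_mk, ← hword, hπ]) f hf
  obtain ⟨Γ₂, g1, g2, g3, g4, g5, g6, g7⟩ :=
    exists_attach (Γ.deleteEdge e₀) (u := ν N) (w := ν 0) hN h0 hc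
  have hsub : ∀ {u x w}, (Γ.deleteEdge e₀).Adj u x w → Γ₂.Adj u x w := fun h =>
    adj_iff_edgeOf.2 (g2 (adj_iff_edgeOf.1 h))
  -- The attached path meets the old graph only at the ends of the walk, which are not inner
  -- vertices of the stretch.
  have hinv : ∀ j, i < j → j ≤ i + K → ∀ y w, Γ₂.Adj (ν j) y w →
      (Γ.deleteEdge e₀).Adj (ν j) y w := by
    intro j h1 h2 y w hyw
    have hjv : ν j ∈ Γ.verts := isWalk_mem_verts hw h0 (by omega)
    rw [adj_iff_edgeOf] at hyw ⊢
    rcases g7 _ hyw with h | ⟨h, h'⟩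
    · exact h
    · exfalso
      have hj : ν j = ν N ∨ ν j = ν 0 ∨ ν j ∉ (Γ.deleteEdge e₀).verts := by
        rcases edgeOf_fst (ν j) y w with h3 | h3
        · rwa [h3.1] at h
        · rwa [h3.2] at h'
      rcases hj with h | h | h
      · exact (hend j h1 h2).2 h
      · exact (hend j h1 h2).1 h
      · exact h hjv
  -- After the deletion `ν (i + 1)` has degree one, so the other K edges of the stretch form a hair.
  obtain ⟨Γ', p1, p2, -, -, -, p6, -, p8⟩ := exists_prune_path (Γ := Γ₂)
    (ν := fun l => ν (i + 1 + l)) (ω := fun l => ω (i + 1 + l)) K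
    (fun j hj => hsub (hstep (i + 1 + j) (by omega) (by omega)))
    (fun j hj => hred (i + 1 + j) (by omega))
    (by
      intro j hj y w hyw
      have h1 := hinv (i + 1 + j) (by omega) (by omega) y w hyw
      obtain ⟨h2, h3⟩ := adj_deleteEdge.1 h1
      have h4 := hw (i + 1 + j) (by omega)
      have h5 := adj_flip.2 (hw (i + j) (by omega))
      rw [show i + j + 1 = i + 1 + j by ring] at h5
      have h6 : ω (i + 1 + j) ≠ flipL (ω (i + j)) := by
        have := hred (i + j) (by omega)
        rwa [show i + j + 1 = i + 1 + j by ring] at this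
      rcases Folded.out_of_deg_two (hdeg _ (by omega) (by omega)) h4 h5 h6 h2 with
        ⟨rfl, rfl⟩ | ⟨rfl, rfl⟩
      · exact .inl ⟨rfl, rfl⟩
      · rcases Nat.eq_zero_or_pos j with rfl | hj0
        · exfalso
          apply h3
          rw [he₀]
          exact edgeOf_flip _ _ _
        · have hj1 : i + 1 + (j - 1) = i + j := by omega
          exact .inr ⟨hj0, by simp only [hj1], by simp only [hj1]⟩)
  have hn0 : ∀ l < K, ν 0 ≠ ν (i + 1 + l) := fun l hl =>
    (hend _ (by omega) (by omega)).1.symm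
  have hcard : (Γ.deleteEdge e₀).edges.card + 1 = Γ.edges.card :=
    Finset.card_erase_add_one (adj_iff_edgeOf.1 hi)
  have hv' : (Γ.deleteEdge e₀).verts = Γ.verts := rfl
  rw [hv'] at g4 g5 g6 g7
  have hcpos : 0 < c.length := List.length_pos_of_ne_nil hc
  have hreach0 : ∀ v ∈ Γ₂.verts, ∃ g, Reach Γ₂.gens v g (ν 0) := by
    intro v hv
    obtain ⟨y, hy, g, hg⟩ := g6 v hv
    obtain ⟨g', hg'⟩ := hcon y hy (ν 0) h0
    obtain ⟨g'', hg''⟩ := hreach _ _ _ hg'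
    exact ⟨_, hg.trans ((g5 y hy (ν 0) h0 g'').2 hg'')⟩
  -- In all, K + 1 edges are removed and at most |c| ≤ K are added, whence the strict decrease.
  refine ⟨Γ', f', by omega, ?_, ?_, ?_, ?_, hπf⟩
  · intro a ha b hb
    rw [p6] at ha hb
    obtain ⟨g, hg⟩ := hreach0 a ha.1
    obtain ⟨g', hg'⟩ := hreach0 b hb.1
    exact ⟨_, (p8 _ _ _ ha.2 hb.2).2 (hg.trans hg'.symm)⟩
  · unfold RankLE at hk ⊢
    omega
  · rw [p6]
    exact ⟨g1 h0, hn0⟩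
  · rw [hf']
    ext g
    rw [mem_loops, mem_loops, p8 _ _ _ hn0 hn0, g5 _ h0 _ h0]

end LGraph

/-! ### Long stretches of walks -/

section OverlapSection

open FreeGroup (IsReduced invRev)

variable {α : Type*} {S : Set (List (α × Bool))} {lam : ℝ}

/-- A repetition longer than a piece would make two different rotations of the relator equal, which
happens only for proper powers. -/
theorem SmallCancellationSet.seg_ne (hS : SmallCancellationSet lam S)
    (hrot : ∀ a b, a ++ b ∈ S → a ≠ [] → b ≠ [] → a ++ b ≠ b ++ a)
    {ω : ℕ → α × Bool} {N i j K : ℕ} {c : List (α × Bool)} (hs : seg ω 0 N ++ c ∈ S)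
    (hij : i < j) (hj : j + K ≤ N) (hK : lam * ((seg ω 0 N ++ c).length : ℝ) ≤ K) :
    seg ω i K ≠ seg ω j K := by
  intro heq
  have hpos := hS.one_lt _ hs
  have hK0 : 0 < K := by
    rcases Nat.eq_zero_or_pos K with rfl | h
    · simp only [Nat.cast_zero] at hK; linarith
    · exact h
  have hd : seg ω 0 N ++ c = seg ω 0 i ++ (seg ω i (j - i) ++ (seg ω j (N - j) ++ c)) := by
    rw [← List.append_assoc, ← List.append_assoc]
    congr 1
    have h1 := seg_add ω 0 i (j - i)
    have h2 := seg_add ω 0 (i + (j - i)) (N - (i + (j - i)))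
    rw [show i + (j - i) + (N - (i + (j - i))) = N by omega, h1] at h2
    rw [h2]
    simp only [zero_add]
    rw [show i + (j - i) = j by omega]
  have hjs : seg ω j (N - j) = seg ω j K ++ seg ω (j + K) (N - j - K) := by
    rw [← seg_add]; congr 1; omega
  have his : seg ω i (j - i) ++ seg ω j (N - j) = seg ω i K ++ seg ω (i + K) (N - i - K) := by
    rw [← seg_add, show K + (N - i - K) = (j - i) + (N - j) by omega, seg_add,
      show i + (j - i) = j by omega]
  have t1 := hS.rot _ _ (hd ▸ hs)
  have t2 := hS.rot _ _ (by rw [hd, ← List.append_assoc] at hs; exact hs)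
  have hlen : ((seg ω i (j - i) ++ (seg ω j (N - j) ++ c) ++ seg ω 0 i).length : ℝ) =
      ((seg ω 0 N ++ c).length : ℝ) := by
    rw [hd]; simp only [List.length_append]; push_cast; ring
  have h := hS.piece _ t1 _ t2 (seg ω i K) ?_ ?_ ?_
  · refine hrot (seg ω i (j - i)) (seg ω j (N - j) ++ c ++ seg ω 0 i) (by simpa using t1) ?_ ?_ ?_
    · intro h0
      have := congrArg List.length h0
      simp at this; omega
    · intro h0
      have := congrArg List.length h0
      simp at this; omega
    · simpa using h
  · rw [← List.append_assoc, his]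
    simp
  · rw [heq, hjs]
    simp
  · rw [hlen, length_seg]
    exact hK

/-- Likewise, a long segment recurring inverted would make the relator a rotation of its own
inverse. -/
theorem SmallCancellationSet.seg_ne_invRev (hS : SmallCancellationSet lam S)
    (hinv : ∀ s ∈ S, ¬ s ~r invRev s)
    {ω : ℕ → α × Bool} {N i j K : ℕ} {c : List (α × Bool)} (hs : seg ω 0 N ++ c ∈ S)
    (hi : i + K ≤ N) (hj : j + K ≤ N) (hK : lam * ((seg ω 0 N ++ c).length : ℝ) ≤ K) :
    seg ω i K ≠ invRev (seg ω j K) := by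
  intro heq
  have hd : ∀ i, i + K ≤ N → seg ω 0 N ++ c =
      seg ω 0 i ++ (seg ω i K ++ (seg ω (i + K) (N - (i + K)) ++ c)) := by
    intro i hi
    rw [← List.append_assoc, ← List.append_assoc]
    congr 1
    have h1 := seg_add ω 0 i K
    have h2 := seg_add ω 0 (i + K) (N - (i + K))
    rw [show i + K + (N - (i + K)) = N by omega, h1] at h2
    rw [h2]
    simp only [zero_add]
  have t1 := hS.rot _ _ (hd i hi ▸ hs)
  have hs' := hS.inv _ hs
  have e1 : invRev (seg ω 0 N ++ c) = invRev (seg ω (j + K) (N - (j + K)) ++ c) ++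
      (invRev (seg ω j K) ++ invRev (seg ω 0 j)) := by
    rw [hd j hj]; simp only [FreeGroup.invRev_append, List.append_assoc]
  have t2 := hS.rot _ _ (e1 ▸ hs')
  have h := hS.piece _ t1 _ t2 (seg ω i K) (by simp) (by rw [heq]; simp) ?_
  · apply hinv _ hs
    have r1 : seg ω 0 N ++ c ~r
        (seg ω i K ++ (seg ω (i + K) (N - (i + K)) ++ c)) ++ seg ω 0 i := by
      rw [hd i hi]; exact List.isRotated_append
    have r2 : invRev (seg ω 0 N ++ c) ~r (invRev (seg ω j K) ++ invRev (seg ω 0 j)) ++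
        invRev (seg ω (j + K) (N - (j + K)) ++ c) := by
      rw [e1]; exact List.isRotated_append
    rw [h] at r1
    exact r1.trans r2.symm
  · have hlen : ((seg ω i K ++ (seg ω (i + K) (N - (i + K)) ++ c) ++ seg ω 0 i).length : ℝ) =
        ((seg ω 0 N ++ c).length : ℝ) := by
      rw [hd i hi]; simp only [List.length_append]; push_cast; ring
    rw [hlen, length_seg]
    exact hK

end OverlapSection

namespace LGraph

variable {m : ℕ} {V : Type*} [DecidableEq V] {Γ : LGraph m V}

/-- A stretch of a walk, with inner vertices of degree two, which is too long to be a piece is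
traversed only once. -/
theorem stretch_once {S : Set (List (Letter m))} {lam : ℝ} (hS : SmallCancellationSet lam S)
    (hrot : ∀ a b, a ++ b ∈ S → a ≠ [] → b ≠ [] → a ++ b ≠ b ++ a)
    (hinv : ∀ s ∈ S, ¬ s ~r FreeGroup.invRev s)
    {ν : ℕ → V} {ω : ℕ → Letter m} {N i K : ℕ} (hw : Γ.IsWalk ν ω N)
    {c : List (Letter m)} (hs : seg ω 0 N ++ c ∈ S)
    (hiK : i + K + 1 ≤ N) (hdeg : ∀ j, i < j → j ≤ i + K → Γ.deg (ν j) = 2)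
    (hend : ∀ j, i < j → j ≤ i + K → ν j ≠ ν 0 ∧ ν j ≠ ν N)
    (hred : ∀ j, j + 1 < N → ω (j + 1) ≠ flipL (ω j))
    (hK : lam * ((seg ω 0 N ++ c).length : ℝ) ≤ K) {j : ℕ} (hj : j < N)
    (heq : edgeOf (ν j) (ω j) (ν (j + 1)) = edgeOf (ν i) (ω i) (ν (i + 1))) : j = i := by
  have hK' : lam * ((seg ω 0 N ++ c).length : ℝ) ≤ ((K + 1 : ℕ) : ℝ) := by push_cast; linarith
  have htwo : ∀ l < K, ∀ t z, Γ.Adj (ν (i + l + 1)) t z →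
      (t = ω (i + l + 1) ∧ z = ν (i + l + 1 + 1)) ∨ (t = flipL (ω (i + l)) ∧ z = ν (i + l)) := by
    intro l hl t z htz
    exact Folded.out_of_deg_two (hdeg (i + l + 1) (by omega) (by omega)) (hw _ (by omega))
      (adj_flip.2 (hw (i + l) (by omega))) (hred _ (by omega)) htz
  rcases edgeOf_eq_iff.1 heq with ⟨h1, h2, h3⟩ | ⟨h1, h2, h3⟩
  -- A reduced walk that enters the stretch is forced through it by the degree two vertices, and it
  -- cannot stop inside because both of its ends lie off the inner vertices. The K + 1 letters of
  -- the stretch are therefore read again.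
  · have key : ∀ l ≤ K, j + l < N ∧ ω (j + l) = ω (i + l) ∧ ν (j + l + 1) = ν (i + l + 1) := by
      intro l hl
      induction l with
      | zero => exact ⟨hj, h2, h3⟩
      | succ l ih =>
        obtain ⟨a1, a2, a3⟩ := ih (by omega)
        have a4 := hend (i + l + 1) (by omega) (by omega)
        have a5 : j + l + 1 < N := by
          refine lt_of_le_of_ne a1 fun h => a4.2 ?_
          rw [← a3, h]
        have a6 := hw _ a5
        rw [a3] at a6
        rcases htwo l (by omega) _ _ a6 with ⟨a7, a8⟩ | ⟨a7, -⟩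
        · exact ⟨a5, a7, a8⟩
        · exact absurd (a2 ▸ a7) (hred _ a5)
    by_contra hne
    have hseg : seg ω i (K + 1) = seg ω j (K + 1) :=
      seg_congr fun l hl => (key l (by omega)).2.1.symm
    have hjK := (key K le_rfl).1
    rcases lt_or_gt_of_ne hne with h | h
    · exact hS.seg_ne hrot hs h (by omega) hK' hseg.symm
    · exact hS.seg_ne hrot hs h (by omega) hK' hseg
  · exfalso
    -- If the edge is traversed backwards, follow the walk into the past: the stretch has been read
    -- in the inverse direction just before.
    have key : ∀ l ≤ K, l ≤ j ∧ ω (j - l) = flipL (ω (i + l)) ∧ ν (j - l) = ν (i + l + 1) := by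
      intro l hl
      induction l with
      | zero => exact ⟨by omega, h2, h1⟩
      | succ l ih =>
        obtain ⟨a1, a2, a3⟩ := ih (by omega)
        have a4 := hend (i + l + 1) (by omega) (by omega)
        have a5 : l + 1 ≤ j := by
          refine lt_of_le_of_ne a1 fun h => a4.1 ?_
          rw [← a3, h, Nat.sub_self]
        have a6 := adj_flip.2 (hw (j - (l + 1)) (by omega))
        rw [show j - (l + 1) + 1 = j - l by omega, a3] at a6
        rcases htwo l (by omega) _ _ a6 with ⟨a7, a8⟩ | ⟨a7, -⟩
        · refine ⟨a5, ?_, a8⟩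
          rw [← flipL_flipL (ω (j - (l + 1))), a7]
          rfl
        · exfalso
          rw [← a2] at a7
          refine hred (j - (l + 1)) (by omega) ?_
          rw [a7]
          congr 1
          omega
    have hjK := (key K le_rfl).1
    refine hS.seg_ne_invRev hinv hs (i := j - K) (j := i) (K := K + 1) (by omega) (by omega) hK' ?_
    apply invRev_seg
    intro l hl
    have := (key (K - l) (by omega)).2.1
    rw [show j - K + l = j - (K - l) by omega, this]
    congr 2

open Classical in
/-- The continuation of an oriented edge. -/
def next (Γ : LGraph m V) (t : V × Letter m × V) : V × Letter m × V :=
  if h : ∃ t', t'.1 = t.2.2 ∧ Γ.Adj t'.1 t'.2.1 t'.2.2 ∧ t'.2.1 ≠ flipL t.2.1 then h.choose else t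

theorem next_eq {u v w : V} {x y : Letter m} (hv : Γ.deg v = 2) (h : Γ.Adj u x v)
    (h' : Γ.Adj v y w) (hne : y ≠ flipL x) : Γ.next (u, x, v) = (v, y, w) := by
  have hex : ∃ t' : V × Letter m × V, t'.1 = (u, x, v).2.2 ∧ Γ.Adj t'.1 t'.2.1 t'.2.2 ∧
      t'.2.1 ≠ flipL (u, x, v).2.1 := ⟨(v, y, w), rfl, h', hne⟩
  unfold next
  rw [dif_pos hex]
  obtain ⟨h1, h2, h3⟩ := hex.choose_spec
  revert h1 h2 h3
  generalize hex.choose = t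
  obtain ⟨v', y', w'⟩ := t
  rintro rfl h2 h3
  rcases Folded.out_of_deg_two hv h' (adj_flip.2 h) hne h2 with ⟨h4, h5⟩ | ⟨h4, -⟩
  · simp only at h4 h5
    rw [h4, h5]
  · exact absurd h4 h3

/-- A vertex of degree d ≥ 3 satisfies d ≤ 3 (d - 2), and `p` and `q` cost at most 2 more each: the
total is at most 3 (2k - 2) + 4. -/
theorem sum_deg_le {k : ℕ} (hk : Γ.RankLE k) (hdeg : ∀ v ∈ Γ.verts, 2 ≤ Γ.deg v) (p q : V)
    (hk1 : 1 ≤ k) :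
    ∑ v ∈ Γ.verts with (Γ.deg v ≠ 2 ∨ v = p ∨ v = q), Γ.deg v ≤ 6 * k - 2 := by
  have h1 := sum_deg_sub_le hk
  have h2 : ((∑ v ∈ Γ.verts with (Γ.deg v ≠ 2 ∨ v = p ∨ v = q), Γ.deg v : ℕ) : ℤ) ≤
      ∑ v ∈ Γ.verts, (3 * ((Γ.deg v : ℤ) - 2) +
        ((if v = p then 2 else 0) + (if v = q then 2 else 0))) := by
    push_cast
    rw [Finset.sum_filter]
    refine Finset.sum_le_sum fun v hv => ?_
    have := hdeg v hv
    split_ifs with h a b <;>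
      first
      | omega
      | (rcases h with h | h | h <;> first | omega | exact absurd h ‹_›)
  rw [Finset.sum_add_distrib, ← Finset.mul_sum, Finset.sum_add_distrib, Finset.sum_ite_eq',
    Finset.sum_ite_eq'] at h2
  have h3 : (if p ∈ Γ.verts then (2 : ℤ) else 0) ≤ 2 := by split_ifs <;> norm_num
  have h4 : (if q ∈ Γ.verts then (2 : ℤ) else 0) ≤ 2 := by split_ifs <;> norm_num
  omega

/-- A reduced walk with many edges has a long stretch with inner vertices of degree two. -/
theorem exists_stretch {k : ℕ} (hk : Γ.RankLE k) (hk1 : 1 ≤ k)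
    (hdeg : ∀ v ∈ Γ.verts, 2 ≤ Γ.deg v) {ν : ℕ → V} {ω : ℕ → Letter m} {N K : ℕ}
    (hN : 0 < N) (hw : Γ.IsWalk ν ω N) (hred : ∀ j, j + 1 < N → ω (j + 1) ≠ flipL (ω j))
    (hcard : (6 * k - 2) * K < 2 * (support ν ω N).edges.card) :
    ∃ i, i + K + 1 ≤ N ∧ ∀ j, i < j → j ≤ i + K →
      Γ.deg (ν j) = 2 ∧ ν j ≠ ν 0 ∧ ν j ≠ ν N := by
  by_contra! hcon
  have h0 : ν 0 ∈ Γ.verts := (hw 0 hN).mem_left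
  set B := Γ.verts.filter (fun v => Γ.deg v ≠ 2 ∨ v = ν 0 ∨ v = ν N) with hB
  have hmem : ∀ j ≤ N, ν j ∉ B → Γ.deg (ν j) = 2 ∧ ν j ≠ ν 0 ∧ ν j ≠ ν N := by
    intro j hj h
    rw [hB, Finset.mem_filter] at h
    push Not at h
    exact h (isWalk_mem_verts hw h0 hj)
  have hB0 : ν 0 ∈ B := Finset.mem_filter.2 ⟨h0, by simp⟩
  have hBN : ν N ∈ B := Finset.mem_filter.2 ⟨isWalk_mem_verts hw h0 le_rfl, by simp⟩
  have hcon' : ∀ i, i + K + 1 ≤ N → ∃ j, i < j ∧ j ≤ i + K ∧ ν j ∈ B := by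
    intro i hi
    obtain ⟨j, h1, h2, h3⟩ := hcon i hi
    refine ⟨j, h1, h2, ?_⟩
    by_contra h
    obtain ⟨a, b, c⟩ := hmem j (by omega) h
    exact c (h3 a b)
  -- Between visits to `B` the walk has no choice, so an oriented edge of the support is reached
  -- from one leaving `B` by fewer than K forced steps. There are at most 6k - 2 such starting
  -- edges, which bounds the number of edges.
  have hsub : (support ν ω N).oedges ⊆ ((B.biUnion Γ.out) ×ˢ Finset.range K).image
      (fun p => Γ.next^[p.2] p.1) := by
    rintro ⟨u, x, w⟩ ht
    rw [mem_oedges, adj_support] at ht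
    obtain ⟨j, hj, ⟨rfl, rfl, rfl⟩ | ⟨rfl, h2, rfl⟩⟩ := ht
    · -- forwards
      have hex : ∃ d ≤ j, ν (j - d) ∈ B := ⟨j, le_rfl, by simpa using hB0⟩
      classical
      obtain ⟨h1, h2⟩ := Nat.find_spec hex
      set d := Nat.find hex with hd
      have hmin : ∀ d' < d, ν (j - d') ∉ B := fun d' hd' h =>
        Nat.find_min hex hd' ⟨by omega, h⟩
      have hdK : d < K := by
        by_contra hdK
        obtain ⟨j', h3, h4, h5⟩ := hcon' (j - d) (by omega)
        refine hmin (j - j') (by omega) ?_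
        rwa [show j - (j - j') = j' by omega]
      refine Finset.mem_image.2 ⟨((ν (j - d), ω (j - d), ν (j - d + 1)), d), ?_, ?_⟩
      · rw [Finset.mem_product, Finset.mem_biUnion]
        exact ⟨⟨_, h2, mem_out.2 ⟨hw _ (by omega), rfl⟩⟩, Finset.mem_range.2 hdK⟩
      · have : ∀ d' ≤ d, Γ.next^[d'] (ν (j - d), ω (j - d), ν (j - d + 1)) =
            (ν (j - d + d'), ω (j - d + d'), ν (j - d + d' + 1)) := by
          intro d' hd'
          induction d' with
          | zero => rfl
          | succ d' ih =>
            rw [Function.iterate_succ_apply', ih (by omega)]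
            refine next_eq (hmem (j - d + d' + 1) (by omega) ?_).1 (hw (j - d + d') (by omega))
              (hw (j - d + d' + 1) (by omega)) (hred (j - d + d') (by omega))
            have := hmin (d - d' - 1) (by omega)
            rwa [show j - (d - d' - 1) = j - d + d' + 1 by omega] at this
        simp only
        rw [this d le_rfl, show j - d + d = j by omega]
    · -- backwards
      have hx : x = flipL (ω j) := by rw [h2, flipL_flipL]
      subst hx
      have hex : ∃ d, j + 1 + d ≤ N ∧ ν (j + 1 + d) ∈ B :=
        ⟨N - (j + 1), by omega, by rwa [show j + 1 + (N - (j + 1)) = N by omega]⟩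
      classical
      obtain ⟨h1, h2⟩ := Nat.find_spec hex
      set d := Nat.find hex with hd
      have hmin : ∀ d' < d, ν (j + 1 + d') ∉ B := fun d' hd' h =>
        Nat.find_min hex hd' ⟨by omega, h⟩
      have hdK : d < K := by
        by_contra hdK
        obtain ⟨j', h3, h4, h5⟩ := hcon' j (by omega)
        refine hmin (j' - (j + 1)) (by omega) ?_
        rwa [show j + 1 + (j' - (j + 1)) = j' by omega]
      refine Finset.mem_image.2 ⟨((ν (j + d + 1), flipL (ω (j + d)), ν (j + d)), d), ?_, ?_⟩
      · rw [Finset.mem_product, Finset.mem_biUnion]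
        refine ⟨⟨_, h2, mem_out.2 ⟨adj_flip.2 (hw _ (by omega)), ?_⟩⟩, Finset.mem_range.2 hdK⟩
        congr 1; omega
      · have : ∀ d' ≤ d, Γ.next^[d'] (ν (j + d + 1), flipL (ω (j + d)), ν (j + d)) =
            (ν (j + (d - d') + 1), flipL (ω (j + (d - d'))), ν (j + (d - d'))) := by
          intro d' hd'
          induction d' with
          | zero => rfl
          | succ d' ih =>
            rw [Function.iterate_succ_apply', ih (by omega)]
            have e1 : j + (d - d') = j + (d - (d' + 1)) + 1 := by omega
            rw [e1]
            refine next_eq (hmem _ (by omega) ?_).1 (adj_flip.2 (hw _ (by omega)))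
              (adj_flip.2 (hw _ (by omega))) ?_
            · have := hmin (d - (d' + 1)) (by omega)
              rwa [show j + 1 + (d - (d' + 1)) = j + (d - (d' + 1)) + 1 by omega] at this
            · intro h
              rw [flipL_flipL] at h
              exact hred (j + (d - (d' + 1))) (by omega) h.symm
        simp only
        rw [this d le_rfl, Nat.sub_self, add_zero]
  have h1 := (Finset.card_le_card hsub).trans Finset.card_image_le
  rw [card_oedges, Finset.card_product, Finset.card_range] at h1
  have h2 : (B.biUnion Γ.out).card ≤ 6 * k - 2 :=
    Finset.card_biUnion_le.trans (sum_deg_le hk hdeg (ν 0) (ν N) hk1)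
  have h3 := Nat.mul_le_mul_right K h2
  omega

end LGraph

namespace LGraph

variable {m : ℕ}

/-! ### Readable words -/

section ToFGraph

variable {V : Type} (Γ : LGraph m V)

/-- The abstract graph of a graph on a set of vertices. -/
def toFGraph : FGraph m where
  V := {v // v ∈ Γ.verts}
  E := {e // e ∈ Γ.edges}
  src e := ⟨e.1.1, Γ.src_mem _ e.2⟩
  tgt e := ⟨e.1.2.2, Γ.tgt_mem _ e.2⟩
  lab e := e.1.2.1

variable {Γ}

theorem adj_toFGraph (d : Γ.toFGraph.OEdge) :
    Γ.Adj (Γ.toFGraph.origin d).1 (Γ.toFGraph.oLabel d) (Γ.toFGraph.terminus d).1 := by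
  obtain ⟨⟨e, he⟩, b⟩ := d
  cases b
  · exact adj_false.2 he
  · exact adj_true.2 he

theorem exists_oEdge {u w : V} {x : Letter m} (h : Γ.Adj u x w) :
    ∃ d : Γ.toFGraph.OEdge, (Γ.toFGraph.origin d).1 = u ∧ Γ.toFGraph.oLabel d = x ∧
      (Γ.toFGraph.terminus d).1 = w := by
  obtain ⟨a, b⟩ := x
  cases b
  · exact ⟨(⟨_, adj_false.1 h⟩, false), rfl, rfl, rfl⟩
  · exact ⟨(⟨_, adj_true.1 h⟩, true), rfl, rfl, rfl⟩

theorem exists_path_of_run {l : List (Letter m)} {u w : Γ.toFGraph.V}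
    (h : Run Γ.Adj u.1 l w.1) : ∃ p, Γ.toFGraph.IsPath u p w ∧ Γ.toFGraph.pathLabel p = l := by
  induction l generalizing u with
  | nil => exact ⟨[], Subtype.ext h, rfl⟩
  | cons x l ih =>
    obtain ⟨c, h1, h2⟩ := h
    obtain ⟨d, rfl', rfl, rfl⟩ := exists_oEdge h1
    obtain ⟨p, hp, rfl⟩ := ih h2
    exact ⟨d :: p, ⟨Subtype.ext rfl', hp⟩, rfl⟩

theorem isConnected_toFGraph (hΓ : Γ.Connected) (hne : Γ.verts.Nonempty) :
    Γ.toFGraph.IsConnected := by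
  obtain ⟨v, hv⟩ := hne
  refine ⟨⟨⟨v, hv⟩⟩, fun x y => ?_⟩
  obtain ⟨g, hg⟩ := hΓ x.1 x.2 y.1 y.2
  obtain ⟨l, hl, -⟩ := exists_run_of_reach hg
  obtain ⟨p, hp, -⟩ := exists_path_of_run hl
  exact ⟨p, hp⟩

theorem isFolded_toFGraph (hΓ : Γ.Folded) : Γ.toFGraph.IsFolded := by
  intro d d' h h'
  have h1 := adj_toFGraph d
  have h2 := adj_toFGraph d'
  rw [← h, ← h'] at h2
  have h3 := hΓ.func _ _ _ _ h1 h2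
  obtain ⟨⟨⟨s, a, t⟩, he⟩, b⟩ := d
  obtain ⟨⟨⟨s', a', t'⟩, he'⟩, b'⟩ := d'
  simp only [FGraph.oLabel, toFGraph, Prod.mk.injEq] at h'
  obtain ⟨rfl, rfl⟩ := h'
  cases b <;> simp [FGraph.origin, FGraph.terminus, toFGraph] at h h3 <;> simp [h, h3]

theorem degree_toFGraph_le [DecidableEq V] (v : Γ.toFGraph.V) :
    Γ.toFGraph.degree v ≤ Γ.deg v.1 := by
  have h1 : Nat.card {t // t ∈ Γ.out v.1} = Γ.deg v.1 := by simp [deg]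
  rw [← h1]
  refine Nat.card_le_card_of_injective (fun d => ⟨((Γ.toFGraph.origin d.1).1,
    Γ.toFGraph.oLabel d.1, (Γ.toFGraph.terminus d.1).1), mem_out.2 ⟨adj_toFGraph d.1, by rw [d.2]⟩⟩) ?_
  rintro ⟨⟨⟨⟨s, a, t⟩, he⟩, b⟩, hd⟩ ⟨⟨⟨⟨s', a', t'⟩, he'⟩, b'⟩, hd'⟩ h
  simp only [Subtype.mk.injEq, Prod.mk.injEq, FGraph.oLabel, FGraph.origin, FGraph.terminus,
    toFGraph] at h
  obtain ⟨h1, ⟨rfl, rfl⟩, h2⟩ := h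
  cases b <;> simp at h1 h2 <;> simp [h1, h2]

theorem isReadableL_of_run [DecidableEq V] (hΓ : Γ.Connected) (hf : Γ.Folded) {μ : ℝ} {L : ℕ}
    (hk : Γ.RankLE L) {w : List (Letter m)} (hμ : (Γ.edges.card : ℝ) ≤ μ * (w.length : ℝ))
    {u u' v : V} (hu : u ∈ Γ.verts) (hrun : Run Γ.Adj u w u') (hv : v ∈ Γ.verts)
    (hdeg : Γ.deg v < 2 * m) : IsReadableL μ L w := by
  have hE : Nat.card Γ.toFGraph.E = Γ.edges.card := by
    change Nat.card {e // e ∈ Γ.edges} = _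
    simp
  have hV : Nat.card Γ.toFGraph.V = Γ.verts.card := by
    change Nat.card {e // e ∈ Γ.verts} = _
    simp
  refine ⟨Γ.toFGraph, ⟨?_, ?_⟩, isConnected_toFGraph hΓ ⟨u, hu⟩, isFolded_toFGraph hf, ?_, ?_, ?_,
    ⟨v, hv⟩, (degree_toFGraph_le ⟨v, hv⟩).trans_lt hdeg⟩
  · change Finite {e // e ∈ Γ.verts}
    infer_instance
  · change Finite {e // e ∈ Γ.edges}
    infer_instance
  · rwa [hE]
  · unfold FGraph.rank
    rw [hE, hV]
    unfold RankLE at hk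
    omega
  · obtain ⟨p, hp, hl⟩ := exists_path_of_run (u := ⟨u, hu⟩) (w := ⟨u', run_mem_verts hrun hu⟩) hrun
    exact ⟨_, p, _, hp, hl⟩

end ToFGraph

end LGraph

variable {m n : ℕ} {r : Relators m n}

theorem mk_eq_one_of_mem_symmetrized {s : List (Letter m)} (hs : s ∈ symmetrized r) :
    PresentedGroup.mk (Set.range r) (FreeGroup.mk s) = 1 := by
  have key : ∀ g : FreeGroup (Fin m), PresentedGroup.mk (Set.range r) g = 1 →
      s ~r g.toWord → PresentedGroup.mk (Set.range r) (FreeGroup.mk s) = 1 := by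
    intro g hg h
    obtain ⟨c, hc⟩ := isConj_iff.1 (isConj_mk_of_isRotated h.symm)
    rw [FreeGroup.mk_toWord] at hc
    rw [← hc]
    simp [hg]
  have hone : ∀ i, PresentedGroup.mk (Set.range r) (r i) = 1 := fun i =>
    PresentedGroup.one_of_mem ⟨i, rfl⟩
  obtain ⟨i, h | h⟩ := hs
  · exact key _ (hone i) h
  · exact key _ (by rw [map_inv, hone, inv_one]) h

open LGraph in
-- Condition (3) read contrapositively. It speaks of cyclic permutations of the relators only; an
-- inverse relator is treated by reading the path backwards.
theorem not_isReadableL_of_run {L : ℕ} {lam μ : ℝ} (hr : r ∈ genericClass m n lam μ L)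
    {s w : List (Letter m)} (hs : s ∈ symmetrized r) (hw : w <:+: s)
    (hlen : (s.length : ℝ) / 2 ≤ w.length) {V : Type} [DecidableEq V] {Γ : LGraph m V}
    (hΓ : Γ.Connected) (hf : Γ.Folded) (hk : Γ.RankLE L)
    (hμ : (Γ.edges.card : ℝ) ≤ μ * (w.length : ℝ)) {u u' : V} (hu : u ∈ Γ.verts)
    (hrun : Run Γ.Adj u w u') {v : V} (hv : v ∈ Γ.verts) : 2 * m ≤ Γ.deg v := by
  by_contra! hdeg
  obtain ⟨i, hi⟩ := hs
  have hl := length_of_mem_symmetrized hi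
  obtain ⟨-, ⟨-, -, h3⟩, -⟩ := hr
  rcases hi with hi | hi
  · exact (h3 i s hi w hw (by rwa [← hl])).1 (isReadableL_of_run hΓ hf hk hμ hu hrun hv hdeg)
  · have h4 : FreeGroup.invRev s ~r (r i).toWord := by
      have := isRotated_invRev hi
      rwa [FreeGroup.toWord_inv, FreeGroup.invRev_invRev] at this
    refine (h3 i _ h4 (FreeGroup.invRev w) ?_ ?_).1 ?_
    · obtain ⟨a, b, rfl⟩ := hw
      exact ⟨FreeGroup.invRev b, FreeGroup.invRev a, by simp [FreeGroup.invRev_append]⟩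
    · rw [FreeGroup.invRev_length]; rwa [← hl]
    · exact isReadableL_of_run hΓ hf hk (by rwa [FreeGroup.invRev_length])
        (run_mem_verts hrun hu) (hf.run_invRev hrun) hv hdeg

/-! ### Graphs which carry a homomorphism -/

/-- Up to conjugation the homomorphism `ψ` lifts to a homomorphism onto the fundamental group of
the graph `Γ`. -/
structure Carries {ι G : Type*} [Group G] (π : FreeGroup (Fin m) →* G) (k : ℕ)
    (ψ : FreeGroup ι →* G) (Γ : LGraph m ℕ) (x : ℕ) (f : FreeGroup ι →* FreeGroup (Fin m)) :
    Prop where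
  connected : Γ.Connected
  mem : x ∈ Γ.verts
  rank : Γ.RankLE k
  range : f.range = Loops Γ.gens x
  conj : ∃ g, ∀ z, π (f z) = g * ψ z * g⁻¹

namespace Carries

variable {ι G : Type*} [Group G] {π : FreeGroup (Fin m) →* G} {k : ℕ} {ψ : FreeGroup ι →* G}
  {Γ : LGraph m ℕ} {x : ℕ} {f : FreeGroup ι →* FreeGroup (Fin m)}

theorem rebase (h : Carries π k ψ Γ x f) {y : ℕ} (hy : y ∈ Γ.verts) :
    ∃ f', Carries π k ψ Γ y f' := by
  obtain ⟨c, hc⟩ := h.connected x h.mem y hy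
  obtain ⟨g, hg⟩ := h.conj
  refine ⟨(MulAut.conj c⁻¹).toMonoidHom.comp f, h.connected, hy, h.rank, ?_, π c⁻¹ * g, ?_⟩
  · ext z
    rw [← mem_loops_conj hc, ← h.range]
    constructor
    · rintro ⟨a, rfl⟩
      refine ⟨a, ?_⟩
      simp [mul_assoc]
    · rintro ⟨a, ha⟩
      refine ⟨a, ?_⟩
      simp [ha, mul_assoc]
  · intro z
    simp [hg, mul_assoc]

theorem exists_fold (h : Carries π k ψ Γ x f) (hΓ : ¬ Γ.Folded) :
    ∃ Γ' x', Γ'.edges.card < Γ.edges.card ∧ Carries π k ψ Γ' x' f := by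
  obtain ⟨Γ', φ, h1, h2, h3, -, h5, h6⟩ := LGraph.exists_fold hΓ
  refine ⟨Γ', φ x, h1, ?_, h3 _ h.mem, h2 _ h.rank, ?_, h.conj⟩
  · intro u hu w hw
    obtain ⟨u', hu', rfl⟩ := h6 u hu
    obtain ⟨w', hw', rfl⟩ := h6 w hw
    obtain ⟨g, hg⟩ := h.connected u' hu' w' hw'
    exact ⟨g, (h5 _ _ _).2 hg⟩
  · rw [h.range]
    ext g
    exact (h5 _ _ _).symm

open LGraph in
theorem exists_prune (h : Carries π k ψ Γ x f) {v : ℕ} (hdeg : Γ.deg v = 1) :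
    ∃ Γ' x' f', Γ'.edges.card < Γ.edges.card ∧ Carries π k ψ Γ' x' f' := by
  obtain ⟨⟨v', y, w⟩, he⟩ := Finset.card_eq_one.1 hdeg
  have hmem : (v', y, w) ∈ Γ.out v := by rw [he]; simp
  obtain ⟨hadj, rfl⟩ := mem_out.1 hmem
  have huniq : ∀ z t, Γ.Adj v' z t → z = y ∧ t = w := by
    intro z t hzt
    have : (v', z, t) ∈ Γ.out v' := mem_out.2 ⟨hzt, rfl⟩
    rw [he, Finset.mem_singleton] at this
    simpa using this
  have hne : w ≠ v' := by
    rintro rfl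
    exact flipL_ne _ (huniq _ _ (adj_flip.2 hadj)).1
  have hinc : ∀ e' ∈ Γ.edges, e' ≠ edgeOf v' y w → e'.1 ≠ v' ∧ e'.2.2 ≠ v' := by
    rintro ⟨s, a, t⟩ he' hne'
    refine ⟨?_, ?_⟩
    · rintro rfl
      obtain ⟨rfl, rfl⟩ := huniq _ _ (adj_true.2 he')
      exact hne' rfl
    · rintro rfl
      obtain ⟨rfl, rfl⟩ := huniq _ _ (adj_false.2 he')
      exact hne' rfl
  have hev : ((edgeOf v' y w).1 = v' ∧ (edgeOf v' y w).2.2 ≠ v') ∨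
      ((edgeOf v' y w).2.2 = v' ∧ (edgeOf v' y w).1 ≠ v') := by
    rcases edgeOf_fst v' y w with h | h
    · exact .inl ⟨h.1, by rw [h.2]; exact hne⟩
    · exact .inr ⟨h.2, by rw [h.1]; exact hne⟩
  have hE := adj_iff_edgeOf.1 hadj
  obtain ⟨f', hf'⟩ := h.rebase hadj.mem_right
  refine ⟨Γ.prune v' (edgeOf v' y w) hinc, w, f', Finset.card_erase_lt_of_mem hE, ?_,
    Finset.mem_erase.2 ⟨hne, hadj.mem_right⟩, ?_, ?_, hf'.conj⟩
  · intro a ha b hb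
    obtain ⟨ha1, ha2⟩ := Finset.mem_erase.1 ha
    obtain ⟨hb1, hb2⟩ := Finset.mem_erase.1 hb
    obtain ⟨g, hg⟩ := h.connected a ha2 b hb2
    exact ⟨g, (reach_prune hinc hev hE ha1 hb1).2 hg⟩
  · have h1 := Finset.card_erase_add_one hE
    have h2 := Finset.card_erase_add_one hadj.mem_left
    have h3 := h.rank
    unfold RankLE at h3 ⊢
    change (Γ.edges.erase _).card + 1 ≤ (Γ.verts.erase _).card + k
    omega
  · rw [hf'.range]
    ext g
    exact (reach_prune hinc hev hE hne hne).symm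

end Carries

/-! ### Minimising the graph that carries a homomorphism -/

open LGraph in
/-- A folded graph without vertices of degree one, which reads almost all of a relator, is a rose
or can be shortened. -/
theorem Carries.surjective_or_shorten {L : ℕ} {lam μ : ℝ} (hm : 1 < m) (hn : 0 < n)
    (hadm : AdmissibleParameters m L lam μ) (hr : r ∈ genericClass m n lam μ L) {ι : Type*}
    {k : ℕ} (hkm : k ≤ m) (hk1 : 1 ≤ k) {ψ : FreeGroup ι →* PresGroup r} {Γ : LGraph m ℕ} {x : ℕ}
    {f : FreeGroup ι →* FreeGroup (Fin m)}
    (h : Carries (PresentedGroup.mk (Set.range r)) k ψ Γ x f) (hf : Γ.Folded)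
    (hdeg : ∀ v ∈ Γ.verts, 2 ≤ Γ.deg v) {c' d : List (Letter m)} (hs : c' ++ d ∈ symmetrized r)
    (hd : d ≠ []) (hdl : (d.length : ℝ) ≤ 4 * lam * (c' ++ d).length) {u u' : ℕ}
    (hu : u ∈ Γ.verts) (hrun3 : Run Γ.Adj u c' u') :
    (k = m ∧ f.range = ⊤) ∨
    ∃ Γ' x' f', Γ'.edges.card < Γ.edges.card ∧
      Carries (PresentedGroup.mk (Set.range r)) k ψ Γ' x' f' := by
  have hS := smallCancellationSet_symmetrized hm hn hadm hr
  have hone := hS.one_lt _ hs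
  have hlam := hS.pos
  have hspos : (0 : ℝ) < (c' ++ d).length := by
    by_contra hcon
    nlinarith
  set S : ℝ := ((c' ++ d).length : ℝ) with hSdef
  have hN : (1 - 4 * lam) * S ≤ c'.length := by
    rw [hSdef] at hdl ⊢
    simp only [List.length_append, Nat.cast_add] at hdl ⊢
    nlinarith
  have hlam33 := hS.le
  have hNhalf : S / 2 ≤ c'.length := by nlinarith
  have hNpos : 0 < c'.length := by
    rw [← Nat.cast_pos (α := ℝ)]; linarith
  have : Nonempty (Letter m) := ⟨(⟨0, by omega⟩, true)⟩
  obtain ⟨ω, hω⟩ := exists_seg c'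
  set N := c'.length with hNdef
  rw [← hω] at hrun3
  obtain ⟨ν, rfl, -, hw'⟩ := exists_walk hrun3
  have hw : Γ.IsWalk ν ω N := fun j hj => by simpa using hw' j hj
  have hredc : FreeGroup.IsReduced c' := IsReduced.left (hS.red _ hs)
  have hred : ∀ j, j + 1 < N → ω (j + 1) ≠ flipL (ω j) := by
    intro j hj heq
    have h1 : seg ω 0 N = seg ω 0 j ++ (ω j :: ω (j + 1) :: seg ω (j + 2) (N - (j + 2))) := by
      have h2 : N = j + (2 + (N - (j + 2))) := by omega
      conv_lhs => rw [h2, seg_add, seg_add]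
      simp [seg, List.range_succ]
    rw [hω, heq] at h1
    rw [h1] at hredc
    exact not_isReduced_cancel hredc
  set Δ := support ν ω N with hΔ
  have hΔE : Δ.edges ⊆ Γ.edges := support_edges_subset hw
  have hΔf : Δ.Folded := hf.mono hΔE
  have hΔk : Δ.RankLE k := h.connected.rankLE_of_subgraph (support_verts_subset hw hu) hΔE
    ⟨_, zero_mem_support⟩ h.rank
  by_cases hfull : ∀ v ∈ Δ.verts, 2 * m ≤ Δ.deg v
  -- The walk spans a rose with all m petals, so every element of the free group labels a loop at `ν
  -- 0`; conjugating back gives surjectivity.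
  · left
    obtain ⟨hkm', hrose⟩ := hΔf.rose_of_deg hm hΔk hkm hfull zero_mem_support
    refine ⟨hkm', ?_⟩
    rw [h.range, eq_top_iff]
    rintro z -
    obtain ⟨t, ht⟩ := h.connected x h.mem _ hu
    have h1 : ∀ g, Reach Γ.gens (ν 0) g (ν 0) := reach_of_rose fun y =>
      adj_iff_edgeOf.2 (hΔE (adj_iff_edgeOf.1 (hrose y)))
    have h2 := (ht.trans (h1 (t⁻¹ * z * t))).trans ht.symm
    rw [mem_loops]
    convert h2 using 1
    group
  right
  push Not at hfull
  obtain ⟨v, hv, hvdeg⟩ := hfull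
  have hmL := hadm.1
  -- With fewer edges, `Δ` would show more than half of a relator to be readable, having a deficient
  -- vertex and rank at most k ≤ m ≤ L.
  have hmany : μ * (N : ℝ) < Δ.edges.card := by
    by_contra! hcon
    have hΔL : Δ.RankLE L := by
      unfold RankLE at hΔk ⊢
      omega
    have hwalk : Run Δ.Adj (ν 0) c' (ν N) := by
      have := run_seg (E := Δ.Adj) (ν := ν) (ω := ω) (i := 0) (k := N) fun j _ hj =>
        isWalk_support j (by omega)
      rwa [zero_add, hω] at this
    have := not_isReadableL_of_run hr hs (List.prefix_append c' d).isInfix hNhalf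
      support_connected hΔf hΔL hcon zero_mem_support hwalk hv
    exact absurd hvdeg (not_lt.2 this)
  obtain ⟨-, hμ0, -, -, hadm'⟩ := hadm
  have hL : (0 : ℝ) ≤ L := Nat.cast_nonneg _
  have hpar : 15 * (L : ℝ) * lam ≤ μ * (1 - 3 * lam) := by
    rw [le_div_iff₀ (by positivity)] at hadm'
    nlinarith
  -- K must be at least |d|, so that the exchange shortens, and at least lam S, so that the stretch
  -- is no piece. Rounding down is harmless because lam S > 1.
  set K := ⌊4 * lam * S⌋₊ with hKdef
  have hK1 : (K : ℝ) ≤ 4 * lam * S := Nat.floor_le (by positivity)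
  have hK2 : lam * S ≤ K := by
    have := Nat.lt_floor_add_one (4 * lam * S)
    rw [← hKdef] at this
    linarith
  have hdK : d.length ≤ K := Nat.le_floor hdl
  -- This is where the bound on lam is needed: it gives 15 L lam ≤ μ (1 - 3 lam), and with lam ≤
  -- 1/33 this implies 24 L lam < 2 μ (1 - 4 lam).
  have hcard : (6 * k - 2) * K < 2 * Δ.edges.card := by
    have h1 : (((6 * k - 2) * K : ℕ) : ℝ) ≤ 6 * (L : ℝ) * (4 * lam * S) := by
      push_cast
      have h2 : ((6 * k - 2 : ℕ) : ℝ) ≤ 6 * (L : ℝ) := by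
        exact_mod_cast (show 6 * k - 2 ≤ 6 * L by omega)
      exact mul_le_mul h2 hK1 (Nat.cast_nonneg _) (by positivity)
    have h3 : μ * ((1 - 4 * lam) * S) ≤ μ * N := by gcongr
    have h4 : 15 * (L : ℝ) * lam * S ≤ μ * (1 - 3 * lam) * S := by gcongr
    have h5 : 0 ≤ (L : ℝ) * lam * S := by positivity
    have h8 : 0 ≤ μ * S * (1 / 33 - lam) := mul_nonneg (by positivity) (by linarith)
    have h9 : 0 < μ * S := by positivity
    have h6 : (((6 * k - 2) * K : ℕ) : ℝ) < ((2 * Δ.edges.card : ℕ) : ℝ) := by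
      rw [Nat.cast_mul 2]
      push_cast at h1 ⊢
      linarith
    exact_mod_cast h6
  obtain ⟨i, hiK, hstr⟩ := exists_stretch h.rank hk1 hdeg hNpos hw hred hcard
  obtain ⟨f', hf'⟩ := h.rebase hu
  have hs' : seg ω 0 N ++ d ∈ symmetrized r := by rwa [hω]
  have hSat := hr.2.1
  obtain ⟨Γ', f'', h1, h2, h3, h4, h5, h6⟩ := exists_shortening h.connected hf h.rank hw hiK
    (fun j hj hj' => (hstr j hj hj').1) (fun j hj hj' => (hstr j hj hj').2) hred
    (fun j hj heq => stretch_once hS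
      (fun a b hab ha hb => rotation_ne_of_not_isProperPower hSat.2.1 hab ha hb)
      (fun s hs => not_isRotated_invRev (hS.red s hs) (ne_nil_of_mem_symmetrized hr.1 hs))
      hw hs' hiK (fun j hj hj' => (hstr j hj hj').1) (fun j hj hj' => (hstr j hj hj').2) hred
      (by rw [hω]; exact hK2) hj heq)
    hd hdK f' hf'.range (PresentedGroup.mk (Set.range r))
    (by rw [hω, ← map_mul, FreeGroup.mul_mk]; exact mk_eq_one_of_mem_symmetrized hs)
  refine ⟨Γ', ν 0, f'', h1, h2, h4, h3, h5, ?_⟩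
  obtain ⟨t, ht⟩ := hf'.conj
  exact ⟨t, fun z => by rw [← ht z]; exact DFunLike.congr_fun h6 z⟩

open LGraph in
/-- A homomorphism which is carried by a graph of rank at most `m` is carried by a folded graph
with a surjective lift or by one which reads no large part of a relator. -/
theorem Carries.exists_surjective_or_not_run {L : ℕ} {lam μ : ℝ} (hm : 1 < m) (hn : 0 < n)
    (hadm : AdmissibleParameters m L lam μ) (hr : r ∈ genericClass m n lam μ L) {ι : Type*}
    {k : ℕ} (hkm : k ≤ m) (hk1 : 1 ≤ k) {ψ : FreeGroup ι →* PresGroup r} {Γ : LGraph m ℕ} {x : ℕ}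
    {f : FreeGroup ι →* FreeGroup (Fin m)}
    (h : Carries (PresentedGroup.mk (Set.range r)) k ψ Γ x f) :
    ∃ Γ' x' f', Carries (PresentedGroup.mk (Set.range r)) k ψ Γ' x' f' ∧ Γ'.Folded ∧
      ((k = m ∧ f'.range = ⊤) ∨ ∀ (c d : List (Letter m)) (u u' : ℕ), c ++ d ∈ symmetrized r →
        d ≠ [] → (d.length : ℝ) ≤ 4 * lam * (c ++ d).length → u ∈ Γ'.verts →
        ¬ Run Γ'.Adj u c u') := by
  -- Folding, pruning and shortening all lower the number of edges.
  induction hE : Γ.edges.card using Nat.strong_induction_on generalizing Γ x f with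
  | _ E ih =>
  subst hE
  by_cases hf : Γ.Folded
  swap
  · obtain ⟨Γ', x', h1, h2⟩ := h.exists_fold hf
    exact ih _ h1 h2 rfl
  by_cases h1 : ∃ v, Γ.deg v = 1
  · obtain ⟨v, hv⟩ := h1
    obtain ⟨Γ', x', f', h1, h2⟩ := h.exists_prune hv
    exact ih _ h1 h2 rfl
  by_cases h0 : ∃ v ∈ Γ.verts, Γ.deg v = 0
  · obtain ⟨v, hv, hv0⟩ := h0
    -- A connected graph with an isolated vertex is a point. It reads only the empty word, and a
    -- whole relator is too long to be the remainder `d`.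
    refine ⟨Γ, x, f, h, hf, .inr ?_⟩
    intro c d u u' hs _ hdl hu hrun
    have hno : ∀ y w, ¬ Γ.Adj v y w := by
      intro y w hyw
      have : (v, y, w) ∈ Γ.out v := mem_out.2 ⟨hyw, rfl⟩
      rw [Finset.card_eq_zero.1 hv0] at this
      simp at this
    have hnil : ∀ {l w}, Run Γ.Adj v l w → l = [] ∧ w = v := by
      intro l w hl
      cases l with
      | nil => exact ⟨rfl, hl.symm⟩
      | cons y l => obtain ⟨c, hc, -⟩ := hl; exact absurd hc (hno _ _)
    obtain ⟨t, ht⟩ := h.connected v hv u hu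
    obtain ⟨l, hl, -⟩ := exists_run_of_reach ht
    obtain rfl := (hnil hl).2
    obtain rfl := (hnil hrun).1
    have hS := smallCancellationSet_symmetrized hm hn hadm hr
    have h1 := hS.one_lt _ hs
    have h2 := hS.le
    have h3 := hS.pos
    rw [List.nil_append] at hdl h1
    have h4 : (0 : ℝ) < d.length := by
      by_contra hcon
      nlinarith
    nlinarith
  push Not at h0 h1
  have hdeg : ∀ v ∈ Γ.verts, 2 ≤ Γ.deg v := fun v hv => by
    have := h0 v hv
    have := h1 v
    omega
  by_cases hrun : ∀ (c d : List (Letter m)) (u u' : ℕ), c ++ d ∈ symmetrized r →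
        d ≠ [] → (d.length : ℝ) ≤ 4 * lam * (c ++ d).length → u ∈ Γ.verts →
        ¬ Run Γ.Adj u c u'
  · exact ⟨Γ, x, f, h, hf, .inr hrun⟩
  push Not at hrun
  obtain ⟨c, d, u, u', hs, hd, hdl, hu, hrun⟩ := hrun
  rcases h.surjective_or_shorten hm hn hadm hr hkm hk1 hf hdeg hs hd hdl hu hrun with
    h2 | ⟨Γ', x', f', h2, h3⟩
  · exact ⟨Γ, x, f, h, hf, .inl h2⟩
  · exact ih _ h2 h3 rfl

/-! ### Free groups of finite rank are Hopfian -/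

section Hopf

variable {α : Type*} [Finite α]

/-- Free groups of finite rank are residually finite. -/
theorem exists_finite_quotient {g : FreeGroup α} (hg : g ≠ 1) :
    ∃ (Q : Type) (_ : Group Q) (_ : Finite Q) (σ : FreeGroup α →* Q), σ g ≠ 1 := by
  classical
  let B : Set (FreeGroup α) := {h | h.norm ≤ g.norm}
  have hB : B.Finite := by
    refine Set.Finite.of_injOn (f := FreeGroup.toWord) (t := {l | l.length ≤ g.norm})
      (fun h hh => hh) (FreeGroup.toWord_injective.injOn) ?_
    exact List.finite_length_le _ _
  have : Finite ↑{x | x ∈ B} := hB.to_subtype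
  have : Finite B := this
  obtain ⟨N, ⟨e⟩⟩ := Finite.exists_equiv_fin B
  -- Right multiplication by a generator is a partial injection of the finite ball and extends to a
  -- permutation of it.
  let τ : ∀ a : α, {x : B // x.1 * FreeGroup.of a ∈ B} ≃ {x : B // x.1 * (FreeGroup.of a)⁻¹ ∈ B} :=
    fun a =>
    { toFun := fun x => ⟨⟨x.1.1 * FreeGroup.of a, x.2⟩, by simp⟩
      invFun := fun x => ⟨⟨x.1.1 * (FreeGroup.of a)⁻¹, x.2⟩, by simp⟩
      left_inv := fun x => by ext; simp
      right_inv := fun x => by ext; simp }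
  -- a homomorphism into the opposite group, since the action is on the right
  let σ : FreeGroup α →* (Equiv.Perm B)ᵐᵒᵖ := FreeGroup.lift fun a => MulOpposite.op (τ a).extendSubtype
  have hof : ∀ (a : α) (x : B) (hx : x.1 * FreeGroup.of a ∈ B),
      (σ (FreeGroup.of a)).unop x = ⟨x.1 * FreeGroup.of a, hx⟩ := by
    intro a x hx
    simp only [σ, FreeGroup.lift_apply_of, MulOpposite.unop_op]
    exact Equiv.extendSubtype_apply_of_mem (τ a) x hx
  have hlet : ∀ (y : α × Bool) (x : B) (hx : x.1 * FreeGroup.mk [y] ∈ B),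
      (σ (FreeGroup.mk [y])).unop x = ⟨x.1 * FreeGroup.mk [y], hx⟩ := by
    rintro ⟨a, b⟩ x hx
    cases b
    · have h1 : FreeGroup.mk [(a, false)] = (FreeGroup.of a)⁻¹ := rfl
      simp only [h1] at hx ⊢
      have h2 := hof a ⟨_, hx⟩ (by simp)
      simp only [inv_mul_cancel_right] at h2
      rw [map_inv, MulOpposite.unop_inv, Equiv.Perm.inv_eq_iff_eq, h2]
    · exact hof a x hx
  have hrun : ∀ (l : List (α × Bool)), (∀ l', l' <+: l → FreeGroup.mk l' ∈ B) →
      ∀ (h1 : (1 : FreeGroup α) ∈ B) (h : FreeGroup.mk l ∈ B),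
        (σ (FreeGroup.mk l)).unop ⟨1, h1⟩ = ⟨FreeGroup.mk l, h⟩ := by
    intro l
    induction l using List.reverseRecOn with
    | nil =>
      intro _ h1 h
      have h2 : (FreeGroup.mk [] : FreeGroup α) = 1 := rfl
      simp [h2]
    | append_singleton l y ih =>
      intro hl h1 h
      have h3 : FreeGroup.mk (l ++ [y]) = FreeGroup.mk l * FreeGroup.mk [y] := FreeGroup.mul_mk.symm
      have h4 : FreeGroup.mk l ∈ B := hl l (List.prefix_append _ _)
      simp only [h3] at h ⊢
      rw [map_mul, MulOpposite.unop_mul, Equiv.Perm.mul_apply,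
        ih (fun l' hl' => hl l' (hl'.trans (List.prefix_append _ _))) h1 h4, hlet y ⟨_, h4⟩ h]
  let ε : (Equiv.Perm B)ᵐᵒᵖ ≃* (Equiv.Perm (Fin N))ᵐᵒᵖ := MulEquiv.op e.permCongrHom
  refine ⟨(Equiv.Perm (Fin N))ᵐᵒᵖ, inferInstance, Finite.of_equiv _ MulOpposite.opEquiv, ε.toMonoidHom.comp σ, ?_⟩
  intro hcon
  have h1 : σ g = 1 := by
    have : ε (σ g) = 1 := hcon
    simpa using this
  have h1B : (1 : FreeGroup α) ∈ B := by simp [B]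
  have hgB : g ∈ B := le_refl g.norm
  -- All prefixes of the word of `g` stay in the ball, so the permutation belonging to `g` moves 1
  -- to `g`.
  have h2 := hrun g.toWord ?_ h1B (by rwa [FreeGroup.mk_toWord])
  · simp only [FreeGroup.mk_toWord, h1] at h2
    apply hg
    have h3 := congrArg Subtype.val h2
    simpa using h3.symm
  · intro l' hl'
    have h3 : (FreeGroup.mk l').norm ≤ l'.length := FreeGroup.norm_mk_le
    exact h3.trans hl'.length_le

/-- Malcev's argument: precomposition with a surjection is injective on the finite set of
homomorphisms to a finite group `Q`, hence bijective. So every homomorphism to `Q` factors through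
`f` and kills its kernel, contrary to residual finiteness if the kernel is nontrivial. -/
theorem freeGroup_hopfian {f : FreeGroup α →* FreeGroup α} (hf : Function.Surjective f) :
    Function.Injective f := by
  rw [injective_iff_map_eq_one]
  intro g hg
  by_contra hne
  obtain ⟨Q, _, _, σ, hσ⟩ := exists_finite_quotient hne
  have : Finite (FreeGroup α →* Q) := Finite.of_equiv _ (FreeGroup.lift (α := α) (β := Q))
  have hinj : Function.Injective fun τ : FreeGroup α →* Q => τ.comp f := by
    intro τ τ' h
    ext a
    obtain ⟨z, hz⟩ := hf (FreeGroup.of a)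
    rw [← hz]
    exact DFunLike.congr_fun h z
  obtain ⟨τ, rfl⟩ := (Finite.injective_iff_surjective.1 hinj) σ
  apply hσ
  simp [hg]

end Hopf

/-! ### Initial graphs -/

namespace LGraph

variable {m : ℕ}

/-- Each passage along the extra loop splits off a factor in `H`; what remains is a path in the old
graph. -/
theorem reach_union_loop {V : Type*} {S : Set (V × FreeGroup (Fin m) × V)} {x : V}
    {c g : FreeGroup (Fin m)} {H : Subgroup (FreeGroup (Fin m))} (hH : Loops S x ≤ H) (hc : c ∈ H)
    (h : Reach (S ∪ {(x, c, x)}) x g x) : g ∈ H := by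
  have key : ∀ {y g}, Reach (S ∪ {(x, c, x)}) x g y → ∃ t ∈ H, ∃ p, Reach S x p y ∧ g = t * p := by
    intro y g h
    induction h with
    | refl => exact ⟨1, H.one_mem, 1, .refl _, by simp⟩
    | @fwd g v k w _ he ih =>
      obtain ⟨t, ht, p, hp, rfl⟩ := ih
      rcases he with he | he
      · exact ⟨t, ht, _, hp.fwd he, by rw [mul_assoc]⟩
      · simp only [Set.mem_singleton_iff, Prod.mk.injEq] at he
        obtain ⟨rfl, rfl, rfl⟩ := he
        exact ⟨t * p * k, H.mul_mem (H.mul_mem ht (hH hp)) hc, 1, .refl _, by simp⟩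
    | @bwd g v k w _ he ih =>
      obtain ⟨t, ht, p, hp, rfl⟩ := ih
      rcases he with he | he
      · exact ⟨t, ht, _, hp.bwd he, by rw [mul_assoc]⟩
      · simp only [Set.mem_singleton_iff, Prod.mk.injEq] at he
        obtain ⟨rfl, rfl, rfl⟩ := he
        exact ⟨t * p * k⁻¹, H.mul_mem (H.mul_mem ht (hH hp)) (H.inv_mem hc), 1, .refl _, by simp⟩
  obtain ⟨t, ht, p, hp, rfl⟩ := key h
  exact H.mul_mem ht (hH hp)

/-- A finitely generated subgroup is the fundamental group of a finite graph. -/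
theorem exists_wedge (l : List (FreeGroup (Fin m))) : ∃ (Γ : LGraph m ℕ), 0 ∈ Γ.verts ∧
    Γ.Connected ∧ Γ.RankLE l.length ∧ Loops Γ.gens 0 = Subgroup.closure {g | g ∈ l} := by
  induction l with
  | nil =>
    refine ⟨⟨{0}, ∅, by simp, by simp⟩, by simp, ?_, by simp [RankLE], ?_⟩
    · intro u hu w hw
      simp only [Finset.mem_singleton] at hu hw
      subst hu hw
      exact ⟨1, .refl _⟩
    · have : {g : FreeGroup (Fin m) | g ∈ ([] : List (FreeGroup (Fin m)))} = ∅ := by ext; simp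
      rw [this, Subgroup.closure_empty, eq_bot_iff]
      intro g hg
      obtain ⟨w, hw, rfl⟩ := exists_run_of_reach hg
      cases w with
      | nil => exact Subgroup.mem_bot.2 rfl
      | cons x w =>
        obtain ⟨c, hc, -⟩ := hw
        rw [adj_iff_edgeOf] at hc
        simp at hc
  | cons g l ih =>
    obtain ⟨Γ, h0, h1, h2, h3⟩ := ih
    have hset : {h | h ∈ g :: l} = insert g {h | h ∈ l} := by ext; simp
    rw [hset]
    -- A trivial generator has the empty word, to which no petal corresponds.
    by_cases hg : g = 1
    · refine ⟨Γ, h0, h1, ?_, ?_⟩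
      · unfold RankLE at h2 ⊢
        simp only [List.length_cons]
        omega
      · rw [h3, hg, Subgroup.closure_insert_one]
    · have hne : g.toWord ≠ [] := by simpa using hg
      obtain ⟨Γ', a1, a2, a3, a4, a5, a6, -⟩ := exists_attach Γ h0 h0 hne
      rw [FreeGroup.mk_toWord] at a5
      have hsub : Γ.gens ⊆ Γ'.gens := gens_subset_of_edges_subset a2
      refine ⟨Γ', a1 h0, ?_, ?_, ?_⟩
      · have : ∀ v ∈ Γ'.verts, ∃ g, Reach Γ'.gens v g 0 := by
          intro v hv
          obtain ⟨y, hy, p, hp⟩ := a6 v hv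
          obtain ⟨q, hq⟩ := h1 y hy 0 h0
          exact ⟨_, hp.trans (hq.mono hsub)⟩
        intro u hu w hw
        obtain ⟨p, hp⟩ := this u hu
        obtain ⟨q, hq⟩ := this w hw
        exact ⟨_, hp.trans hq.symm⟩
      · unfold RankLE at h2 ⊢
        simp only [List.length_cons]
        omega
      · apply le_antisymm
        · intro z hz
          rw [mem_loops, a5 0 h0 0 h0] at hz
          refine reach_union_loop ?_ (Subgroup.subset_closure (Set.mem_insert _ _)) hz
          rw [h3]
          exact Subgroup.closure_mono (Set.subset_insert _ _)
        · rw [Subgroup.closure_le]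
          rintro z (rfl | hz)
          · exact (a5 0 h0 0 h0 z).2 (.edge (.inr rfl))
          · have : z ∈ Loops Γ.gens 0 := by rw [h3]; exact Subgroup.subset_closure hz
            exact Reach.mono hsub this

end LGraph

/-- Lift the images of the generators through `π` and take the wedge of loops labelled by the lifts.
-/
theorem exists_carries {m k : ℕ} {G : Type*} [Group G] {π : FreeGroup (Fin m) →* G}
    (hπ : Function.Surjective π) (ψ : FreeGroup (Fin k) →* G) :
    ∃ Γ x f, Carries π k ψ Γ x f := by
  choose g hg using fun i => hπ (ψ (FreeGroup.of i))
  obtain ⟨Γ, h0, h1, h2, h3⟩ := LGraph.exists_wedge (List.ofFn g)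
  refine ⟨Γ, 0, FreeGroup.lift g, h1, h0, by simpa using h2, ?_, 1, ?_⟩
  · rw [h3, FreeGroup.range_lift_eq_closure]
    congr 1
    ext z
    simp [List.mem_ofFn]
  · have : π.comp (FreeGroup.lift g) = ψ := by
      ext i
      simp [hg]
    intro z
    simp [← this]

/-! ### Rigidity -/

section Rigid

variable {m n : ℕ} {r : Relators m n} {L : ℕ} {lam μ : ℝ}

/-- `Γ` reads no large part of a relator. -/
def ReadsNoPiece (lam : ℝ) (r : Relators m n) (Γ : LGraph m ℕ) : Prop :=
  ∀ (c d : List (Letter m)) (u u' : ℕ), c ++ d ∈ symmetrized r → d ≠ [] →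
    (d.length : ℝ) ≤ 4 * lam * (c ++ d).length → u ∈ Γ.verts → ¬ Run Γ.Adj u c u'

theorem run_infix {V : Type*} {E : V → Letter m → V → Prop} {u u' : V} {c l : List (Letter m)}
    (h : Run E u l u') (hc : c <:+: l) : ∃ w a b, Run E u a w ∧ Run E w c b := by
  obtain ⟨a, b, rfl⟩ := hc
  rw [run_append] at h
  obtain ⟨w, h1, -⟩ := h
  rw [run_append] at h1
  obtain ⟨w', h2, h3⟩ := h1
  exact ⟨w', a, w, h2, h3⟩

/-- Greendlinger's lemma leaves a remainder of at most 3 lam |s|, while the graph avoids remainders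
up to 4 lam |s|. The slack lam |s| > 1 pays for one letter. -/
theorem ReadsNoPiece.not_infix {Γ : LGraph m ℕ} (hΓ : ReadsNoPiece lam r Γ)
    (hS : SmallCancellationSet lam (symmetrized r)) {c d l : List (Letter m)} {u u' : ℕ}
    (hs : c ++ d ∈ symmetrized r) (hd : (d.length : ℝ) ≤ 3 * lam * (c ++ d).length)
    (hu : u ∈ Γ.verts) (hl : Run Γ.Adj u l u') : ¬ c <:+: l := by
  intro hcl
  have hone := hS.one_lt _ hs
  have hpos := hS.pos
  have key : ∀ c d, c ++ d ∈ symmetrized r → d ≠ [] →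
    (d.length : ℝ) ≤ 4 * lam * (c ++ d).length → ¬ c <:+: l := by
    intro c d hs hd hdl hcl
    obtain ⟨w, a, b, h1, h2⟩ := run_infix hl hcl
    exact hΓ c d w b hs hd hdl (LGraph.run_mem_verts h1 hu) h2
  -- If the whole relator is read, give up its last letter in order to have a nonempty remainder.
  by_cases hd0 : d = []
  · subst hd0
    have hcne : c ≠ [] := by
      rintro rfl
      simp at hone
      linarith
    rw [List.append_nil] at hs hone
    refine key c.dropLast [c.getLast hcne] ?_ (by simp) ?_ ((List.dropLast_prefix c).isInfix.trans hcl)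
    · rwa [List.dropLast_append_getLast]
    · rw [List.dropLast_append_getLast]
      simp only [List.length_singleton, Nat.cast_one]
      linarith
  · refine key c d hs hd0 ?_ hcl
    linarith

theorem HasBigPiece.exists_append {w : List (Letter m)} {S : Set (List (Letter m))}
    (h : HasBigPiece lam S w) : ∃ c d, c ++ d ∈ S ∧ c <:+: w ∧
      (d.length : ℝ) ≤ 3 * lam * (c ++ d).length := by
  obtain ⟨s, hs, c, ⟨d, rfl⟩, hcw, hlen⟩ := h
  refine ⟨c, d, hs, hcw, ?_⟩
  simp only [List.length_append, Nat.cast_add] at hlen ⊢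
  linarith

variable (hm : 1 < m) (hn : 0 < n) (hadm : AdmissibleParameters m L lam μ)
  (hr : r ∈ genericClass m n lam μ L)

include hm hn hadm hr

theorem ReadsNoPiece.injective {Γ : LGraph m ℕ} (hΓ : ReadsNoPiece lam r Γ) (hf : Γ.Folded)
    {x : ℕ} (hx : x ∈ Γ.verts) {g : FreeGroup (Fin m)} (hg : Reach Γ.gens x g x)
    (h1 : PresentedGroup.mk (Set.range r) g = 1) : g = 1 := by
  by_contra hne
  obtain ⟨c, d, hs, hc, hd⟩ := (hasBigPiece_of_mk_eq_one hm hn hadm hr h1 hne).exists_append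
  exact hΓ.not_infix (smallCancellationSet_symmetrized hm hn hadm hr) hs hd hx
    (hf.run_toWord hg) hc

/-- The large part of a relator lies in the reduced form of a⁻¹g. It is a subword of `g` up to its
first letter, and the slack lam |s| > 1 absorbs that letter. -/
theorem ReadsNoPiece.eq_of_of_mk_eq {Γ : LGraph m ℕ} (hΓ : ReadsNoPiece lam r Γ) (hf : Γ.Folded)
    {x : ℕ} (hx : x ∈ Γ.verts) {g : FreeGroup (Fin m)} (hg : Reach Γ.gens x g x) {a : Fin m}
    (h1 : PresentedGroup.mk (Set.range r) g = PresentedGroup.mk (Set.range r) (FreeGroup.of a)) :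
    g = FreeGroup.of a := by
  have hS := smallCancellationSet_symmetrized hm hn hadm hr
  by_contra hne
  have hker : PresentedGroup.mk (Set.range r) ((FreeGroup.of a)⁻¹ * g) = 1 := by
    rw [map_mul, map_inv, h1, inv_mul_cancel]
  obtain ⟨c, d, hs, hc, hd⟩ := (hasBigPiece_of_mk_eq_one hm hn hadm hr hker
    (fun h => hne (inv_mul_eq_one.1 h).symm)).exists_append
  have hrun := hf.run_toWord hg
  have hcase : c <:+: g.toWord ∨ ∃ y c', c = y :: c' ∧ c' <:+: g.toWord := by
    have h2 : ((FreeGroup.of a)⁻¹ * g).toWord =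
        FreeGroup.reduce ((a, false) :: g.toWord) := by
      rw [← FreeGroup.toWord_mk]
      congr 1
      have : FreeGroup.mk ((a, false) :: g.toWord) =
          FreeGroup.mk [(a, false)] * FreeGroup.mk g.toWord := by
        rw [FreeGroup.mul_mk]; rfl
      rw [this, FreeGroup.mk_toWord]
      rfl
    rw [h2, FreeGroup.reduce.cons, FreeGroup.reduce_toWord] at hc
    rcases hw : g.toWord with _ | ⟨z, l⟩
    · rw [hw] at hc
      simp only at hc
      rcases List.infix_cons_iff.1 hc with h3 | h3
      · cases c with
        | nil => exact .inl List.nil_infix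
        | cons y c => exact .inr ⟨y, c, rfl, (List.cons_prefix_cons.1 h3).2.isInfix⟩
      · exact .inl h3
    · rw [hw] at hc
      simp only at hc
      split_ifs at hc
      · exact .inl (hc.trans (List.suffix_cons z l).isInfix)
      · rcases List.infix_cons_iff.1 hc with h3 | h3
        · cases c with
          | nil => exact .inl List.nil_infix
          | cons y c => exact .inr ⟨y, c, rfl, (List.cons_prefix_cons.1 h3).2.isInfix⟩
        · exact .inl h3
  rcases hcase with hc' | ⟨y, c', rfl, hc'⟩
  · exact hΓ.not_infix hS hs hd hx hrun hc'
  · obtain ⟨w, a', b, h2, h3⟩ := run_infix hrun hc'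
    have hs' : c' ++ (d ++ [y]) ∈ symmetrized r := by
      have := hS.rot [y] (c' ++ d) (by simpa using hs)
      simpa using this
    refine hΓ c' (d ++ [y]) w b hs' (by simp) ?_ (LGraph.run_mem_verts h2 hx) h3
    have hone := hS.one_lt _ hs
    simp only [List.length_append, List.length_cons, List.length_nil, Nat.cast_add, Nat.cast_one,
      zero_add] at hd hone ⊢
    linarith

theorem exists_carries_or_surjective {k : ℕ} (hkm : k ≤ m) (hk1 : 1 ≤ k)
    (ψ : FreeGroup (Fin k) →* PresGroup r) :
    (∃ Γ x f, Carries (PresentedGroup.mk (Set.range r)) k ψ Γ x f ∧ Γ.Folded ∧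
      ReadsNoPiece lam r Γ) ∨
    (k = m ∧ ∃ f : FreeGroup (Fin k) →* FreeGroup (Fin m), Function.Surjective f ∧
      ∃ g, ∀ z, PresentedGroup.mk (Set.range r) (f z) = g * ψ z * g⁻¹) := by
  obtain ⟨Γ, x, f, h⟩ := exists_carries (PresentedGroup.mk_surjective (Set.range r)) ψ
  obtain ⟨Γ', x', f', h1, h2, ⟨h3, h4⟩ | h3⟩ :=
    h.exists_surjective_or_not_run hm hn hadm hr hkm hk1
  · exact .inr ⟨h3, f', MonoidHom.range_eq_top.1 h4, h1.conj⟩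
  · exact .inl ⟨Γ', x', f', h1, h2, h3⟩

/-- A homomorphism to `G` from a free group of rank `m` has free image, or it lifts, up to
conjugation, to a surjective endomorphism. -/
theorem isFreeGroup_range_or {k : ℕ} (hkm : k ≤ m) (hk1 : 1 ≤ k)
    (ψ : FreeGroup (Fin k) →* PresGroup r) :
    IsFreeGroup ψ.range ∨
    (k = m ∧ ∃ f : FreeGroup (Fin k) →* FreeGroup (Fin m), Function.Surjective f ∧
      ∃ g, ∀ z, PresentedGroup.mk (Set.range r) (f z) = g * ψ z * g⁻¹) := by
  rcases exists_carries_or_surjective hm hn hadm hr hkm hk1 ψ with ⟨Γ, x, f, h1, h2, h3⟩ | h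
  · left
    obtain ⟨g, hg⟩ := h1.conj
    -- The fundamental group is a subgroup of a free group, and Greendlinger's lemma makes the
    -- quotient map injective on it; the conjugation turns its image into that of `ψ`.
    let θ : f.range →* PresGroup r := ((MulAut.conj g⁻¹).toMonoidHom.comp
      (PresentedGroup.mk (Set.range r))).comp f.range.subtype
    have hθ : Function.Injective θ := by
      rw [injective_iff_map_eq_one]
      rintro ⟨z, hz⟩ h
      have h4 : PresentedGroup.mk (Set.range r) z = 1 := by
        have h5 : g⁻¹ * PresentedGroup.mk (Set.range r) z * g = 1 := by simpa [θ] using h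
        rwa [mul_eq_one_iff_eq_inv, mul_eq_left] at h5
      rw [h1.range] at hz
      exact Subtype.ext (h3.injective hm hn hadm hr h2 h1.mem hz h4)
    have hrange : θ.range = ψ.range := by
      ext y
      constructor
      · rintro ⟨⟨_, z, rfl⟩, rfl⟩
        refine ⟨z, ?_⟩
        simp [θ, hg, mul_assoc]
      · rintro ⟨z, rfl⟩
        refine ⟨⟨_, z, rfl⟩, ?_⟩
        simp [θ, hg, mul_assoc]
    rw [← hrange]
    exact IsFreeGroup.ofMulEquiv (MonoidHom.ofInjective hθ)
  · exact .inr h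

/-- `G` is not generated by fewer than `m` elements. -/
theorem not_surjective_of_lt {k : ℕ} (hkm : k < m) (hk1 : 1 ≤ k)
    (ψ : FreeGroup (Fin k) →* PresGroup r) : ¬ Function.Surjective ψ := by
  intro hψ
  rcases exists_carries_or_surjective hm hn hadm hr hkm.le hk1 ψ with ⟨Γ, x, f, h1, h2, h3⟩ | h
  · obtain ⟨g, hg⟩ := h1.conj
    -- Surjectivity makes each conjugated generator an image; its lift equals the generator itself,
    -- which is therefore a loop at `x`. These m loops form a subgraph of rank m, too large for a
    -- graph of rank at most k < m.
    have hadj : ∀ a, Γ.Adj x (a, true) x := by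
      intro a
      obtain ⟨z, hz⟩ := hψ (g⁻¹ * PresentedGroup.mk (Set.range r) (FreeGroup.of a) * g)
      have h4 : Reach Γ.gens x (f z) x := by
        have : f z ∈ Loops Γ.gens x := by rw [← h1.range]; exact ⟨z, rfl⟩
        exact this
      have h5 := h3.eq_of_of_mk_eq hm hn hadm hr h2 h1.mem h4 (a := a) (by
        rw [hg, hz]; group)
      rw [h5] at h4
      have h6 := h2.run_toWord h4
      rw [FreeGroup.toWord_of] at h6
      exact run_singleton.1 h6
    let Δ : LGraph m ℕ :=
      { verts := {x}
        edges := Finset.univ.image fun a : Fin m => (x, a, x)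
        src_mem := by simp
        tgt_mem := by simp }
    have h4 : Δ.RankLE k := by
      refine h1.connected.rankLE_of_subgraph (by simpa [Δ] using h1.mem) ?_ ⟨x, by simp [Δ]⟩ h1.rank
      intro e he
      obtain ⟨a, -, rfl⟩ := Finset.mem_image.1 he
      exact LGraph.adj_true.1 (hadj a)
    have h5 : Δ.edges.card = m := by
      change (Finset.univ.image fun a : Fin m => (x, a, x)).card = m
      rw [Finset.card_image_of_injective _ (fun a b h => by simpa using h)]
      simp
    unfold LGraph.RankLE at h4
    rw [h5] at h4
    simp [Δ] at h4
    omega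
  · exact absurd h.1 hkm.ne

/-- If G were free, its rank would be at most m. Rank m is excluded by the Hopf property, since a
relator is nontrivial, and smaller rank because G needs m generators. -/
theorem not_isFreeGroup : ¬ IsFreeGroup (PresGroup r) := by
  intro hfree
  let π := PresentedGroup.mk (Set.range r)
  have hπ : Function.Surjective π := PresentedGroup.mk_surjective _
  let ι := IsFreeGroup.Generators (PresGroup r)
  let e : PresGroup r ≃* FreeGroup ι := IsFreeGroup.toFreeGroup _
  -- homomorphisms to the group of order two
  let Z := Multiplicative (ZMod 2)
  -- A homomorphism to the group of order two is determined on the m generators of G, which bounds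
  -- the rank by m and in particular makes the basis finite.
  have hinj : Function.Injective fun (χ : ι → Z) (a : Fin m) =>
      FreeGroup.lift χ (e (π (FreeGroup.of a))) := by
    intro χ χ' h
    have h1 : ((FreeGroup.lift χ).comp e.toMonoidHom).comp π =
        ((FreeGroup.lift χ').comp e.toMonoidHom).comp π := by
      ext a
      exact congrFun h a
    funext i
    obtain ⟨z, hz⟩ := hπ (e.symm (FreeGroup.of i))
    have h2 := DFunLike.congr_fun h1 z
    simpa [hz] using h2
  have hfin : Finite (ι → Z) := Finite.of_injective _ hinj
  have hι : Finite ι := by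
    classical
    refine Finite.of_injective (fun (i : ι) (j : ι) => if i = j then Multiplicative.ofAdd (1 : ZMod 2)
      else 1 : ι → ι → Z) ?_
    intro i j h
    by_contra hne
    have h2 := congrFun h i
    simp only [if_true, if_neg (Ne.symm hne)] at h2
    exact absurd h2 (by decide)
  have : Fintype ι := Fintype.ofFinite ι
  have hcard : Fintype.card ι ≤ m := by
    classical
    have h1 := Fintype.card_le_of_injective _ hinj
    rw [Fintype.card_fun, Fintype.card_fun, Fintype.card_fin] at h1
    have h2 : Fintype.card Z = 2 := ZMod.card 2
    rw [h2] at h1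
    exact (Nat.pow_le_pow_iff_right (by norm_num)).1 h1
  rcases hcard.eq_or_lt with hc | hc
  · let e' : FreeGroup ι ≃* FreeGroup (Fin m) :=
      FreeGroup.freeGroupCongr (Fintype.equivFinOfCardEq hc)
    have h1 : Function.Surjective ((e'.toMonoidHom.comp e.toMonoidHom).comp π) :=
      (e'.surjective.comp e.surjective).comp hπ
    have h2 := freeGroup_hopfian h1
    have h3 : r ⟨0, hn⟩ = 1 := by
      apply h2
      have : π (r ⟨0, hn⟩) = 1 := PresentedGroup.one_of_mem ⟨_, rfl⟩
      simp [this]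
    exact (hr.1 ⟨0, hn⟩).1 h3
  -- Pad the basis with trivial elements to exactly m - 1 generators.
  · let j : ι ↪ Fin (m - 1) := (Fintype.equivFin ι).toEmbedding.trans (Fin.castLEEmb (by omega))
    let ψ : FreeGroup (Fin (m - 1)) →* PresGroup r :=
      FreeGroup.lift (Function.extend j (fun i => e.symm (FreeGroup.of i)) 1)
    refine not_surjective_of_lt hm hn hadm hr (k := m - 1) (by omega) (by omega) ψ ?_
    have h1 : (ψ.comp (FreeGroup.map j)) = e.symm.toMonoidHom := by
      ext i
      simp [ψ, j.injective.extend_apply]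
    have h2 : Function.Surjective (ψ.comp (FreeGroup.map j)) := by
      rw [h1]; exact e.symm.surjective
    intro y
    obtain ⟨z, hz⟩ := h2 y
    exact ⟨_, hz⟩

theorem range_eq_top_or_isFreeGroup {H : Type*} [Group H] (hH : IsGeneratedBy m H)
    (φ : H →* PresGroup r) : φ.range = ⊤ ∨ IsFreeGroup φ.range := by
  obtain ⟨h, hh⟩ := hH
  have hsurj : (FreeGroup.lift h).range = ⊤ := by rw [FreeGroup.range_lift_eq_closure, hh]
  have hrange : (φ.comp (FreeGroup.lift h)).range = φ.range := by
    rw [MonoidHom.range_comp, hsurj, MonoidHom.range_eq_map]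
  rw [← hrange]
  rcases isFreeGroup_range_or hm hn hadm hr le_rfl (by omega) (φ.comp (FreeGroup.lift h)) with
    h1 | ⟨-, f, hf, g, hg⟩
  · exact .inr h1
  · left
    rw [eq_top_iff]
    rintro y -
    obtain ⟨z, hz⟩ := PresentedGroup.mk_surjective _ (g * y * g⁻¹)
    obtain ⟨t, rfl⟩ := hf z
    refine ⟨t, ?_⟩
    rw [hg] at hz
    simpa using hz

theorem isGeneratedBy_and_not_isFreeGroup_iff (K : Subgroup (PresGroup r)) :
    IsGeneratedBy m K ∧ ¬ IsFreeGroup K ↔ K = ⊤ := by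
  constructor
  · rintro ⟨h1, h2⟩
    rcases range_eq_top_or_isFreeGroup hm hn hadm hr h1 K.subtype with h3 | h3
    · rwa [Subgroup.range_subtype] at h3
    · rw [Subgroup.range_subtype] at h3
      exact absurd h3 h2
  · rintro rfl
    refine ⟨⟨fun a => ⟨PresentedGroup.of a, trivial⟩, ?_⟩, fun h =>
      not_isFreeGroup hm hn hadm hr (IsFreeGroup.ofMulEquiv Subgroup.topEquiv)⟩
    apply (Subgroup.map_injective (Subgroup.subtype_injective ⊤))
    rw [MonoidHom.map_closure, ← Set.range_comp]
    have h1 : Subgroup.closure (Set.range (PresentedGroup.of : Fin m → PresGroup r)) = ⊤ :=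
      PresentedGroup.closure_range_of _
    rw [← MonoidHom.range_eq_map, Subgroup.range_subtype]
    exact h1

/-- The image is all of G and not free, so the automorphism lifts up to conjugation to a surjective
endomorphism. This is bijective by the Hopf property, and the conjugating element lifts as well. -/
theorem isFreelyInduced (α : PresGroup r ≃* PresGroup r) : IsFreelyInduced r α := by
  let π := PresentedGroup.mk (Set.range r)
  have hπ : Function.Surjective π := PresentedGroup.mk_surjective _
  rcases isFreeGroup_range_or hm hn hadm hr le_rfl (by omega) (α.toMonoidHom.comp π) with
    h1 | ⟨-, f, hf, g, hg⟩
  · have h2 : (α.toMonoidHom.comp π).range = ⊤ :=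
      MonoidHom.range_eq_top.2 (α.surjective.comp hπ)
    rw [h2] at h1
    exact absurd (IsFreeGroup.ofMulEquiv Subgroup.topEquiv) (not_isFreeGroup hm hn hadm hr)
  · obtain ⟨t, rfl⟩ := hπ g
    refine ⟨(MulEquiv.ofBijective f ⟨freeGroup_hopfian hf, hf⟩).trans (MulAut.conj t⁻¹), ?_⟩
    intro x
    have h1 : π (f x) = π t * α (π x) * (π t)⁻¹ := hg x
    have h2 : π (t⁻¹ * f x * t⁻¹⁻¹) = α (π x) := by
      rw [map_mul, map_mul, h1]
      simp [mul_assoc]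
    exact h2.symm

/-- The image of an injective endomorphism is isomorphic to G, hence not free, and only the whole
group remains. -/
theorem isCoHopfian : IsCoHopfian (PresGroup r) := by
  intro φ hφ
  have hgen : IsGeneratedBy m (PresGroup r) := ⟨PresentedGroup.of, PresentedGroup.closure_range_of _⟩
  rcases range_eq_top_or_isFreeGroup hm hn hadm hr hgen φ with h | h
  · exact MonoidHom.range_eq_top.1 h
  · exact absurd (IsFreeGroup.ofMulEquiv (MonoidHom.ofInjective hφ).symm)
      (not_isFreeGroup hm hn hadm hr)

end Rigid

/-! ### Counting reduced words -/

section CountWords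

open FreeGroup (IsReduced invRev IsCyclicallyReduced)

variable {m : ℕ}

/-- The words of length `l` which may follow the letter `x` in a reduced word. -/
def continuations (m : ℕ) : ℕ → Letter m → Finset (List (Letter m))
  | 0, _ => {[]}
  | l + 1, x => (Finset.univ.erase (flipL x)).biUnion fun y => (continuations m l y).image (y :: ·)

theorem mem_continuations {l : ℕ} {x : Letter m} {w : List (Letter m)} :
    w ∈ continuations m l x ↔ IsReduced (x :: w) ∧ w.length = l := by
  induction l generalizing x w with
  | zero =>
    simp only [continuations, Finset.mem_singleton, List.length_eq_zero_iff]
    constructor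
    · rintro rfl
      exact ⟨FreeGroup.IsReduced.singleton, rfl⟩
    · exact And.right
  | succ l ih =>
    simp only [continuations, Finset.mem_biUnion, Finset.mem_erase, Finset.mem_univ, and_true,
      Finset.mem_image, ih]
    constructor
    · rintro ⟨y, hy, w, ⟨h1, h2⟩, rfl⟩
      exact ⟨isReduced_cons_cons'.2 ⟨hy, h1⟩, by simp [h2]⟩
    · rintro ⟨h1, h2⟩
      cases w with
      | nil => simp at h2
      | cons y w =>
        rw [isReduced_cons_cons'] at h1
        exact ⟨y, h1.1, w, ⟨h1.2, by simpa using h2⟩, rfl⟩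

theorem card_continuations (l : ℕ) (x : Letter m) :
    (continuations m l x).card = (2 * m - 1) ^ l := by
  induction l generalizing x with
  | zero => rfl
  | succ l ih =>
    rw [continuations, Finset.card_biUnion]
    · rw [Finset.sum_congr rfl fun y _ => by
        rw [Finset.card_image_of_injective _ List.cons_injective, ih], Finset.sum_const,
        Finset.card_erase_of_mem (Finset.mem_univ _), smul_eq_mul, pow_succ']
      simp [Fintype.card_prod, mul_comm]
    · intro y _ z _ hyz
      rw [Function.onFun, Finset.disjoint_left]
      intro w h1 h2
      obtain ⟨w1, -, rfl⟩ := Finset.mem_image.1 h1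
      obtain ⟨w2, -, h⟩ := Finset.mem_image.1 h2
      exact hyz (List.cons.inj h).1.symm

/-- The reduced words of length `l`. -/
def redWords (m : ℕ) : ℕ → Finset (List (Letter m))
  | 0 => {[]}
  | l + 1 => Finset.univ.biUnion fun y => (continuations m l y).image (y :: ·)

theorem mem_redWords {l : ℕ} {w : List (Letter m)} :
    w ∈ redWords m l ↔ IsReduced w ∧ w.length = l := by
  cases l with
  | zero =>
    simp only [redWords, Finset.mem_singleton, List.length_eq_zero_iff]
    constructor
    · rintro rfl
      exact ⟨FreeGroup.IsReduced.nil, rfl⟩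
    · exact And.right
  | succ l =>
    simp only [redWords, Finset.mem_biUnion, Finset.mem_univ, true_and, Finset.mem_image,
      mem_continuations]
    constructor
    · rintro ⟨y, w, ⟨h1, h2⟩, rfl⟩
      exact ⟨h1, by simp [h2]⟩
    · rintro ⟨h1, h2⟩
      cases w with
      | nil => simp at h2
      | cons y w => exact ⟨y, w, ⟨h1, by simpa using h2⟩, rfl⟩

theorem card_redWords_succ (l : ℕ) : (redWords m (l + 1)).card = 2 * m * (2 * m - 1) ^ l := by
  rw [redWords, Finset.card_biUnion]
  · rw [Finset.sum_congr rfl fun y _ => by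
      rw [Finset.card_image_of_injective _ List.cons_injective, card_continuations],
      Finset.sum_const, smul_eq_mul]
    simp [Fintype.card_prod, mul_comm]
  · intro y _ z _ hyz
    rw [Function.onFun, Finset.disjoint_left]
    intro w h1 h2
    obtain ⟨w1, -, rfl⟩ := Finset.mem_image.1 h1
    obtain ⟨w2, -, h⟩ := Finset.mem_image.1 h2
    exact hyz (List.cons.inj h).1.symm

theorem card_redWords_le (hm : 1 < m) (l : ℕ) : (redWords m l).card ≤ 2 * (2 * m - 1) ^ l := by
  cases l with
  | zero => simp [redWords]
  | succ l =>
    rw [card_redWords_succ, pow_succ']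
    calc 2 * m * (2 * m - 1) ^ l ≤ (2 * (2 * m - 1)) * (2 * m - 1) ^ l :=
          Nat.mul_le_mul_right _ (by omega)
      _ = _ := by ring

theorem card_redWords_le_of_le (hm : 1 < m) {l t : ℕ} (h : l ≤ t) :
    (redWords m l).card ≤ 2 * (2 * m - 1) ^ t :=
  (card_redWords_le hm l).trans (Nat.mul_le_mul_left _ (Nat.pow_le_pow_right (by omega) h))

theorem card_le_redWords_of_drop {T : Finset (List (Letter m))} {l k : ℕ}
    (hT : ∀ s ∈ T, IsReduced s ∧ s.length = l)
    (hinj : ∀ s ∈ T, ∀ s' ∈ T, s.drop k = s'.drop k → s = s') :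
    T.card ≤ (redWords m (l - k)).card := by
  refine Finset.card_le_card_of_injOn (List.drop k) ?_ ?_
  · intro s hs
    obtain ⟨h1, h2⟩ := hT s hs
    refine mem_redWords.2 ⟨?_, by simp [h2]⟩
    rw [← List.take_append_drop k s] at h1
    exact IsReduced.right h1
  · intro s hs s' hs' h
    exact hinj s hs s' hs' h

/-- Words with a prefix in `R`. -/
def prefixWords (t a : ℕ) (R : Finset (List (Letter m))) : Finset (List (Letter m)) :=
  (Finset.range (t + 1)).biUnion fun l =>
    (redWords m l).filter fun s => a ≤ l ∧ s.take a ∈ R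

theorem mem_prefixWords {t a : ℕ} {R : Finset (List (Letter m))} {s : List (Letter m)} :
    s ∈ prefixWords t a R ↔ IsReduced s ∧ s.length ≤ t ∧ a ≤ s.length ∧ s.take a ∈ R := by
  simp only [prefixWords, Finset.mem_biUnion, Finset.mem_range, Finset.mem_filter, mem_redWords]
  constructor
  · rintro ⟨l, hl, ⟨h1, rfl⟩, h2, h3⟩
    exact ⟨h1, by omega, h2, h3⟩
  · rintro ⟨h1, h2, h3, h4⟩
    exact ⟨_, by omega, ⟨h1, rfl⟩, h3, h4⟩

theorem card_prefixWords_le (hm : 1 < m) (t a : ℕ) (R : Finset (List (Letter m))) :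
    (prefixWords t a R).card ≤ (t + 1) * (R.card * (2 * (2 * m - 1) ^ (t - a))) := by
  refine Finset.card_biUnion_le.trans ?_
  have : ∀ l ∈ Finset.range (t + 1), ((redWords m l).filter fun s => a ≤ l ∧ s.take a ∈ R).card ≤
      R.card * (2 * (2 * m - 1) ^ (t - a)) := by
    intro l hl
    rw [Finset.mem_range] at hl
    rw [mul_comm]
    refine Finset.card_le_mul_card_image_of_maps_to (f := List.take a) (t := R) ?_ _ ?_
    · intro s hs
      exact (Finset.mem_filter.1 hs).2.2
    · intro u _
      refine (card_le_redWords_of_drop (l := l) (k := a) ?_ ?_).trans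
        (card_redWords_le_of_le hm (by omega))
      · intro s hs
        exact mem_redWords.1 (Finset.mem_filter.1 (Finset.mem_filter.1 hs).1).1
      · intro s hs s' hs' h
        rw [← List.take_append_drop a s, ← List.take_append_drop a s', h,
          (Finset.mem_filter.1 hs).2, (Finset.mem_filter.1 hs').2]
  refine (Finset.sum_le_sum this).trans ?_
  simp

/-- Words whose first `k` letters are determined by the rest. -/
theorem card_le_of_determined {T : Finset (List (Letter m))} {l k : ℕ} (φ : ℕ → ℕ)
    (σ : Letter m → Letter m) (hφ : ∀ i < k, i < φ i)
    (hT : ∀ s ∈ T, IsReduced s ∧ s.length = l)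
    (hdet : ∀ s ∈ T, ∀ i < k, s[i]? = (s[φ i]?).map σ) :
    T.card ≤ (redWords m (l - k)).card := by
  refine card_le_redWords_of_drop hT ?_
  intro s hs s' hs' h
  have hge : ∀ i, k ≤ i → s[i]? = s'[i]? := by
    intro i hi
    have h1 : ∀ s : List (Letter m), s[i]? = (s.drop k)[i - k]? := by
      intro s
      rw [List.getElem?_drop, Nat.add_sub_cancel' hi]
    rw [h1, h1 s', h]
  -- Each of the first `k` letters is read off from a later one, so they are recovered from right to
  -- left.
  have key : ∀ n i, k ≤ i + n → s[i]? = s'[i]? := by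
    intro n
    induction n with
    | zero => exact fun i hi => hge i hi
    | succ n ih =>
      intro i hi
      by_cases hik : k ≤ i
      · exact hge i hik
      · have := hφ i (by omega)
        rw [hdet s hs i (by omega), hdet s' hs' i (by omega), ih (φ i) (by omega)]
  exact List.ext_getElem? fun i => key k i (by omega)

/-- Words with a repetition, up to inversion. -/
def repeatWords (m t k : ℕ) : Finset (List (Letter m)) :=
  (Finset.range (t + 1)).biUnion fun l => (Finset.range (t + 1)).biUnion fun e =>
    ((redWords m l).filter fun s => k ≤ l ∧ 1 ≤ e ∧ ∀ i < k, s[i]? = s[e + i]?) ∪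
    ((redWords m l).filter fun s => k ≤ l ∧ 2 * k ≤ e ∧ ∀ i < k, s[i]? = (s[e - 1 - i]?).map flipL)

theorem card_repeatWords_le (hm : 1 < m) (t k : ℕ) :
    (repeatWords m t k).card ≤ (t + 1) * ((t + 1) * (4 * (2 * m - 1) ^ (t - k))) := by
  have hle : ∀ l < t + 1, ∀ T : Finset (List (Letter m)), T.card ≤ (redWords m (l - k)).card →
      T.card ≤ 2 * (2 * m - 1) ^ (t - k) := fun l hl T h =>
    h.trans (card_redWords_le_of_le hm (by omega))
  refine Finset.card_biUnion_le.trans ?_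
  refine (Finset.sum_le_card_nsmul _ _ ((t + 1) * (4 * (2 * m - 1) ^ (t - k))) ?_).trans
    (by simp)
  intro l hl
  refine Finset.card_biUnion_le.trans ?_
  refine (Finset.sum_le_card_nsmul _ _ (4 * (2 * m - 1) ^ (t - k)) ?_).trans (by simp)
  intro e he
  rw [Finset.mem_range] at hl he
  refine (Finset.card_union_le _ _).trans ?_
  have h1 : ((redWords m l).filter fun s => k ≤ l ∧ 1 ≤ e ∧ ∀ i < k, s[i]? = s[e + i]?).card ≤
      2 * (2 * m - 1) ^ (t - k) := by
    by_cases he1 : 1 ≤ e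
    · refine hle l hl _ (card_le_of_determined (fun i => e + i) id (fun i _ => by omega) ?_ ?_)
      · exact fun s hs => mem_redWords.1 (Finset.mem_filter.1 hs).1
      · intro s hs i hi
        rw [(Finset.mem_filter.1 hs).2.2.2 i hi]
        simp
    · rw [Finset.filter_false_of_mem (fun s _ h => he1 h.2.1)]
      simp
  have h2 : ((redWords m l).filter fun s => k ≤ l ∧ 2 * k ≤ e ∧
      ∀ i < k, s[i]? = (s[e - 1 - i]?).map flipL).card ≤ 2 * (2 * m - 1) ^ (t - k) := by
    by_cases he1 : 2 * k ≤ e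
    · refine hle l hl _ (card_le_of_determined (fun i => e - 1 - i) flipL
        (fun i _ => by omega) ?_ ?_)
      · exact fun s hs => mem_redWords.1 (Finset.mem_filter.1 hs).1
      · exact fun s hs => (Finset.mem_filter.1 hs).2.2.2
    · rw [Finset.filter_false_of_mem (fun s _ h => he1 h.2.1)]
      simp
  omega

theorem mem_repeatWords_of_shift {t k e : ℕ} {s : List (Letter m)} (hs : IsReduced s)
    (ht : s.length ≤ t) (he : 1 ≤ e) (hk : e + k ≤ s.length)
    (h : ∀ i < k, s[i]? = s[e + i]?) : s ∈ repeatWords m t k := by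
  simp only [repeatWords, Finset.mem_biUnion, Finset.mem_range, Finset.mem_union,
    Finset.mem_filter, mem_redWords]
  exact ⟨s.length, by omega, e, by omega, .inl ⟨⟨hs, rfl⟩, by omega, he, h⟩⟩

theorem mem_repeatWords_of_flip {t k e : ℕ} {s : List (Letter m)} (hs : IsReduced s)
    (ht : s.length ≤ t) (he : 2 * k ≤ e) (hk : e ≤ s.length)
    (h : ∀ i < k, s[i]? = (s[e - 1 - i]?).map flipL) : s ∈ repeatWords m t k := by
  simp only [repeatWords, Finset.mem_biUnion, Finset.mem_range, Finset.mem_union,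
    Finset.mem_filter, mem_redWords]
  exact ⟨s.length, by omega, e, by omega, .inr ⟨⟨hs, rfl⟩, by omega, he, h⟩⟩

/-- Two rotations with a common prefix. -/
theorem mem_repeatWords_of_rotation {t k : ℕ} {a b : List (Letter m)} (ha : a ≠ []) (hb : b ≠ [])
    (hs : IsReduced (a ++ b)) (hs' : IsReduced (b ++ a)) (ht : (a ++ b).length ≤ t)
    (hk : 2 * k ≤ (a ++ b).length)
    {u : List (Letter m)} (hu : u <+: a ++ b) (hu' : u <+: b ++ a) (huk : k ≤ u.length) :
    a ++ b ∈ repeatWords m t k ∨ b ++ a ∈ repeatWords m t k := by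
  have ha' := List.length_pos_of_ne_nil ha
  have hb' := List.length_pos_of_ne_nil hb
  simp only [List.length_append] at ht hk
  -- Shifting by the shorter part keeps the repeated segment inside the word, since it is at most
  -- half of the length.
  have key : ∀ a b : List (Letter m), 0 < a.length → a.length ≤ b.length → IsReduced (a ++ b) →
      a.length + b.length ≤ t → 2 * k ≤ a.length + b.length → u <+: a ++ b → u <+: b ++ a →
      a ++ b ∈ repeatWords m t k := by
    intro a b ha hab hs ht hk hu hu'
    refine mem_repeatWords_of_shift (e := a.length) hs (by simpa using ht) ha
      (by simp; omega) ?_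
    intro i hi
    have h1 : (a ++ b)[i]? = u[i]? := by
      obtain ⟨v, hv⟩ := hu
      rw [← hv, List.getElem?_append_left (by omega)]
    have h2 : (b ++ a)[i]? = u[i]? := by
      obtain ⟨v, hv⟩ := hu'
      rw [← hv, List.getElem?_append_left (by omega)]
    rw [List.getElem?_append_left (by omega)] at h2
    rw [h1, ← h2, List.getElem?_append_right (by omega)]
    congr 1
    omega
  rcases le_total a.length b.length with h | h
  · exact .inl (key a b ha' h hs ht hk hu hu')
  · exact .inr (key b a hb' h hs' (by omega) (by omega) hu' hu)

end CountWords

/-! ### Counting tuples -/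

section CountTuples

open FreeGroup (IsReduced invRev IsCyclicallyReduced)

variable {m n : ℕ}

theorem getElem?_invRev {α : Type*} (u : List (α × Bool)) {i : ℕ} (hi : i < u.length) :
    (invRev u)[u.length - 1 - i]? = (u[i]?).map flipL := by
  unfold invRev
  rw [List.getElem?_reverse (by simp; omega), List.getElem?_map]
  have : (u.map fun x => (x.1, !x.2)).length - 1 - (u.length - 1 - i) = i := by simp; omega
  rw [this]
  rfl

/-- Rotations of a word and of its inverse with a common prefix. -/
theorem exists_mem_repeatWords_of_invRev {t k : ℕ} {w s s' u : List (Letter m)}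
    (hw : IsCyclicallyReduced w) (ht : w.length ≤ t) (hk : 4 * k ≤ w.length) (hs : s ~r w)
    (hs' : s' ~r invRev w) (hu : u <+: s) (hu' : u <+: s') (huk : 2 * k ≤ u.length) :
    ∃ s'' ∈ repeatWords m t k, s'' ~r w := by
  wlog huk' : u.length = 2 * k generalizing u
  · exact this ((List.take_prefix (2 * k) u).trans hu) ((List.take_prefix (2 * k) u).trans hu')
      (by simp [huk]) (by simp [huk])
  have hls : s.length = w.length := hs.perm.length_eq
  have h1 : s ~r invRev s' := by
    have h2 := isRotated_invRev hs'
    rw [FreeGroup.invRev_invRev] at h2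
    exact hs.trans h2.symm
  obtain ⟨a, b, rfl, hab⟩ := exists_append_of_isRotated h1
  obtain ⟨v', rfl⟩ := hu'
  rw [FreeGroup.invRev_append] at hab
  have hlen := congrArg List.length hab
  simp only [List.length_append, FreeGroup.invRev_length] at hlen hls
  have hsi : ∀ i < 2 * k, (a ++ b)[i]? = u[i]? := by
    intro i hi
    obtain ⟨v, hv⟩ := hu
    rw [← hv, List.getElem?_append_left (by omega)]
  have hba : ∀ i < 2 * k, (b ++ a)[w.length - 1 - i]? = (u[i]?).map flipL := by
    intro i hi
    rw [← getElem?_invRev u (by omega), ← hab,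
      List.getElem?_append_right (by simp only [FreeGroup.invRev_length]; omega)]
    congr 1
    simp only [FreeGroup.invRev_length]
    omega
  -- The word begins with `u`, and the inverse of `u` ends with `a`. If `a` is long enough, the two
  -- occurrences of the first `k` letters do not overlap.
  by_cases ha : 2 * k ≤ a.length
  · refine ⟨a ++ b, mem_repeatWords_of_flip (e := a.length)
      (IsCyclicallyReduced.of_isRotated hw hs.symm).1 (by simp; omega) ha (by simp) ?_, hs⟩
    intro i hi
    rw [hsi i (by omega), List.getElem?_append_left (by omega)]
    have h2 := hba i (by omega)
    rw [List.getElem?_append_right (by omega), show w.length - 1 - i - b.length = a.length - 1 - i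
      by omega] at h2
    rw [h2, Option.map_map]
    simp [Function.comp_def]
  -- Otherwise the inverse copy wraps around the start. Rotating by `k` and comparing only the
  -- second half of `u` separates the two occurrences, which is why 2k common letters yield a
  -- repetition of length k.
  · have hrot : (a ++ b).rotate k ~r w := (List.isRotated_iff_mod.2 ⟨_, by
      simp; omega, rfl⟩ : (a ++ b) ~r (a ++ b).rotate k).symm.trans hs
    refine ⟨(a ++ b).rotate k, mem_repeatWords_of_flip (e := w.length + a.length - 2 * k)
      (IsCyclicallyReduced.of_isRotated hw hrot.symm).1 (by simp; omega) (by omega)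
      (by simp; omega) ?_, hrot⟩
    intro i hi
    rw [List.getElem?_rotate (by simp; omega), List.getElem?_rotate (by simp; omega)]
    have h2 := hba (i + k) (by omega)
    rw [← List.rotate_append_length_eq, List.getElem?_rotate (by simp; omega)] at h2
    rw [Nat.mod_eq_of_lt (by simp; omega), hsi _ (by omega)]
    rw [show w.length - 1 - (i + k) + a.length = w.length + a.length - 2 * k - 1 - i + k by omega]
      at h2
    rw [h2, Option.map_map]
    simp [Function.comp_def]

theorem exists_repeat_of_isProperPower {g : FreeGroup (Fin m)} (hg : g ≠ 1)
    (hc : IsCyclicallyReduced g.toWord) (hp : IsProperPower g) :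
    ∃ a b : List (Letter m), a ≠ [] ∧ b ≠ [] ∧ g.toWord = a ++ b ∧ a ++ b = b ++ a := by
  obtain ⟨h, k, hk, rfl⟩ := hp
  obtain ⟨k, rfl⟩ : ∃ l, k = l + 1 + 1 := ⟨k - 2, by omega⟩
  have hw : (h ^ (k + 1 + 1)).toWord =
      FreeGroup.reduce (List.replicate (k + 1 + 1) h.toWord).flatten := by
    rw [← FreeGroup.toWord_mk]
    congr 1
    generalize k + 1 + 1 = j
    induction j with
    | zero => rfl
    | succ j ih => rw [pow_succ', ih, List.replicate_succ, List.flatten_cons, ← FreeGroup.mul_mk,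
        FreeGroup.mk_toWord]
  rw [FreeGroup.reduceCyclically.reduce_flatten_replicate_succ FreeGroup.isReduced_toWord] at hw
  set c := FreeGroup.reduceCyclically.conjugator h.toWord with hcdef
  set d := FreeGroup.reduceCyclically h.toWord with hd
  -- The reduced form of a power begins with the conjugator and ends with its inverse, which cyclic
  -- reducedness forbids unless it is empty.
  have hc0 : c = [] := by
    rcases hcc : c with _ | ⟨x, c'⟩
    · rfl
    · exfalso
      rw [hw, hcc, invRev_cons', ← List.append_assoc, List.append_assoc, List.cons_append] at hc
      have h1 := hc.2 (flipL x) (by rw [← List.append_assoc, List.getLast?_concat]; rfl) x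
        (by simp) rfl
      exact flipL_ne x (Prod.ext rfl h1)
  rw [hc0] at hw
  simp only [List.nil_append, FreeGroup.invRev_empty, List.append_nil] at hw
  have hd0 : d ≠ [] := by
    intro h0
    rw [h0] at hw
    simp at hw
    exact hg (by rw [hw]; simp)
  refine ⟨d, (List.replicate (k + 1) d).flatten, hd0, ?_, ?_, ?_⟩
  · rw [List.replicate_succ, List.flatten_cons]
    simp [hd0]
  · rw [hw, List.replicate_succ, List.flatten_cons]
  · rw [← List.flatten_cons, ← List.replicate_succ]
    conv_lhs => rw [List.replicate_succ']
    simp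

/-- The ball of radius `t` in the free group. -/
def ball (m t : ℕ) : Finset (FreeGroup (Fin m)) :=
  ((Finset.range (t + 1)).biUnion (redWords m)).image FreeGroup.mk

theorem mem_ball {t : ℕ} {g : FreeGroup (Fin m)} : g ∈ ball m t ↔ g.norm ≤ t := by
  simp only [ball, Finset.mem_image, Finset.mem_biUnion, Finset.mem_range, mem_redWords]
  constructor
  · rintro ⟨w, ⟨l, hl, -, rfl⟩, rfl⟩
    exact FreeGroup.norm_mk_le.trans (by omega)
  · intro h
    exact ⟨g.toWord, ⟨g.toWord.length, Nat.lt_succ_of_le h, FreeGroup.isReduced_toWord, rfl⟩,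
      FreeGroup.mk_toWord⟩

theorem card_ball_le (hm : 1 < m) (t : ℕ) : (ball m t).card ≤ (t + 1) * (2 * (2 * m - 1) ^ t) := by
  refine Finset.card_image_le.trans (Finset.card_biUnion_le.trans ?_)
  refine (Finset.sum_le_card_nsmul _ _ (2 * (2 * m - 1) ^ t) fun l hl => ?_).trans (by simp)
  exact card_redWords_le_of_le hm (by rw [Finset.mem_range] at hl; omega)

open Classical in
/-- The nontrivial cyclically reduced words of length at most `t`. -/
def cyclicBall (m t : ℕ) : Finset (FreeGroup (Fin m)) :=
  (ball m t).filter fun g => g ≠ 1 ∧ IsCyclicallyReduced g.toWord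

theorem mem_cyclicBall {t : ℕ} {g : FreeGroup (Fin m)} :
    g ∈ cyclicBall m t ↔ g.norm ≤ t ∧ g ≠ 1 ∧ IsCyclicallyReduced g.toWord := by
  simp [cyclicBall, mem_ball]

theorem le_card_cyclicBall (hm : 1 < m) {t : ℕ} (ht : 2 ≤ t) :
    (2 * m - 1) ^ (t - 1) ≤ (cyclicBall m t).card := by
  obtain ⟨l, rfl⟩ : ∃ l, t = l + 2 := ⟨t - 2, by omega⟩
  have hlt : (2 * m - 1) ^ (l + 2 - 1) ≤ (redWords m (l + 1)).card := by
    rw [card_redWords_succ, show l + 2 - 1 = l + 1 by omega, pow_succ']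
    exact Nat.mul_le_mul_right _ (by omega)
  refine hlt.trans ?_
  -- One letter put in front makes a reduced word cyclically reduced: as 2m > 2, it can avoid
  -- cancelling with the first and the last letter.
  have hy : ∀ x z : Letter m, ∃ y, y ≠ flipL x ∧ y ≠ flipL z := by
    intro x z
    have h1 : ({flipL x, flipL z} : Finset (Letter m)).card < (Finset.univ : Finset (Letter m)).card := by
      refine (Finset.card_le_two).trans_lt ?_
      simp [Fintype.card_prod]
      omega
    obtain ⟨y, -, hy⟩ := Finset.exists_mem_notMem_of_card_lt_card h1
    simp only [Finset.mem_insert, Finset.mem_singleton, not_or] at hy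
    exact ⟨y, hy⟩
  choose y hy1 hy2 using hy
  refine Finset.card_le_card_of_injOn (fun w => FreeGroup.mk
    (y (w.headD (⟨0, by omega⟩, true)) (w.getLastD (⟨0, by omega⟩, true)) :: w)) ?_ ?_
  · intro w hw
    obtain ⟨h1, h2⟩ := mem_redWords.1 hw
    rcases w with _ | ⟨x, w⟩
    · simp at h2
    have hlast : (x :: w).getLastD (⟨0, by omega⟩, true) = (x :: w).getLast (by simp) := by
      rw [List.getLastD_eq_getLast?, List.getLast?_eq_some_getLast (by simp)]
      rfl
    simp only [List.headD_cons, hlast]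
    set z := (x :: w).getLast (by simp) with hz
    have h3 : IsReduced (y x z :: x :: w) := isReduced_cons_cons'.2
      ⟨fun h => hy1 x z ((congrArg flipL h).trans (flipL_flipL _)).symm, h1⟩
    rw [Finset.mem_coe, mem_cyclicBall]
    have h4 : (FreeGroup.mk (y x z :: x :: w)).toWord = y x z :: x :: w := by
      rw [FreeGroup.toWord_mk, h3.reduce_eq]
    refine ⟨?_, ?_, ?_⟩
    · refine FreeGroup.norm_mk_le.trans ?_
      simp at h2 ⊢
      omega
    · intro h
      rw [h] at h4
      simp at h4
    · rw [h4]
      refine ⟨h3, ?_⟩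
      intro p hp q hq hpq
      rw [List.getLast?_cons_cons, List.getLast?_eq_some_getLast (by simp), Option.mem_some_iff,
        ← hz] at hp
      simp only [List.head?_cons, Option.mem_some_iff] at hq
      subst hp hq
      by_contra hne
      exact hy2 x z (eq_flipL_iff.2 ⟨hpq.symm ▸ rfl, fun h => hne h⟩)
  · intro w hw w' hw' h
    have hred : ∀ w ∈ redWords m (l + 1), (FreeGroup.mk
        (y (w.headD (⟨0, by omega⟩, true)) (w.getLastD (⟨0, by omega⟩, true)) :: w)).toWord.tail =
          w := by
      intro w hw
      obtain ⟨h1, h2⟩ := mem_redWords.1 hw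
      rcases w with _ | ⟨x, w⟩
      · simp at h2
      rw [FreeGroup.toWord_mk, IsReduced.reduce_eq]
      · rfl
      · exact isReduced_cons_cons'.2
          ⟨fun h => hy1 x _ ((congrArg flipL h).trans (flipL_flipL _)).symm, h1⟩
    rw [← hred w hw, ← hred w' hw']
    simp only at h
    rw [h]

open Classical in
/-- The words some rotation of which, up to inversion, belongs to `T`. -/
def rotationCover (t : ℕ) (T : Finset (List (Letter m))) : Finset (FreeGroup (Fin m)) :=
  (cyclicBall m t).filter fun g => ∃ s ∈ T, s ~r g.toWord ∨ s ~r (g⁻¹).toWord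

theorem card_rotationCover_le (t : ℕ) (T : Finset (List (Letter m))) :
    (rotationCover t T).card ≤ 2 * (t + 1) * T.card := by
  have h : rotationCover t T ⊆
      ((T ×ˢ Finset.range (t + 1)).image fun p => FreeGroup.mk (p.1.rotate p.2)) ∪
      ((T ×ˢ Finset.range (t + 1)).image fun p => (FreeGroup.mk (p.1.rotate p.2))⁻¹) := by
    intro g hg
    obtain ⟨hg, s, hs, h⟩ := Finset.mem_filter.1 hg
    have hn := (mem_cyclicBall.1 hg).1
    have key : ∀ h : FreeGroup (Fin m), h.norm ≤ t → s ~r h.toWord →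
        ∃ p ∈ T ×ˢ Finset.range (t + 1), FreeGroup.mk (p.1.rotate p.2) = h := by
      intro h hh hsh
      obtain ⟨p, hp, hrot⟩ := List.isRotated_iff_mod.1 hsh
      have : s.length ≤ t := by rw [hsh.perm.length_eq]; exact hh
      refine ⟨(s, p), Finset.mem_product.2 ⟨hs, Finset.mem_range.2 (by omega)⟩, ?_⟩
      rw [hrot, FreeGroup.mk_toWord]
    rw [Finset.mem_union, Finset.mem_image, Finset.mem_image]
    rcases h with h | h
    · exact .inl (key g hn h)
    · obtain ⟨p, hp, hpg⟩ := key g⁻¹ (by rwa [FreeGroup.norm_inv_eq]) h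
      exact .inr ⟨p, hp, by rw [hpg, inv_inv]⟩
  refine (Finset.card_le_card h).trans ((Finset.card_union_le _ _).trans ?_)
  refine (Nat.add_le_add Finset.card_image_le Finset.card_image_le).trans ?_
  rw [Finset.card_product, Finset.card_range]
  exact le_of_eq (by ring)

/-- Tuples which are bad because of one coordinate. -/
theorem card_tuples_le {β : Type*} [DecidableEq β] [Inhabited β] (A : Finset β) (Z : Finset (Fin n → β)) (j : Fin n)
    (y : ℕ) (hZ : Z ⊆ Fintype.piFinset fun _ => A)
    (h : ∀ r : Fin n → β, (A.filter fun g => Function.update r j g ∈ Z).card ≤ y) :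
    Z.card ≤ A.card ^ (n - 1) * y := by
  have h1 : (Z.image fun r => Function.update r j default).card ≤ A.card ^ (n - 1) := by
    have hsub : (Z.image fun r => Function.update r j default) ⊆
        Fintype.piFinset (Function.update (fun _ => A) j {default}) := by
      intro r hr
      obtain ⟨r₀, hr₀, rfl⟩ := Finset.mem_image.1 hr
      rw [Fintype.mem_piFinset]
      intro i
      by_cases hij : i = j
      · subst hij; simp
      · simp only [Function.update_of_ne hij]
        exact Fintype.mem_piFinset.1 (hZ hr₀) i
    refine (Finset.card_le_card hsub).trans ?_
    rw [Fintype.card_piFinset, ← Finset.mul_prod_erase _ _ (Finset.mem_univ j)]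
    rw [Finset.prod_congr rfl (g := fun _ => A.card) fun i hi => by
      rw [Function.update_of_ne (Finset.ne_of_mem_erase hi)]]
    simp
  refine (Finset.card_le_mul_card_image (f := fun r => Function.update r j default) Z y ?_).trans ?_
  · intro r' _
    refine le_trans ?_ (h r')
    refine Finset.card_le_card_of_injOn (fun r => r j) ?_ ?_
    · intro r hr
      obtain ⟨h2, h3⟩ := Finset.mem_filter.1 hr
      rw [Finset.mem_coe, Finset.mem_filter]
      refine ⟨Fintype.mem_piFinset.1 (hZ h2) j, ?_⟩
      rw [← h3]
      simpa using h2
    · intro r hr s hs hrs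
      have h3 := (Finset.mem_filter.1 hr).2
      have h4 := (Finset.mem_filter.1 hs).2
      funext i
      by_cases hij : i = j
      · rw [hij]; exact hrs
      · have := congrFun (h3.trans h4.symm) i
        simpa [Function.update_of_ne hij] using this
  · rw [mul_comm]
    exact Nat.mul_le_mul_right _ h1

end CountTuples

/-! ### Tuples outside of the class -/

section Bad

open FreeGroup (IsReduced invRev IsCyclicallyReduced)

variable {m n : ℕ}

/-- The prefixes of length `k` of the rotations of a word and its inverse. -/
def rotationPrefixes (t k : ℕ) (g : FreeGroup (Fin m)) : Finset (List (Letter m)) :=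
  ((Finset.range (t + 1)).image fun p => (g.toWord.rotate p).take k) ∪
    ((Finset.range (t + 1)).image fun p => ((g⁻¹).toWord.rotate p).take k)

theorem card_rotationPrefixes_le (t k : ℕ) (g : FreeGroup (Fin m)) :
    (rotationPrefixes t k g).card ≤ 2 * (t + 1) := by
  refine (Finset.card_union_le _ _).trans ?_
  refine (Nat.add_le_add Finset.card_image_le Finset.card_image_le).trans ?_
  rw [Finset.card_range]
  omega

theorem take_mem_rotationPrefixes {t k : ℕ} {g : FreeGroup (Fin m)} (hg : g.norm ≤ t)
    {s : List (Letter m)} (hs : s ~r g.toWord ∨ s ~r (g⁻¹).toWord) :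
    s.take k ∈ rotationPrefixes t k g := by
  have key : ∀ h : FreeGroup (Fin m), h.norm ≤ t → s ~r h.toWord →
      s.take k ∈ (Finset.range (t + 1)).image fun p => (h.toWord.rotate p).take k := by
    intro h hh hsh
    obtain ⟨p, hp, rfl⟩ := List.isRotated_iff_mod.1 hsh.symm
    refine Finset.mem_image.2 ⟨p, Finset.mem_range.2 ?_, rfl⟩
    have : h.toWord.length ≤ t := hh
    omega
  rcases hs with h | h
  · exact Finset.mem_union_left _ (key g hg h)
  · exact Finset.mem_union_right _ (key _ (by rwa [FreeGroup.norm_inv_eq]) h)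

/-- Once all relators are longer than t/2, every violation shows up at a fixed scale: a piece that
is too long has 2k letters, and half of a relator has at least a letters. So four families of
exceptional words account for everything. -/
theorem mem_genericClass_of {L t k a : ℕ} {lam μ : ℝ} (hlam : lam ≤ 1 / 33)
    (hk : 4 * (k : ℝ) ≤ lam * t) (ha : 4 * a ≤ t) (hmt : 2 * m ≤ t) {R : Finset (List (Letter m))}
    (hR : ∀ w : List (Letter m), IsReduced w → a ≤ w.length → w.length ≤ t →
      IsReadableL μ L w ∨ IsReadable μ w → w.take a ∈ R)
    {r : Relators m n} (hr : ∀ i, r i ∈ cyclicBall m t) (h1 : ∀ i, t < 2 * (r i).norm)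
    (h2 : ∀ i, r i ∉ rotationCover t (repeatWords m t k))
    (h3 : ∀ i j, i ≠ j → r j ∉ rotationCover t (prefixWords t k (rotationPrefixes t k (r i))))
    (h4 : ∀ i, r i ∉ rotationCover t (prefixWords t a R)) :
    r ∈ genericClass m n lam μ L := by
  have hcyc : IsCyclicallyReducedTuple r := fun i => (mem_cyclicBall.1 (hr i)).2
  have hnorm : ∀ i, (r i).norm ≤ t := fun i => (mem_cyclicBall.1 (hr i)).1
  have hkt : 4 * k ≤ t := by
    have h5 : 4 * (k : ℝ) ≤ t := by
      have : (0 : ℝ) ≤ t := Nat.cast_nonneg _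
      nlinarith
    exact_mod_cast h5
  have hk4 : ∀ i, 4 * k ≤ (r i).norm := by
    intro i
    have h5 : ((4 * k : ℕ) : ℝ) ≤ (r i).norm := by
      have h6 : (t : ℝ) < 2 * (r i).norm := by exact_mod_cast h1 i
      have : (0 : ℝ) ≤ t := Nat.cast_nonneg _
      push_cast
      nlinarith
    exact_mod_cast h5
  have hcover : ∀ {i T s}, r i ∉ rotationCover t T →
      s ∈ T → ¬ (s ~r (r i).toWord ∨ s ~r ((r i)⁻¹).toWord) := by
    intro i T s hi hs h
    exact hi (Finset.mem_filter.2 ⟨hr i, s, hs, h⟩)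
  have hcycw : ∀ i s, s ~r (r i).toWord ∨ s ~r ((r i)⁻¹).toWord → IsCyclicallyReduced s :=
    fun i s hs => isCyclicallyReduced_of_mem_symmetrized hcyc ⟨i, hs⟩
  -- Coincidences between rotations of one relator. Used both for pieces and, with the whole word as
  -- common prefix, to exclude proper powers.
  have hrep : ∀ i (a b : List (Letter m)), a ≠ [] → b ≠ [] →
      (a ++ b ~r (r i).toWord ∨ a ++ b ~r ((r i)⁻¹).toWord) →
      ∀ u, u <+: a ++ b → u <+: b ++ a → u.length < k := by
    intro i a b ha hb hab u hu hu'
    by_contra! hlen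
    have h5 := hcycw i _ hab
    have hl := length_of_mem_symmetrized hab
    have hrot : b ++ a ~r a ++ b := List.isRotated_append
    rcases mem_repeatWords_of_rotation ha hb h5.1
      (IsCyclicallyReduced.rotate_append h5).1 (hl.le.trans (hnorm i))
      (by have := hk4 i; omega) hu hu' hlen with h6 | h6
    · exact hcover (h2 i) h6 hab
    · exact hcover (h2 i) h6 (hab.imp hrot.trans hrot.trans)
  refine ⟨hcyc, ⟨?_, ?_, ?_⟩, ?_⟩
  · intro s hs s' hs' hne u hu hu'
    by_contra! hlen
    obtain ⟨i, hi⟩ := hs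
    obtain ⟨j, hj⟩ := hs'
    have hsl := length_of_mem_symmetrized hi
    have huk : 2 * k ≤ u.length := by
      have h5 : ((2 * k : ℕ) : ℝ) ≤ u.length := by
        have h6 : (t : ℝ) < 2 * s.length := by rw [hsl]; exact_mod_cast h1 i
        push_cast
        by_cases hl0 : 0 ≤ lam
        · nlinarith
        · have : (0 : ℝ) ≤ t := Nat.cast_nonneg _
          have : (0 : ℝ) ≤ k := Nat.cast_nonneg _
          nlinarith
      exact_mod_cast h5
    by_cases hij : i = j
    · subst hij
      have hrot : s ~r s' → False := by
        intro hss
        obtain ⟨a, b, rfl, rfl⟩ := exists_append_of_isRotated hss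
        have := hrep i a b (by rintro rfl; simp at hne) (by rintro rfl; simp at hne) hi u hu hu'
        omega
      have hinv : ∀ (w s s' : List (Letter m)), w = (r i).toWord → s ~r w → s' ~r invRev w →
          u <+: s → u <+: s' → False := by
        intro w s s' hw hs hs' hu hu'
        obtain ⟨s'', h5, h6⟩ := exists_mem_repeatWords_of_invRev (t := t) (k := k)
          (by rw [hw]; exact (hcyc i).2) (by rw [hw]; exact hnorm i)
          (by rw [hw]; exact hk4 i) hs hs' hu hu' huk
        rw [hw] at h6
        exact hcover (h2 i) h5 (.inl h6)
      rw [FreeGroup.toWord_inv] at hi hj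
      rcases hi with hi | hi <;> rcases hj with hj | hj
      · exact hrot (hi.trans hj.symm)
      · exact hinv _ s s' rfl hi hj hu hu'
      · exact hinv _ s' s rfl hj hi hu' hu
      · exact hrot (hi.trans hj.symm)
    · have hc := hcycw j s' hj
      have hul := hu.length_le
      have hul' := hu'.length_le
      refine hcover (h3 i j hij) (s := s') (mem_prefixWords.2 ⟨hc.1, ?_, by omega, ?_⟩) hj
      · rw [length_of_mem_symmetrized hj]; exact hnorm j
      · have h5 : s'.take k = s.take k := by
          have key : ∀ z, u <+: z → z.take k = u.take k := by
            rintro _ ⟨v, rfl⟩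
            exact List.take_append_of_le_length (by omega)
          rw [key s' hu', key s hu]
        rw [h5]
        exact take_mem_rotationPrefixes (hnorm i) hi
  · intro i hp
    obtain ⟨a, b, ha, hb, h5, h6⟩ := exists_repeat_of_isProperPower (hcyc i).1 (hcyc i).2 hp
    have := hrep i a b ha hb (.inl (h5 ▸ .refl _)) (a ++ b) (List.prefix_refl _)
      (by rw [h6])
    rw [← h5] at this
    have h7 := hk4 i
    have h8 : (r i).toWord.length = (r i).norm := rfl
    omega
  · intro i s hs w hw hlen
    rw [← not_or]
    intro hread
    obtain ⟨x, y, rfl⟩ := hw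
    have hl : (x ++ w ++ y).length = (r i).norm := length_of_mem_symmetrized (.inl hs)
    have hrot : w ++ (y ++ x) ~r x ++ w ++ y := by
      rw [List.append_assoc x, ← List.append_assoc w]
      exact List.isRotated_append
    have hc := hcycw i _ (.inl (hrot.trans hs))
    have hlw : a ≤ w.length := by
      have h5 : (a : ℝ) ≤ w.length := by
        have h6 : (t : ℝ) < 2 * (r i).norm := by exact_mod_cast h1 i
        have h7 : 4 * (a : ℝ) ≤ t := by exact_mod_cast ha
        linarith
      exact_mod_cast h5
    have hnt := hnorm i
    rw [← hl] at hnt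
    simp only [List.length_append] at hnt
    refine hcover (h4 i) (s := w ++ (y ++ x)) (mem_prefixWords.2 ⟨hc.1, ?_, ?_, ?_⟩)
      (.inl (hrot.trans hs))
    · simp only [List.length_append]; omega
    · simp only [List.length_append]; omega
    · rw [List.take_append_of_le_length hlw]
      exact hR w (IsReduced.left hc.1) hlw (by omega) hread
  · intro i
    have := h1 i
    omega

open Classical in
/-- The number of tuples outside of the class. -/
theorem card_bad_le (hm : 1 < m) {L t k a : ℕ} {lam μ : ℝ} (hlam : lam ≤ 1 / 33)
    (hk : 4 * (k : ℝ) ≤ lam * t) (ha : 4 * a ≤ t) (hmt : 2 * m ≤ t) {R : Finset (List (Letter m))}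
    (hR : ∀ w : List (Letter m), IsReduced w → a ≤ w.length → w.length ≤ t →
      IsReadableL μ L w ∨ IsReadable μ w → w.take a ∈ R) :
    ((Fintype.piFinset fun _ : Fin n => cyclicBall m t).filter
      fun r => r ∉ genericClass m n lam μ L).card ≤
    (cyclicBall m t).card ^ (n - 1) * (n * ((ball m (t / 2)).card +
      2 * (t + 1) * ((t + 1) * ((t + 1) * (4 * (2 * m - 1) ^ (t - k)))) +
      2 * (t + 1) * ((t + 1) * (R.card * (2 * (2 * m - 1) ^ (t - a))))) +
      n * n * (2 * (t + 1) * ((t + 1) * (2 * (t + 1) * (2 * (2 * m - 1) ^ (t - k)))))) := by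
  set A := cyclicBall m t with hA
  set Q := Fintype.piFinset fun _ : Fin n => A with hQ
  -- A failure caused by a single relator: too short, with a long repetition, or readable. Failures
  -- caused by two relators are collected in `Y`.
  let W : Finset (FreeGroup (Fin m)) := ball m (t / 2) ∪ rotationCover t (repeatWords m t k) ∪
    rotationCover t (prefixWords t a R)
  let Z : Fin n → Finset (Relators m n) := fun i => Q.filter fun r => r i ∈ W
  let Y : Fin n × Fin n → Finset (Relators m n) := fun p => Q.filter fun r => p.1 ≠ p.2 ∧
    r p.2 ∈ rotationCover t (prefixWords t k (rotationPrefixes t k (r p.1)))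
  have hsub : (Q.filter fun r => r ∉ genericClass m n lam μ L) ⊆
      Finset.univ.biUnion Z ∪ Finset.univ.biUnion Y := by
    intro r hr
    obtain ⟨hr, hbad⟩ := Finset.mem_filter.1 hr
    by_contra hcon
    simp only [Finset.mem_union, Finset.mem_biUnion, Finset.mem_univ, true_and, not_or,
      not_exists, Z, Y, Finset.mem_filter, hr, Prod.forall, not_and, W] at hcon
    obtain ⟨hz, hy⟩ := hcon
    refine hbad (mem_genericClass_of hlam hk ha hmt hR (Fintype.mem_piFinset.1 hr)
      (fun i => ?_) (fun i => (hz i).1.2) hy (fun i => (hz i).2))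
    have := (hz i).1.1
    rw [mem_ball] at this
    omega
  have hW : W.card ≤ (ball m (t / 2)).card +
      2 * (t + 1) * ((t + 1) * ((t + 1) * (4 * (2 * m - 1) ^ (t - k)))) +
      2 * (t + 1) * ((t + 1) * (R.card * (2 * (2 * m - 1) ^ (t - a)))) := by
    refine (Finset.card_union_le _ _).trans (Nat.add_le_add
      ((Finset.card_union_le _ _).trans (Nat.add_le_add le_rfl ?_)) ?_)
    · exact (card_rotationCover_le _ _).trans (Nat.mul_le_mul_left _ (card_repeatWords_le hm _ _))
    · exact (card_rotationCover_le _ _).trans (Nat.mul_le_mul_left _ (card_prefixWords_le hm _ _ _))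
  have hZ : ∀ i, (Z i).card ≤ A.card ^ (n - 1) * W.card := by
    intro i
    refine card_tuples_le A (Z i) i _ (Finset.filter_subset _ _) fun r => Finset.card_le_card ?_
    intro g hg
    have := (Finset.mem_filter.1 (Finset.mem_filter.1 hg).2).2
    simpa using this
  have hY : ∀ p, (Y p).card ≤ A.card ^ (n - 1) *
      (2 * (t + 1) * ((t + 1) * (2 * (t + 1) * (2 * (2 * m - 1) ^ (t - k))))) := by
    rintro ⟨i, j⟩
    refine card_tuples_le A (Y (i, j)) j _ (Finset.filter_subset _ _) fun r => ?_
    refine (Finset.card_le_card (t := rotationCover t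
      (prefixWords t k (rotationPrefixes t k (r i)))) ?_).trans ?_
    · intro g hg
      obtain ⟨h1, h2⟩ := (Finset.mem_filter.1 (Finset.mem_filter.1 hg).2).2
      simp only [Function.update_self, Function.update_of_ne h1] at h2
      exact h2
    · refine (card_rotationCover_le _ _).trans (Nat.mul_le_mul_left _ ?_)
      refine (card_prefixWords_le hm _ _ _).trans (Nat.mul_le_mul_left _ ?_)
      exact Nat.mul_le_mul_right _ (card_rotationPrefixes_le _ _ _)
  refine (Finset.card_le_card hsub).trans ((Finset.card_union_le _ _).trans ?_)
  rw [Nat.mul_add]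
  refine Nat.add_le_add (Finset.card_biUnion_le.trans ?_) (Finset.card_biUnion_le.trans ?_)
  · refine (Finset.sum_le_card_nsmul _ _ _ fun i _ => (hZ i).trans
      (Nat.mul_le_mul_left _ hW)).trans (le_of_eq ?_)
    simp only [Finset.card_univ, Fintype.card_fin, smul_eq_mul]
    ring
  · refine (Finset.sum_le_card_nsmul _ _ _ fun p _ => hY p).trans (le_of_eq ?_)
    simp only [Finset.card_univ, Fintype.card_prod, Fintype.card_fin, smul_eq_mul]
    ring

end Bad

namespace LGraph

variable {m : ℕ} {V : Type*} [DecidableEq V] {Γ : LGraph m V}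

/-! ### Generators of fundamental groups -/

/-- Grow a spanning tree from `u` along crossing edges, recording the label of the tree path to each
vertex; all edges but those of the tree are the possible exceptions. -/
theorem Connected.exists_tree_labelling (hΓ : Γ.Connected) {u : V} (hu : u ∈ Γ.verts) :
    ∃ τ : V → FreeGroup (Fin m), τ u = 1 ∧
      (∀ v ∈ Γ.verts, Reach Γ.gens u (τ v) v ∧ (τ v).norm + 1 ≤ Γ.verts.card) ∧
      (Γ.edges.filter fun e => τ e.1 * FreeGroup.of e.2.1 ≠ τ e.2.2).card + Γ.verts.card ≤
        Γ.edges.card + 1 := by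
  have key : ∀ (j : ℕ) (W : Finset V) (τ : V → FreeGroup (Fin m)) (T : Finset (V × Fin m × V)),
      Γ.verts.card - W.card = j → W ⊆ Γ.verts → u ∈ W → τ u = 1 →
      (∀ v ∈ W, Reach Γ.gens u (τ v) v ∧ (τ v).norm + 1 ≤ W.card) → T ⊆ Γ.edges →
      T.card + 1 = W.card →
      (∀ e ∈ T, e.1 ∈ W ∧ e.2.2 ∈ W ∧ τ e.1 * FreeGroup.of e.2.1 = τ e.2.2) →
      ∃ τ : V → FreeGroup (Fin m), τ u = 1 ∧
        (∀ v ∈ Γ.verts, Reach Γ.gens u (τ v) v ∧ (τ v).norm + 1 ≤ Γ.verts.card) ∧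
        (Γ.edges.filter fun e => τ e.1 * FreeGroup.of e.2.1 ≠ τ e.2.2).card + Γ.verts.card ≤
          Γ.edges.card + 1 := by
    intro j
    induction j with
    | zero =>
      intro W τ T hj hW _ hτu hτ hT hTc hTe
      obtain rfl : W = Γ.verts := Finset.eq_of_subset_of_card_le hW (by omega)
      refine ⟨τ, hτu, hτ, ?_⟩
      rw [← hTc, ← add_assoc, add_le_add_iff_right, ← Finset.card_union_of_disjoint]
      · exact Finset.card_le_card (Finset.union_subset (Finset.filter_subset _ _) hT)
      · rw [Finset.disjoint_left]
        intro e he he'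
        exact (Finset.mem_filter.1 he).2 (hTe e he').2.2
    | succ j ih =>
      intro W τ T hj hW huW hτu hτ hT hTc hTe
      obtain ⟨w, hw, hwW⟩ : ∃ w ∈ Γ.verts, w ∉ W := by
        by_contra! hcon
        have := Finset.card_le_card (show Γ.verts ⊆ W from hcon)
        omega
      obtain ⟨p, x, q, hadj, hp, hq⟩ := hΓ.exists_crossing (W := (W : Set V)) hu hw
        (by simpa using huW) (by simpa using hwW)
      simp only [Finset.mem_coe] at hp hq
      have hne : ∀ v ∈ W, v ≠ q := fun v hv h => hq (h ▸ hv)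
      have hWc : (insert q W).card = W.card + 1 := Finset.card_insert_of_notMem hq
      set τ' := Function.update τ q (τ p * FreeGroup.mk [x]) with hτ'
      have hold : ∀ v ∈ W, τ' v = τ v := fun v hv => Function.update_of_ne (hne v hv) _ _
      have hnew : τ' q = τ p * FreeGroup.mk [x] := Function.update_self _ _ _
      have hnotT : edgeOf p x q ∉ T := by
        intro h
        obtain ⟨h1, h2, -⟩ := hTe _ h
        rcases edgeOf_fst p x q with ⟨-, h3⟩ | ⟨h3, -⟩
        · rw [h3] at h2; exact hq h2
        · rw [h3] at h1; exact hq h1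
      refine ih (insert q W) τ' (insert (edgeOf p x q) T) (by omega)
        (Finset.insert_subset hadj.mem_right hW) (by simp [huW]) (by rw [hold u huW, hτu]) ?_
        (Finset.insert_subset (adj_iff_edgeOf.1 hadj) hT)
        (by rw [Finset.card_insert_of_notMem hnotT]; omega) ?_
      · intro v hv
        rcases Finset.mem_insert.1 hv with rfl | hv
        · rw [hnew, hWc]
          refine ⟨(hτ p hp).1.trans hadj.reach, ?_⟩
          have h1 := FreeGroup.norm_mul_le (τ p) (FreeGroup.mk [x])
          have h2 : (FreeGroup.mk [x]).norm ≤ 1 := FreeGroup.norm_mk_le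
          have h3 := (hτ p hp).2
          omega
        · rw [hold v hv, hWc]
          have := hτ v hv
          exact ⟨this.1, by omega⟩
      · intro e he
        rcases Finset.mem_insert.1 he with rfl | he
        · obtain ⟨a, b⟩ := x
          cases b
          · refine ⟨Finset.mem_insert_self _ _, Finset.mem_insert_of_mem hp, ?_⟩
            simp only [edgeOf, Bool.false_eq_true, if_false, hnew, hold p hp, mul_assoc]
            rw [FreeGroup.of, FreeGroup.mul_mk]
            have : FreeGroup.mk ([(a, false)] ++ [(a, true)]) = 1 := by
              rw [← FreeGroup.mul_mk]
              exact inv_mul_cancel (FreeGroup.of a)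
            rw [this, mul_one]
          · refine ⟨Finset.mem_insert_of_mem hp, Finset.mem_insert_self _ _, ?_⟩
            simp only [edgeOf, if_true, hnew, hold p hp]
            rfl
        · obtain ⟨h1, h2, h3⟩ := hTe e he
          exact ⟨by simp [h1], by simp [h2], by rw [hold _ h1, hold _ h2, h3]⟩
  refine key _ {u} (fun _ => 1) ∅ rfl (by simpa using hu) (by simp) rfl ?_ (by simp) (by simp)
    (by simp)
  intro v hv
  rw [Finset.mem_singleton] at hv
  subst hv
  exact ⟨.refl _, by simp⟩

omit [DecidableEq V] in
-- The standard generators relative to a spanning tree: go out along the tree, cross an edge, and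
-- return. Edges compatible with the tree labels contribute nothing.
theorem loops_eq_closure {τ : V → FreeGroup (Fin m)} {u : V} (hτu : τ u = 1)
    (hτ : ∀ v ∈ Γ.verts, Reach Γ.gens u (τ v) v) :
    Loops Γ.gens u = Subgroup.closure
      ((Γ.edges.filter fun e => τ e.1 * FreeGroup.of e.2.1 ≠ τ e.2.2).image
        fun e => τ e.1 * FreeGroup.of e.2.1 * (τ e.2.2)⁻¹ : Finset (FreeGroup (Fin m))) := by
  set T : Finset (FreeGroup (Fin m)) :=
    (Γ.edges.filter fun e => τ e.1 * FreeGroup.of e.2.1 ≠ τ e.2.2).image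
      fun e => τ e.1 * FreeGroup.of e.2.1 * (τ e.2.2)⁻¹ with hT
  set H := Subgroup.closure (T : Set (FreeGroup (Fin m))) with hH
  apply le_antisymm
  · have hedge : ∀ p k q, (p, k, q) ∈ Γ.gens → τ p * k * (τ q)⁻¹ ∈ H := by
      intro p k q h
      obtain ⟨a, ha, rfl⟩ := mem_gens.1 h
      by_cases h1 : τ p * FreeGroup.of a = τ q
      · rw [h1, mul_inv_cancel]; exact H.one_mem
      · refine Subgroup.subset_closure ?_
        rw [Finset.mem_coe, Finset.mem_image]
        exact ⟨(p, a, q), Finset.mem_filter.2 ⟨ha, h1⟩, rfl⟩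
    have key : ∀ {g v}, Reach Γ.gens u g v → g * (τ v)⁻¹ ∈ H := by
      intro g v h
      induction h with
      | refl => rw [hτu]; simp [H.one_mem]
      | @fwd g v k w _ he ih =>
        have := H.mul_mem ih (hedge _ _ _ he)
        convert this using 1
        group
      | @bwd g v k w _ he ih =>
        have := H.mul_mem ih (H.inv_mem (hedge _ _ _ he))
        convert this using 1
        group
    intro g hg
    have := key hg
    rwa [hτu, inv_one, mul_one] at this
  · rw [hH, Subgroup.closure_le]
    intro g hg
    rw [Finset.mem_coe, Finset.mem_image] at hg
    obtain ⟨⟨p, a, q⟩, he, rfl⟩ := hg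
    have he' := (Finset.mem_filter.1 he).1
    exact ((hτ p (Γ.src_mem _ he')).trans (adj_true.2 he').reach).trans
      (hτ q (Γ.tgt_mem _ he')).symm

theorem Connected.exists_generators (hΓ : Γ.Connected) {u : V} (hu : u ∈ Γ.verts) {L E : ℕ}
    (hL : Γ.RankLE L) (hE : Γ.edges.card ≤ E) :
    (∃ g : Fin L → FreeGroup (Fin m), (∀ i, (g i).norm ≤ 2 * E + 1) ∧
      Loops Γ.gens u = Subgroup.closure (Set.range g)) ∧
    ∀ v ∈ Γ.verts, ∃ h, Reach Γ.gens u h v ∧ h.norm ≤ 2 * E + 1 := by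
  obtain ⟨τ, h1, h2, h3⟩ := hΓ.exists_tree_labelling hu
  have hV : Γ.verts.card ≤ E + 1 := by omega
  refine ⟨?_, fun v hv => ⟨τ v, (h2 v hv).1, by have := (h2 v hv).2; omega⟩⟩
  have h4 := loops_eq_closure h1 fun v hv => (h2 v hv).1
  set T := (Γ.edges.filter fun e => τ e.1 * FreeGroup.of e.2.1 ≠ τ e.2.2).image
        fun e => τ e.1 * FreeGroup.of e.2.1 * (τ e.2.2)⁻¹ with hT
  have hTc : T.card ≤ L := by
    refine Finset.card_image_le.trans ?_
    unfold RankLE at hL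
    omega
  have hTn : ∀ z ∈ T, z.norm ≤ 2 * E + 1 := by
    intro z hz
    obtain ⟨⟨p, a, q⟩, he, rfl⟩ := Finset.mem_image.1 hz
    have he' := (Finset.mem_filter.1 he).1
    have h5 := (h2 p (Γ.src_mem _ he')).2
    have h6 := (h2 q (Γ.tgt_mem _ he')).2
    have h7 := FreeGroup.norm_mul_le (τ p * FreeGroup.of a) (τ q)⁻¹
    have h8 := FreeGroup.norm_mul_le (τ p) (FreeGroup.of a)
    rw [FreeGroup.norm_inv_eq] at h7
    rw [FreeGroup.norm_of] at h8
    simp only at h7 ⊢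
    omega
  let e := T.equivFin
  let g : Fin L → FreeGroup (Fin m) := fun i =>
    if h : i.1 < T.card then (e.symm ⟨i.1, h⟩).1 else 1
  refine ⟨g, ?_, ?_⟩
  · intro i
    by_cases h : i.1 < T.card
    · simp only [g, h, dif_pos]
      exact hTn _ (e.symm ⟨i.1, h⟩).2
    · simp [g, h]
  · rw [h4]
    apply le_antisymm
    · rw [Subgroup.closure_le]
      intro z hz
      refine Subgroup.subset_closure ⟨⟨(e ⟨z, hz⟩).1, (e ⟨z, hz⟩).2.trans_le hTc⟩, ?_⟩
      simp [g]
    · rw [Subgroup.closure_le]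
      rintro _ ⟨i, rfl⟩
      by_cases h : i.1 < T.card
      · simp only [g, h, dif_pos]
        exact Subgroup.subset_closure (e.symm ⟨i.1, h⟩).2
      · simp only [g, h, dif_neg, not_false_iff]
        exact Subgroup.one_mem _

/-! ### Supports of walks -/

theorem exists_missing_letter {v : V} (hv : Γ.deg v < 2 * m) : ∃ y, ∀ w, ¬ Γ.Adj v y w := by
  by_contra! hcon
  choose f hf using hcon
  have h1 : (Finset.univ.image fun y : Letter m => (v, y, f y)) ⊆ Γ.out v := by
    intro t ht
    obtain ⟨y, -, rfl⟩ := Finset.mem_image.1 ht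
    exact mem_out.2 ⟨hf y, rfl⟩
  have h2 := Finset.card_le_card h1
  rw [Finset.card_image_of_injective _ (fun y z h => by simpa using (Prod.mk.inj (Prod.mk.inj h).2).1)]
    at h2
  simp only [Finset.card_univ, Fintype.card_prod, Fintype.card_fin, Fintype.card_bool] at h2
  change m * 2 ≤ Γ.deg v at h2
  omega

theorem deg_mono {Δ : LGraph m V} (h : Δ.edges ⊆ Γ.edges) (v : V) : Δ.deg v ≤ Γ.deg v := by
  refine Finset.card_le_card ?_
  rintro ⟨p, x, q⟩ ht
  obtain ⟨h1, rfl⟩ := mem_out.1 ht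
  exact mem_out.2 ⟨adj_iff_edgeOf.2 (h (adj_iff_edgeOf.1 h1)), rfl⟩

/-- A subgraph of a connected folded graph with a deficient vertex has a deficient vertex. -/
theorem Folded.exists_deficient (hΓ : Γ.Folded) (hcon : Γ.Connected) {Δ : LGraph m V}
    (hE : Δ.edges ⊆ Γ.edges) (hV : Δ.verts ⊆ Γ.verts) (hne : Δ.verts.Nonempty) {v : V}
    (hv : v ∈ Γ.verts) (hdeg : Γ.deg v < 2 * m) : ∃ w ∈ Δ.verts, Δ.deg w < 2 * m := by
  by_contra! hfull
  obtain ⟨u, hu⟩ := hne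
  by_cases hvΔ : v ∈ Δ.verts
  · have := hfull v hvΔ
    have := deg_mono hE v
    omega
  -- If all vertices of the subgraph are full, every edge leaving it has, by folding, an edge of the
  -- subgraph with the same origin and label, so it does not leave.
  · obtain ⟨p, x, q, hadj, hp, hq⟩ := hcon.exists_crossing (W := (Δ.verts : Set V)) (hV hu) hv
      (by simpa using hu) (by simpa using hvΔ)
    obtain ⟨w, hw⟩ := (hΓ.mono hE).adj_of_deg (hfull p (by simpa using hp)) x
    have := hΓ.func _ _ _ _ hadj (adj_iff_edgeOf.2 (hE (adj_iff_edgeOf.1 hw)))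
    subst this
    exact hq (by simpa using hw.mem_right)

/-- The support of a reduced walk has few vertices of full degree. -/
theorem card_full_support_le (hm : 1 < m) {ν : ℕ → V} {ω : ℕ → Letter m} {N L : ℕ} (hN : 0 < N)
    (hred : ∀ j, j + 1 < N → ω (j + 1) ≠ flipL (ω j)) (hL : (support ν ω N).RankLE L) :
    ((support ν ω N).verts.filter fun v => 2 * m ≤ (support ν ω N).deg v).card ≤ L := by
  set Δ := support ν ω N with hΔ
  have h1 := sum_deg_sub_le hL
  have hw : Δ.IsWalk ν ω N := isWalk_support
  have hdeg : ∀ v ∈ Δ.verts, 1 ≤ Δ.deg v ∧ (Δ.deg v < 2 → v = ν 0 ∨ v = ν N) := by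
    intro v hv
    obtain ⟨j, hj, rfl⟩ := Finset.mem_image.1 hv
    rw [Finset.mem_range] at hj
    rcases Nat.eq_zero_or_pos j with rfl | hj0
    · exact ⟨Finset.card_pos.2 ⟨_, mem_out.2 ⟨hw 0 hN, rfl⟩⟩, fun _ => .inl rfl⟩
    have hb := adj_flip.2 (hw (j - 1) (by omega))
    rw [Nat.sub_add_cancel hj0] at hb
    refine ⟨Finset.card_pos.2 ⟨_, mem_out.2 ⟨hb, rfl⟩⟩, fun hlt => ?_⟩
    by_contra! hcon
    have hjN : j < N := lt_of_le_of_ne (by omega) fun h => hcon.2 (by rw [h])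
    have hf := hw j hjN
    have h2 : ({(ν j, ω j, ν (j + 1)), (ν j, flipL (ω (j - 1)), ν (j - 1))} :
        Finset (V × Letter m × V)) ⊆ Δ.out (ν j) := by
      intro t ht
      simp only [Finset.mem_insert, Finset.mem_singleton] at ht
      rcases ht with rfl | rfl
      · exact mem_out.2 ⟨hf, rfl⟩
      · exact mem_out.2 ⟨hb, rfl⟩
    have h3 := Finset.card_le_card h2
    rw [Finset.card_pair] at h3
    · exact absurd hlt (not_lt.2 h3)
    · intro h
      have h4 := (Prod.mk.inj (Prod.mk.inj h).2).1
      have := hred (j - 1) (by omega)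
      rw [Nat.sub_add_cancel hj0] at this
      exact this h4
  -- A full vertex contributes at least 2 to the sum, and only the two ends of the walk can have
  -- degree one: 2 · #full - 2 ≤ 2L - 2.
  have h2 : (∑ v ∈ Δ.verts, ((if 2 * m ≤ Δ.deg v then (2 : ℤ) else 0) -
      ((if v = ν 0 then 1 else 0) + (if v = ν N then 1 else 0)))) ≤
      ∑ v ∈ Δ.verts, ((Δ.deg v : ℤ) - 2) := by
    refine Finset.sum_le_sum fun v hv => ?_
    obtain ⟨h3, h4⟩ := hdeg v hv
    by_cases h5 : Δ.deg v < 2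
    · rcases h4 h5 with h6 | h6
      · rw [if_neg (by omega), if_pos h6]
        split_ifs <;> omega
      · rw [if_neg (by omega), if_pos h6]
        split_ifs <;> omega
    · split_ifs <;> omega
  rw [Finset.sum_sub_distrib, Finset.sum_add_distrib, Finset.sum_ite_eq', Finset.sum_ite_eq',
    ← Finset.sum_filter, Finset.sum_const, nsmul_eq_mul] at h2
  have h3 : (if ν 0 ∈ Δ.verts then (1 : ℤ) else 0) ≤ 1 := by split_ifs <;> norm_num
  have h4 : (if ν N ∈ Δ.verts then (1 : ℤ) else 0) ≤ 1 := by split_ifs <;> norm_num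
  omega

end LGraph

namespace LGraph

open FreeGroup (IsReduced)

variable {m : ℕ} {V : Type*} {Γ : LGraph m V}

/-! ### Words readable in a folded graph -/

theorem isReduced_replicate_append {x y : Letter m} {i : ℕ} {l : List (Letter m)}
    (hx : y.1 ≠ x.1) (hl : IsReduced (y :: l)) :
    IsReduced (x :: (List.replicate (i + 1) y ++ l)) := by
  have hxy : y ≠ flipL x := fun h => hx (by rw [h]; rfl)
  have hyy : y ≠ flipL y := (flipL_ne y).symm
  have h1 : ∀ i, IsReduced (List.replicate (i + 1) y ++ l) := by
    intro i
    induction i with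
    | zero => exact hl
    | succ i ih => exact isReduced_cons_cons'.2 ⟨hyy, ih⟩
  exact isReduced_cons_cons'.2 ⟨hxy, h1 i⟩

theorem exists_isReduced_extension (hm : 1 < m) {x : Letter m} {z : List (Letter m)}
    (h : IsReduced (x :: z)) (k : ℕ) : ∃ z', IsReduced (x :: (z ++ z')) ∧ z'.length = k := by
  obtain ⟨s, y, hs⟩ : ∃ s y, x :: z = s ++ [y] := by
    rcases List.eq_nil_or_concat (x :: z) with h | ⟨s, y, h⟩
    · simp at h
    · exact ⟨s, y, by simpa using h⟩
  obtain ⟨z', hz'⟩ : (continuations m k y).Nonempty := by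
    rw [← Finset.card_pos, card_continuations]
    exact pow_pos (by omega) _
  rw [mem_continuations] at hz'
  refine ⟨z', ?_, hz'.2⟩
  rw [← List.cons_append, hs]
  rw [hs] at h
  exact h.append_overlap hz'.1 (by simp)

variable [DecidableEq V]

/-- A path to a deficient vertex yields an unreadable word. -/
theorem Folded.exists_unreadable_of_run (hΓ : Γ.Folded) {v : V} (hv : Γ.deg v < 2 * m)
    {l : List (Letter m)} {p u : V} {x : Letter m} (hp : Γ.Adj p x u) (hl : IsReduced (x :: l))
    (hrun : Run Γ.Adj u l v) :
    ∃ z, z.length ≤ l.length + 1 ∧ IsReduced (x :: z) ∧ ∀ w, ¬ Run Γ.Adj u z w := by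
  induction l generalizing p u x with
  | nil =>
    obtain rfl := hrun
    obtain ⟨y, hy⟩ := exists_missing_letter hv
    refine ⟨[y], by simp, isReduced_cons_cons'.2 ⟨?_, FreeGroup.IsReduced.singleton⟩, ?_⟩
    · rintro rfl
      exact hy p (adj_flip.2 hp)
    · intro w hw
      exact hy w (run_singleton.1 hw)
  | cons y l ih =>
    obtain ⟨c, h1, h2⟩ := hrun
    rw [isReduced_cons_cons'] at hl
    obtain ⟨z, h3, h4, h5⟩ := ih h1 hl.2 h2
    refine ⟨y :: z, by simpa using h3, isReduced_cons_cons'.2 ⟨hl.1, h4⟩, ?_⟩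
    rintro w ⟨c', h6, h7⟩
    obtain rfl := hΓ.func _ _ _ _ h1 h6
    exact h5 w h7

/-- Deficient vertices are close to every vertex. -/
theorem Folded.exists_run_deficient (hΓ : Γ.Folded) (hcon : Γ.Connected) {v : V}
    (hv : v ∈ Γ.verts) (hdeg : Γ.deg v < 2 * m) {u : V} (hu : u ∈ Γ.verts) :
    ∃ l v', IsReduced l ∧ l.length ≤ (Γ.verts.filter fun v => 2 * m ≤ Γ.deg v).card ∧
      Run Γ.Adj u l v' ∧ Γ.deg v' < 2 * m := by
  suffices h : ∃ l v', l.length ≤ (Γ.verts.filter fun v => 2 * m ≤ Γ.deg v).card ∧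
      Run Γ.Adj u l v' ∧ Γ.deg v' < 2 * m by
    obtain ⟨l, v', h1, h2, h3⟩ := h
    exact ⟨(FreeGroup.mk l).toWord, v', FreeGroup.isReduced_toWord,
      (FreeGroup.norm_mk_le (L₁ := l)).trans h1, run_reduce hΓ h2, h3⟩
  by_cases hfull : Γ.deg u < 2 * m
  · exact ⟨[], u, by simp, rfl, hfull⟩
  -- Explore through full vertices only; a path that leaves the explored set is no longer than their
  -- number.
  have key : ∀ (j : ℕ) (W : Finset V), Γ.verts.card - W.card = j → u ∈ W →
      (W ⊆ Γ.verts.filter fun v => 2 * m ≤ Γ.deg v) →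
      (∀ w ∈ W, ∃ l, Run Γ.Adj u l w ∧ l.length + 1 ≤ W.card) →
      ∃ l v', l.length ≤ (Γ.verts.filter fun v => 2 * m ≤ Γ.deg v).card ∧
        Run Γ.Adj u l v' ∧ Γ.deg v' < 2 * m := by
    intro j
    induction j with
    | zero =>
      intro W hj huW hW _
      have hsub : W ⊆ Γ.verts := hW.trans (Finset.filter_subset _ _)
      have : W = Γ.verts := Finset.eq_of_subset_of_card_le hsub (by omega)
      have := (Finset.mem_filter.1 (hW (this ▸ hv))).2
      omega
    | succ j ih =>
      intro W hj huW hW hrun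
      have hvW : v ∉ W := fun h => by
        have := (Finset.mem_filter.1 (hW h)).2
        omega
      obtain ⟨p, x, q, hadj, hp, hq⟩ := hcon.exists_crossing (W := (W : Set V)) hu hv
        (by simpa using huW) (by simpa using hvW)
      simp only [Finset.mem_coe] at hp hq
      obtain ⟨l, h1, h2⟩ := hrun p hp
      have h3 : Run Γ.Adj u (l ++ [x]) q := run_append.2 ⟨_, h1, run_singleton.2 hadj⟩
      by_cases hqd : Γ.deg q < 2 * m
      · refine ⟨_, q, ?_, h3, hqd⟩
        rw [List.length_append, List.length_singleton]
        exact h2.trans (Finset.card_le_card hW)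
      · have hc : (insert q W).card = W.card + 1 := Finset.card_insert_of_notMem hq
        refine ih (insert q W) (by omega) (by simp [huW]) ?_ ?_
        · refine Finset.insert_subset (Finset.mem_filter.2 ⟨hadj.mem_right, by omega⟩) hW
        · intro w hw
          rw [hc]
          rcases Finset.mem_insert.1 hw with rfl | hw
          · exact ⟨_, h3, by simpa using h2⟩
          · obtain ⟨l, h4, h5⟩ := hrun w hw
            exact ⟨l, h4, by omega⟩
  refine key _ {u} rfl (by simp) ?_ ?_
  · rw [Finset.singleton_subset_iff]
    exact Finset.mem_filter.2 ⟨hu, by omega⟩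
  · intro w hw
    rw [Finset.mem_singleton] at hw
    subst hw
    exact ⟨[], rfl, by simp⟩

/-- Powers of a letter lead to a deficient vertex or are closed. -/
theorem Folded.exists_run_replicate (hΓ : Γ.Folded) {u : V} (hu : u ∈ Γ.verts) (y : Letter m) :
    ∃ i v, i ≤ (Γ.verts.filter fun v => 2 * m ≤ Γ.deg v).card ∧
      Run Γ.Adj u (List.replicate i y) v ∧ (Γ.deg v < 2 * m ∨ 0 < i ∧ v = u) := by
  set W := Γ.verts.filter fun v => 2 * m ≤ Γ.deg v with hW
  by_contra! hcon
  have h1 : ∀ i ≤ W.card, ∃ v, Run Γ.Adj u (List.replicate i y) v := by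
    intro i
    induction i with
    | zero => exact fun _ => ⟨u, rfl⟩
    | succ i ih =>
      intro hi
      obtain ⟨v, hv⟩ := ih (by omega)
      obtain ⟨w, hw⟩ := hΓ.adj_of_deg (hcon i v (by omega) hv).1 y
      refine ⟨w, ?_⟩
      rw [List.replicate_succ']
      exact run_append.2 ⟨_, hv, run_singleton.2 hw⟩
  have : Nonempty V := ⟨u⟩
  choose! f hf using h1
  -- If all the vertices visited were full, two of them would agree by pigeonhole, and reading
  -- backwards gives a return to `u`.
  obtain ⟨i, hi, j, hj, hne, hij⟩ : ∃ i ∈ Finset.range (W.card + 1),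
      ∃ j ∈ Finset.range (W.card + 1), i ≠ j ∧ f i = f j := by
    refine Finset.exists_ne_map_eq_of_card_lt_of_maps_to (t := W) (by simp) ?_
    intro i hi
    rw [Finset.mem_coe, Finset.mem_range] at hi
    have := hf i (by omega)
    exact Finset.mem_filter.2 ⟨run_mem_verts this hu, (hcon i _ (by omega) this).1⟩
  rw [Finset.mem_range] at hi hj
  wlog hlt : i < j generalizing i j
  · exact this j hj i hi hne.symm hij.symm (by omega)
  have h2 := hf j (by omega)
  rw [show j = (j - i) + i by omega, List.replicate_add, run_append] at h2
  obtain ⟨c, h3, h4⟩ := h2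
  rw [show j - i + i = j by omega, ← hij] at h4
  obtain rfl := hΓ.run_cofunc h4 (hf i (by omega))
  exact (hcon (j - i) c (by omega) h3).2 (by omega) rfl

/-- Every state of a folded graph with few vertices of full degree has a short unreadable
continuation. -/
theorem Folded.exists_unreadable (hm : 1 < m) (hΓ : Γ.Folded) (hcon : Γ.Connected) {v : V}
    (hv : v ∈ Γ.verts) (hdeg : Γ.deg v < 2 * m) {L : ℕ}
    (hL : (Γ.verts.filter fun v => 2 * m ≤ Γ.deg v).card ≤ L) {p u : V} {x : Letter m}
    (hp : Γ.Adj p x u) :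
    ∃ z, z.length = 2 * L + 1 ∧ IsReduced (x :: z) ∧ ∀ w, ¬ Run Γ.Adj u z w := by
  suffices h : ∃ l v', l.length ≤ 2 * L ∧ IsReduced (x :: l) ∧ Run Γ.Adj u l v' ∧
      Γ.deg v' < 2 * m by
    obtain ⟨l, v', h1, h2, h3, h4⟩ := h
    obtain ⟨z, h5, h6, h7⟩ := hΓ.exists_unreadable_of_run h4 hp h2 h3
    obtain ⟨z', h8, h9⟩ := exists_isReduced_extension hm h6 (2 * L + 1 - z.length)
    refine ⟨z ++ z', by rw [List.length_append]; omega, h8, fun w hw => ?_⟩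
    obtain ⟨c, h10, -⟩ := run_append.1 hw
    exact h7 c h10
  obtain ⟨l, v', h1, h2, h3, h4⟩ := hΓ.exists_run_deficient hcon hv hdeg hp.mem_right
  cases l with
  | nil => exact ⟨[], v', by simp, FreeGroup.IsReduced.singleton, h3, h4⟩
  | cons a l =>
    by_cases ha : a ≠ flipL x
    · exact ⟨a :: l, v', by omega, isReduced_cons_cons'.2 ⟨ha, h1⟩, h3, h4⟩
    push Not at ha
    subst ha
    -- The short path to a deficient vertex would cancel with the incoming letter. Insert a power of
    -- another generator in front: it reaches a deficient vertex itself or returns to the start, at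
    -- a cost of at most L letters. Hence the bound 2L.
    obtain ⟨y, hy⟩ : ∃ y : Letter m, y.1 ≠ x.1 := by
      have : Nontrivial (Fin m) := Fin.nontrivial_iff_two_le.2 hm
      obtain ⟨b, hb⟩ := exists_ne x.1
      exact ⟨(b, true), hb⟩
    have hyl : IsReduced (y :: flipL x :: l) := by
      refine isReduced_cons_cons'.2 ⟨fun h => hy ?_, h1⟩
      have := congrArg Prod.fst h
      exact this.symm
    obtain ⟨i, w, h5, h6, h7⟩ := hΓ.exists_run_replicate hp.mem_right y
    rcases h7 with h7 | ⟨h7, rfl⟩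
    · refine ⟨List.replicate i y, w, by simp; omega, ?_, h6, h7⟩
      cases i with
      | zero => exact FreeGroup.IsReduced.singleton
      | succ i =>
        have := isReduced_replicate_append (i := i) hy (FreeGroup.IsReduced.singleton (a := y))
        simpa using this
    · obtain ⟨i, rfl⟩ : ∃ j, i = j + 1 := ⟨i - 1, by omega⟩
      refine ⟨List.replicate (i + 1) y ++ flipL x :: l, v', ?_,
        isReduced_replicate_append hy hyl, run_append.2 ⟨_, h6, h3⟩, h4⟩
      rw [List.length_append, List.length_replicate]
      omega

omit [DecidableEq V] in
open Classical in
-- In each block of N letters at least one of the (2m - 1)^N reduced continuations is unreadable,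
-- whatever has been read before.
theorem Folded.card_continuations_le (hΓ : Γ.Folded) {N : ℕ} (hN : 0 < N)
    (h : ∀ p x u, Γ.Adj p x u → ∃ z, z.length = N ∧ IsReduced (x :: z) ∧ ∀ w, ¬ Run Γ.Adj u z w)
    (q : ℕ) {p u : V} {x : Letter m} (hp : Γ.Adj p x u) :
    ((continuations m (q * N) x).filter fun w => ∃ v, Run Γ.Adj u w v).card ≤
      ((2 * m - 1) ^ N - 1) ^ q := by
  induction q generalizing p u x with
  | zero =>
    refine (Finset.card_filter_le _ _).trans ?_
    simp [card_continuations]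
  | succ q ih =>
    set T := (continuations m ((q + 1) * N) x).filter fun w => ∃ v, Run Γ.Adj u w v with hT
    have h1 : (T.image (List.take N)).card ≤ (2 * m - 1) ^ N - 1 := by
      obtain ⟨z, hz1, hz2, hz3⟩ := h p x u hp
      have hz : z ∈ continuations m N x := mem_continuations.2 ⟨hz2, hz1⟩
      rw [← card_continuations (m := m) N x, ← Finset.card_erase_of_mem hz]
      refine Finset.card_le_card ?_
      intro s hs
      obtain ⟨w, hw, rfl⟩ := Finset.mem_image.1 hs
      obtain ⟨h2, v, h3⟩ := Finset.mem_filter.1 hw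
      rw [mem_continuations] at h2
      refine Finset.mem_erase.2 ⟨?_, mem_continuations.2 ⟨?_, ?_⟩⟩
      · intro heq
        rw [← List.take_append_drop N w, run_append, heq] at h3
        obtain ⟨c, h4, -⟩ := h3
        exact hz3 c h4
      · have := h2.1
        rw [← List.take_append_drop N w, ← List.cons_append] at this
        exact IsReduced.left this
      · rw [List.length_take, h2.2, min_eq_left]
        nlinarith
    have h2 : ∀ s ∈ T.image (List.take N), (T.filter fun w => w.take N = s).card ≤
        ((2 * m - 1) ^ N - 1) ^ q := by
      intro s hs
      obtain ⟨w, hw, hws⟩ := Finset.mem_image.1 hs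
      obtain ⟨h3, v, h4⟩ := Finset.mem_filter.1 hw
      rw [mem_continuations] at h3
      have hsl : s.length = N := by
        rw [← hws, List.length_take, h3.2, min_eq_left]
        nlinarith
      rw [← List.take_append_drop N w, run_append, hws] at h4
      obtain ⟨c, h5, -⟩ := h4
      -- The last letter of the block and the vertex reached form the state from which the next
      -- block is counted.
      obtain ⟨s', y, rfl⟩ : ∃ s' y, s = s' ++ [y] := by
        rcases List.eq_nil_or_concat s with h | ⟨s', y, h⟩
        · subst h; simp at hsl; omega
        · exact ⟨s', y, by simpa using h⟩
      obtain ⟨p', h6, h7⟩ := run_append.1 h5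
      rw [run_singleton] at h7
      refine le_trans ?_ (ih h7)
      refine Finset.card_le_card_of_injOn (List.drop N) ?_ ?_
      · intro w' hw'
        obtain ⟨hw1, hw2⟩ := Finset.mem_filter.1 hw'
        obtain ⟨h8, v', h9⟩ := Finset.mem_filter.1 hw1
        rw [mem_continuations] at h8
        rw [← List.take_append_drop N w', hw2] at h9
        obtain ⟨c', h10, h11⟩ := run_append.1 h9
        obtain rfl := hΓ.run_func h5 h10
        refine Finset.mem_filter.2 ⟨mem_continuations.2 ⟨?_, ?_⟩, v', h11⟩
        · have := h8.1
          rw [← List.take_append_drop N w', hw2] at this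
          refine this.infix ⟨x :: s', [], ?_⟩
          simp
        · rw [List.length_drop, h8.2, add_mul, one_mul, Nat.add_sub_cancel]
      · intro w1 hw1 w2 hw2 heq
        rw [← List.take_append_drop N w1, ← List.take_append_drop N w2, heq,
          (Finset.mem_filter.1 hw1).2, (Finset.mem_filter.1 hw2).2]
    refine (Finset.card_le_mul_card_image T _ h2).trans ?_
    rw [pow_succ]
    exact Nat.mul_le_mul_left _ h1

open Classical in
/-- Exponentially few words are readable from a vertex of a folded graph with few vertices of full
degree. -/
theorem Folded.card_readable_le (hm : 1 < m) (hΓ : Γ.Folded) (hcon : Γ.Connected) {v : V}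
    (hv : v ∈ Γ.verts) (hdeg : Γ.deg v < 2 * m) {L : ℕ}
    (hL : (Γ.verts.filter fun v => 2 * m ≤ Γ.deg v).card ≤ L) (q : ℕ) (u : V) :
    ((redWords m (q * (2 * L + 1) + 1)).filter fun w => ∃ v, Run Γ.Adj u w v).card ≤
      2 * m * ((2 * m - 1) ^ (2 * L + 1) - 1) ^ q := by
  have h1 : ((redWords m (q * (2 * L + 1) + 1)).filter fun w => ∃ v, Run Γ.Adj u w v) ⊆
      (Finset.univ : Finset (Letter m)).biUnion fun y =>
        ((continuations m (q * (2 * L + 1)) y).filter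
          fun w => ∃ v, Run Γ.Adj u (y :: w) v).image (y :: ·) := by
    intro w hw
    obtain ⟨h2, h3⟩ := Finset.mem_filter.1 hw
    rw [mem_redWords] at h2
    cases w with
    | nil => simp at h2
    | cons y w =>
      refine Finset.mem_biUnion.2 ⟨y, Finset.mem_univ _, Finset.mem_image.2 ⟨w, ?_, rfl⟩⟩
      exact Finset.mem_filter.2 ⟨mem_continuations.2 ⟨h2.1, by simpa using h2.2⟩, h3⟩
  refine (Finset.card_le_card h1).trans (Finset.card_biUnion_le.trans ?_)
  refine (Finset.sum_le_card_nsmul _ _ (((2 * m - 1) ^ (2 * L + 1) - 1) ^ q) ?_).trans ?_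
  · intro y _
    refine Finset.card_image_le.trans ?_
    by_cases hy : ∃ c, Γ.Adj u y c
    · obtain ⟨c, hc⟩ := hy
      refine le_trans (Finset.card_le_card ?_) (hΓ.card_continuations_le (N := 2 * L + 1)
        (by omega) (fun p x u hp => hΓ.exists_unreadable hm hcon hv hdeg hL hp) q hc)
      intro w hw
      obtain ⟨h2, v', c', h3, h4⟩ := Finset.mem_filter.1 hw
      obtain rfl := hΓ.func _ _ _ _ hc h3
      exact Finset.mem_filter.2 ⟨h2, v', h4⟩
    · rw [Finset.filter_false_of_mem]
      · simp
      · rintro w - ⟨v', c', h3, -⟩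
        exact hy ⟨c', h3⟩
  · rw [Finset.card_univ, Fintype.card_prod, Fintype.card_fin, Fintype.card_bool, smul_eq_mul,
      mul_comm m 2]

end LGraph

open FreeGroup (IsReduced)

variable {m : ℕ}

/-! ### From labelled graphs to finite sets of edges -/

section ToLGraph

variable (Γ : FGraph m) [Fintype Γ.V] [Fintype Γ.E]

open Classical in
/-- The finite labelled graph spanned by all edges. -/
def FGraph.toLGraph : LGraph m Γ.V where
  verts := Finset.univ
  edges := Finset.univ.image fun e => (Γ.src e, Γ.lab e, Γ.tgt e)
  src_mem _ _ := Finset.mem_univ _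
  tgt_mem _ _ := Finset.mem_univ _

variable {Γ}

theorem adj_toLGraph_iff {u w : Γ.V} {x : Letter m} : Γ.toLGraph.Adj u x w ↔
    ∃ d : Γ.OEdge, Γ.origin d = u ∧ Γ.oLabel d = x ∧ Γ.terminus d = w := by
  obtain ⟨a, b⟩ := x
  cases b
  · rw [LGraph.adj_false]
    simp only [FGraph.toLGraph, Finset.mem_image, Finset.mem_univ, true_and, Prod.mk.injEq]
    constructor
    · rintro ⟨e, rfl, rfl, rfl⟩
      exact ⟨(e, false), rfl, rfl, rfl⟩
    · rintro ⟨⟨e, b⟩, h1, h2, h3⟩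
      obtain ⟨rfl, rfl⟩ := Prod.mk.inj h2
      exact ⟨e, h3, rfl, h1⟩
  · rw [LGraph.adj_true]
    simp only [FGraph.toLGraph, Finset.mem_image, Finset.mem_univ, true_and, Prod.mk.injEq]
    constructor
    · rintro ⟨e, rfl, rfl, rfl⟩
      exact ⟨(e, true), rfl, rfl, rfl⟩
    · rintro ⟨⟨e, b⟩, h1, h2, h3⟩
      obtain ⟨rfl, rfl⟩ := Prod.mk.inj h2
      exact ⟨e, h1, rfl, h3⟩

theorem run_of_isPath {p : List Γ.OEdge} {u w : Γ.V} (h : Γ.IsPath u p w) :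
    Run Γ.toLGraph.Adj u (Γ.pathLabel p) w := by
  induction p generalizing u with
  | nil => exact h
  | cons d p ih => exact ⟨_, adj_toLGraph_iff.2 ⟨d, h.1, rfl, rfl⟩, ih h.2⟩

theorem connected_toLGraph (h : Γ.IsConnected) : Γ.toLGraph.Connected := by
  intro u _ w _
  obtain ⟨p, hp⟩ := h.2 u w
  exact ⟨_, LGraph.reach_of_run (run_of_isPath hp)⟩

theorem folded_toLGraph (h : Γ.IsFolded) : Γ.toLGraph.Folded := by
  rw [LGraph.folded_iff]
  intro u x w w' h1 h2
  obtain ⟨d, h3, h4, rfl⟩ := adj_toLGraph_iff.1 h1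
  obtain ⟨d', h5, h6, rfl⟩ := adj_toLGraph_iff.1 h2
  rw [h d d' (h3.trans h5.symm) (h4.trans h6.symm)]

theorem card_edges_toLGraph_le : Γ.toLGraph.edges.card ≤ Nat.card Γ.E := by
  classical
  rw [Nat.card_eq_fintype_card]
  exact Finset.card_image_le

theorem rankLE_toLGraph {k : ℕ} (h : Γ.rank ≤ k) : Γ.toLGraph.RankLE k := by
  have h1 := card_edges_toLGraph_le (Γ := Γ)
  have h2 : Γ.toLGraph.verts.card = Nat.card Γ.V := by
    rw [Nat.card_eq_fintype_card]; rfl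
  unfold FGraph.rank at h
  unfold LGraph.RankLE
  omega

theorem deg_toLGraph_le [DecidableEq Γ.V] (v : Γ.V) : Γ.toLGraph.deg v ≤ Γ.degree v := by
  have h1 : Nat.card {t // t ∈ Γ.toLGraph.out v} = Γ.toLGraph.deg v := by simp [LGraph.deg]
  rw [← h1]
  have : Finite {d : Γ.OEdge // Γ.origin d = v} := Subtype.finite
  refine Nat.card_le_card_of_surjective (fun d => ⟨(Γ.origin d.1, Γ.oLabel d.1, Γ.terminus d.1),
    LGraph.mem_out.2 ⟨adj_toLGraph_iff.2 ⟨_, rfl, rfl, rfl⟩, d.2⟩⟩) ?_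
  rintro ⟨⟨u, x, w⟩, ht⟩
  obtain ⟨h2, rfl⟩ := LGraph.mem_out.1 ht
  obtain ⟨d, h3, rfl, rfl⟩ := adj_toLGraph_iff.1 h2
  exact ⟨⟨d, h3⟩, by simp [h3]⟩

end ToLGraph

namespace LGraph

variable {V : Type*} [DecidableEq V]

/-- Iterated folding. -/
theorem Connected.exists_folded {Γ : LGraph m V} (hΓ : Γ.Connected) :
    ∃ (Γ' : LGraph m V) (φ : V → V), Γ'.Folded ∧ Γ'.Connected ∧ Γ'.edges.card ≤ Γ.edges.card ∧
      (∀ k, Γ.RankLE k → Γ'.RankLE k) ∧ (∀ u ∈ Γ.verts, φ u ∈ Γ'.verts) ∧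
      (∀ u x w, Γ.Adj u x w → Γ'.Adj (φ u) x (φ w)) := by
  induction hn : Γ.edges.card using Nat.strong_induction_on generalizing Γ with
  | _ n ih =>
    by_cases hf : Γ.Folded
    · exact ⟨Γ, id, hf, hΓ, hn.le, fun _ h => h, fun _ h => h, fun _ _ _ h => h⟩
    obtain ⟨Γ₁, φ₁, h1, h2, h3, h4, h5, h6⟩ := exists_fold hf
    have hcon : Γ₁.Connected := by
      intro u hu w hw
      obtain ⟨u, hu', rfl⟩ := h6 u hu
      obtain ⟨w, hw', rfl⟩ := h6 w hw
      obtain ⟨g, hg⟩ := hΓ u hu' w hw'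
      exact ⟨g, (h5 _ _ _).2 hg⟩
    obtain ⟨Γ₂, φ₂, h7, h8, h9, h10, h11, h12⟩ := ih _ (hn ▸ h1) hcon rfl
    exact ⟨Γ₂, φ₂ ∘ φ₁, h7, h8, by omega, fun k h => h10 k (h2 k h),
      fun u hu => h11 _ (h3 u hu), fun u x w h => h12 _ _ _ (h4 u x w h)⟩

end LGraph

/-- A reduced word which is readable in either sense is readable in a folded graph with a vertex of
small degree. -/
theorem exists_lGraph_of_readable (hm : 1 < m) {L : ℕ} (hL : m ≤ L) {μ : ℝ} {w : List (Letter m)}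
    (h : IsReadableL μ L w ∨ IsReadable μ w) :
    ∃ (V : Type) (_ : DecidableEq V) (Γ : LGraph m V) (u u' v : V), Γ.Folded ∧ Γ.Connected ∧
      Γ.RankLE L ∧ (Γ.edges.card : ℝ) ≤ μ * w.length ∧ u ∈ Γ.verts ∧ Run Γ.Adj u w u' ∧
      v ∈ Γ.verts ∧ Γ.deg v < 2 * m := by
  classical
  rcases h with ⟨Γ, ⟨hV, hE⟩, hcon, hf, hμ, hr, ⟨x, p, y, hp, rfl⟩, v, hv⟩ |
    ⟨Γ, ⟨hV, hE⟩, hcon, hμ, hr, x, p, y, hp, -, rfl⟩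
  · have := Fintype.ofFinite Γ.V
    have := Fintype.ofFinite Γ.E
    exact ⟨Γ.V, inferInstance, Γ.toLGraph, x, y, v, folded_toLGraph hf, connected_toLGraph hcon,
      rankLE_toLGraph hr, le_trans (by exact_mod_cast card_edges_toLGraph_le) hμ,
      Finset.mem_univ _, run_of_isPath hp, Finset.mem_univ _, (deg_toLGraph_le v).trans_lt hv⟩
  · have := Fintype.ofFinite Γ.V
    have := Fintype.ofFinite Γ.E
    obtain ⟨Γ', φ, h1, h2, h3, h4, h5, h6⟩ := (connected_toLGraph hcon).exists_folded
    have hr' : Γ'.RankLE (m - 1) := h4 _ (rankLE_toLGraph (by push_cast [hm.le]; exact hr))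
    -- A folded graph of rank at most m - 1 cannot have full degrees throughout, so ordinary
    -- readability reduces to the other kind.
    obtain ⟨v, hv, hdeg⟩ : ∃ v ∈ Γ'.verts, Γ'.deg v < 2 * m := by
      by_contra! hcon'
      have := (LGraph.Folded.rose_of_deg hm h1 hr' (by omega) hcon'
        (h5 x (Finset.mem_univ _))).1
      omega
    refine ⟨Γ.V, inferInstance, Γ', φ x, φ y, v, h1, h2, ?_, ?_, h5 _ (Finset.mem_univ _),
      run_map φ h6 (run_of_isPath hp), hv, hdeg⟩
    · unfold LGraph.RankLE at hr' ⊢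
      omega
    · refine le_trans ?_ hμ
      exact_mod_cast h3.trans card_edges_toLGraph_le

/-! ### Covering the prefixes of readable words by few small cosets -/

open Classical in
/-- The reduced words of length `a` in a coset of a subgroup given by generators. -/
def cosetWords (a : ℕ) {L : ℕ} (c : (Fin L → FreeGroup (Fin m)) × FreeGroup (Fin m)) :
    Finset (List (Letter m)) :=
  (redWords m a).filter fun w => FreeGroup.mk w * c.2⁻¹ ∈ Subgroup.closure (Set.range c.1)

/-- The prefix of a readable word lies in a small set of words in a coset of a subgroup with short
generators. -/
theorem exists_cosetWords_of_readable (hm : 1 < m) {L : ℕ} (hL : m ≤ L) {μ : ℝ} {E q : ℕ}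
    {w : List (Letter m)} (hw : IsReduced w) (hwa : q * (2 * L + 1) + 1 ≤ w.length)
    (hE : μ * w.length < E + 1) (h : IsReadableL μ L w ∨ IsReadable μ w) :
    ∃ c : (Fin L → FreeGroup (Fin m)) × FreeGroup (Fin m),
      (∀ i, c.1 i ∈ ball m (2 * E + 1)) ∧ c.2 ∈ ball m (2 * E + 1) ∧
      w.take (q * (2 * L + 1) + 1) ∈ cosetWords (q * (2 * L + 1) + 1) c ∧
      (cosetWords (q * (2 * L + 1) + 1) c).card ≤
        2 * m * ((2 * m - 1) ^ (2 * L + 1) - 1) ^ q := by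
  classical
  obtain ⟨V, _, Γ, u, u', v, h1, h2, h3, h4, h5, h6, h7, h8⟩ := exists_lGraph_of_readable hm hL h
  set a := q * (2 * L + 1) + 1 with ha
  have hEd : Γ.edges.card ≤ E := by
    have : (Γ.edges.card : ℝ) < E + 1 := h4.trans_lt hE
    exact_mod_cast Nat.lt_succ_iff.1 (by exact_mod_cast this)
  set s := w.take a with hs
  have hsl : s.length = a := by rw [hs, List.length_take, min_eq_left hwa]
  have hsr : IsReduced s := by
    rw [← List.take_append_drop a w] at hw
    exact IsReduced.left hw
  rw [← List.take_append_drop a w, run_append] at h6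
  obtain ⟨c, h6, -⟩ := h6
  have : Nonempty (Letter m) := ⟨(⟨0, by omega⟩, true)⟩
  obtain ⟨ω, hω⟩ := exists_seg s
  rw [hsl] at hω
  rw [← hs, ← hω] at h6
  obtain ⟨ν, rfl, rfl, hν⟩ := LGraph.exists_walk h6
  simp only [zero_add] at hν
  have hwalk : Γ.IsWalk ν ω a := hν
  -- Pass to the part of the graph spanned by the prefix: being the support of a reduced walk, it
  -- has few full vertices, and it is still folded with a deficient vertex.
  set Δ := LGraph.support ν ω a with hΔ
  have hV := LGraph.support_verts_subset hwalk h5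
  have hEs := LGraph.support_edges_subset hwalk
  have hΔf : Δ.Folded := h1.mono hEs
  have hΔc : Δ.Connected := LGraph.support_connected
  have hu : ν 0 ∈ Δ.verts := LGraph.zero_mem_support
  have hΔr : Δ.RankLE L := h2.rankLE_of_subgraph hV hEs ⟨_, hu⟩ h3
  obtain ⟨v', hv', hdeg⟩ := h1.exists_deficient h2 hEs hV ⟨_, hu⟩ h7 h8
  have hred : ∀ j, j + 1 < a → ω (j + 1) ≠ flipL (ω j) := by
    intro j hj
    have h9 : IsReduced (seg ω j 2) := by
      refine (hω ▸ hsr : IsReduced (seg ω 0 a)).infix ⟨seg ω 0 j, seg ω (j + 2) (a - (j + 2)), ?_⟩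
      have h10 := seg_add ω 0 (j + 2) (a - (j + 2))
      rw [seg_add ω 0 j 2, show j + 2 + (a - (j + 2)) = a by omega, zero_add, zero_add] at h10
      exact h10.symm
    exact (isReduced_cons_cons'.1 (show IsReduced [ω j, ω (j + 1)] from h9)).1
  have hfull := LGraph.card_full_support_le hm (by omega) hred hΔr
  have hΔE : Δ.edges.card ≤ E := (Finset.card_le_card hEs).trans hEd
  obtain ⟨⟨g, hg1, hg2⟩, hh⟩ := hΔc.exists_generators hu hΔr hΔE
  have hrun : Run Δ.Adj (ν 0) s (ν a) := by
    have := LGraph.run_seg (E := Δ.Adj) (ν := ν) (ω := ω) (i := 0) (k := a)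
      fun j _ hj => LGraph.isWalk_support j (by omega)
    rwa [hω, zero_add] at this
  obtain ⟨h, hh1, hh2⟩ := hh (ν a) (LGraph.run_mem_verts hrun hu)
  refine ⟨(g, h), fun i => mem_ball.2 (hg1 i), mem_ball.2 hh2, ?_, ?_⟩
  · refine Finset.mem_filter.2 ⟨mem_redWords.2 ⟨hsr, hsl⟩, ?_⟩
    rw [← hg2]
    exact (LGraph.reach_of_run hrun).trans hh1.symm
  -- Every reduced word in the coset labels a path of `Δ` from `ν 0` to `ν a`, so the bound for
  -- readable words is a bound for the coset.
  · refine le_trans (Finset.card_le_card ?_)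
      (hΔf.card_readable_le hm hΔc hv' hdeg hfull q (ν 0))
    intro z hz
    obtain ⟨hz1, hz2⟩ := Finset.mem_filter.1 hz
    refine Finset.mem_filter.2 ⟨hz1, ν a, ?_⟩
    rw [← hg2] at hz2
    have h9 := hΔf.run_toWord ((mem_loops.1 hz2).trans hh1)
    rw [inv_mul_cancel_right] at h9
    simp only [FreeGroup.toWord_mk, (mem_redWords.1 hz1).1.reduce_eq] at h9
    exact h9

open Classical in
/-- A set containing the prefixes of all readable words. -/
def readablePrefixes (m L E q : ℕ) : Finset (List (Letter m)) :=
  ((Fintype.piFinset fun _ : Fin L => ball m (2 * E + 1)) ×ˢ ball m (2 * E + 1)).biUnion fun c =>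
    -- The test makes the bound true by construction; the cosets that come from readable words pass
    -- it.
    if (cosetWords (q * (2 * L + 1) + 1) c).card ≤ 2 * m * ((2 * m - 1) ^ (2 * L + 1) - 1) ^ q then
      cosetWords (q * (2 * L + 1) + 1) c else ∅

theorem card_readablePrefixes_le (m L E q : ℕ) : (readablePrefixes m L E q).card ≤
    (ball m (2 * E + 1)).card ^ (L + 1) * (2 * m * ((2 * m - 1) ^ (2 * L + 1) - 1) ^ q) := by
  refine Finset.card_biUnion_le.trans ((Finset.sum_le_card_nsmul _ _
    (2 * m * ((2 * m - 1) ^ (2 * L + 1) - 1) ^ q) ?_).trans ?_)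
  · intro c _
    split_ifs with h
    · exact h
    · simp
  · rw [Finset.card_product, Fintype.card_piFinset_const, smul_eq_mul, pow_succ (ball m (2 * E + 1)).card]

theorem take_mem_readablePrefixes (hm : 1 < m) {L : ℕ} (hL : m ≤ L) {μ : ℝ} {E q : ℕ}
    {w : List (Letter m)} (hw : IsReduced w) (hwa : q * (2 * L + 1) + 1 ≤ w.length)
    (hE : μ * w.length < E + 1) (h : IsReadableL μ L w ∨ IsReadable μ w) :
    w.take (q * (2 * L + 1) + 1) ∈ readablePrefixes m L E q := by
  obtain ⟨c, h1, h2, h3, h4⟩ := exists_cosetWords_of_readable hm hL hw hwa hE h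
  refine Finset.mem_biUnion.2 ⟨c, Finset.mem_product.2 ⟨Fintype.mem_piFinset.2 h1, h2⟩, ?_⟩
  rwa [if_pos h4]

open Filter Topology

variable {m n : ℕ}

/-! ### Exponential genericity -/

theorem coe_piFinset_cyclicBall (m n t : ℕ) :
    ((Fintype.piFinset fun _ : Fin n => cyclicBall m t : Finset (Relators m n)) :
      Set (Relators m n)) = presentationsUpTo m n t := by
  ext r
  simp only [Finset.mem_coe, Fintype.mem_piFinset, mem_cyclicBall, presentationsUpTo,
    IsCyclicallyReducedTuple, Set.mem_ofPred_eq]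
  constructor
  · exact fun h => ⟨fun i => (h i).2, fun i => (h i).1⟩
  · exact fun h i => ⟨h.2 i, h.1 i⟩

open Classical in
theorem one_sub_proportion (hm : 1 < m) (P : Set (Relators m n)) {t : ℕ} (ht : 2 ≤ t) :
    1 - proportion P t =
      (((Fintype.piFinset fun _ : Fin n => cyclicBall m t).filter fun r => r ∉ P).card : ℝ) /
        ((cyclicBall m t).card : ℝ) ^ n := by
  set F : Finset (Relators m n) := Fintype.piFinset fun _ : Fin n => cyclicBall m t with hF
  have hc : 0 < (cyclicBall m t).card :=
    (pow_pos (by omega) _).trans_le (le_card_cyclicBall hm ht)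
  have h1 : F.card = (cyclicBall m t).card ^ n := by
    rw [hF, Fintype.card_piFinset_const]
  have h2 : P ∩ presentationsUpTo m n t = ((F.filter fun r => r ∈ P : Finset _) : Set _) := by
    rw [← coe_piFinset_cyclicBall, Finset.coe_filter, Set.inter_comm]
    rfl
  have h3 := Finset.card_filter_add_card_filter_not (s := F) (fun r => r ∈ P)
  have h4 : (F.card : ℝ) ≠ 0 := by
    rw [h1]; positivity
  unfold proportion
  rw [h2, ← coe_piFinset_cyclicBall, Set.ncard_coe_finset, Set.ncard_coe_finset, ← hF,
    ← Nat.cast_pow, ← h1, eq_div_iff h4, sub_mul, div_mul_cancel₀ _ h4, one_mul, ← h3]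
  push_cast
  ring

/-- Any base strictly between `ρ` and 1 absorbs the constant and the polynomial factor; the midpoint
is taken. -/
theorem exists_eventually_le_pow (C : ℝ) (K : ℕ) {ρ : ℝ} (h0 : 0 < ρ) (h1 : ρ < 1) :
    ∃ c : ℝ, 0 ≤ c ∧ c < 1 ∧ ∀ᶠ t : ℕ in atTop, C * ((t : ℝ) + 1) ^ K * ρ ^ t ≤ c ^ t := by
  refine ⟨(1 + ρ) / 2, by linarith, by linarith, ?_⟩
  set c := (1 + ρ) / 2 with hc
  have hc0 : 0 < c := by rw [hc]; linarith
  have hr0 : 0 < ρ / c := div_pos h0 hc0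
  have hr1 : ρ / c < 1 := by rw [div_lt_one hc0, hc]; linarith
  have h2 := tendsto_pow_const_mul_const_pow_of_abs_lt_one K
    (show |ρ / c| < 1 by rw [abs_of_pos hr0]; exact hr1)
  have h3 := ((tendsto_add_atTop_iff_nat 1).2 h2).const_mul (C / (ρ / c))
  rw [mul_zero] at h3
  filter_upwards [h3.eventually (eventually_le_nhds zero_lt_one)] with t ht
  have h4 : C * ((t : ℝ) + 1) ^ K * (ρ / c) ^ t ≤ 1 := by
    refine le_trans (le_of_eq ?_) ht
    rw [pow_succ]
    push_cast
    field_simp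
  rw [div_pow, mul_div_assoc', div_le_one (pow_pos hc0 t)] at h4
  exact h4

theorem isExponentiallyGeneric_of_le {P : Set (Relators m n)} (C : ℝ) (K : ℕ) {ρ : ℝ} (h0 : 0 < ρ)
    (h1 : ρ < 1) (h : ∀ᶠ t : ℕ in atTop, 0 ≤ 1 - proportion P t ∧
      1 - proportion P t ≤ C * ((t : ℝ) + 1) ^ K * ρ ^ t) : IsExponentiallyGeneric P := by
  obtain ⟨c, hc0, hc1, hc⟩ := exists_eventually_le_pow C K h0 h1
  have h2 : ∀ᶠ t in atTop, 1 - proportion P t ≤ c ^ t := by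
    filter_upwards [h, hc] with t h3 h4
    exact h3.2.trans h4
  refine ⟨?_, c, hc0, hc1, h2⟩
  have h3 : Tendsto (fun t => 1 - proportion P t) atTop (𝓝 0) :=
    tendsto_of_tendsto_of_tendsto_of_le_of_le' tendsto_const_nhds
      (tendsto_pow_atTop_nhds_zero_of_lt_one hc0 hc1) (h.mono fun _ h => h.1) h2
  have h4 := h3.const_sub 1
  simpa using h4

theorem pow_le_pow_mul_rpow {b : ℝ} (hb : 1 ≤ b) {i j : ℕ} {x : ℝ} (h : (i : ℝ) ≤ j + x) :
    b ^ i ≤ b ^ j * b ^ x := by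
  rw [← Real.rpow_natCast, ← Real.rpow_natCast, ← Real.rpow_add (by linarith)]
  exact Real.rpow_le_rpow_of_exponent_le hb h

/-- The exponent by which readable words are rare. -/
def readExponent (m L : ℕ) : ℝ :=
  -Real.logb ((2 * m - 1 : ℕ) : ℝ)
    ((((2 * m - 1 : ℕ) : ℝ) ^ (2 * L + 1) - 1) / ((2 * m - 1 : ℕ) : ℝ) ^ (2 * L + 1))

theorem one_lt_base (hm : 1 < m) : (1 : ℝ) < ((2 * m - 1 : ℕ) : ℝ) := by
  exact_mod_cast (by omega : 1 < 2 * m - 1)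

theorem readExponent_pos (hm : 1 < m) (L : ℕ) : 0 < readExponent m L := by
  have hb := one_lt_base hm
  have hD : (1 : ℝ) < ((2 * m - 1 : ℕ) : ℝ) ^ (2 * L + 1) := one_lt_pow₀ hb (by omega)
  rw [readExponent, neg_pos]
  refine Real.logb_neg hb (div_pos (by linarith) (by linarith)) ?_
  rw [div_lt_one (by linarith)]
  linarith

/-- `readExponent` is defined so that losing one word per block of length 2L + 1 amounts to this
exponential factor for each block. -/
theorem pow_sub_one_eq (hm : 1 < m) (L q : ℕ) :
    ((((2 * m - 1) ^ (2 * L + 1) - 1) ^ q : ℕ) : ℝ) =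
      ((2 * m - 1 : ℕ) : ℝ) ^ (-(readExponent m L * q)) *
        ((2 * m - 1 : ℕ) : ℝ) ^ (q * (2 * L + 1)) := by
  have hb := one_lt_base hm
  set b : ℝ := ((2 * m - 1 : ℕ) : ℝ) with hbdef
  have hD : (1 : ℝ) < b ^ (2 * L + 1) := one_lt_pow₀ hb (by omega)
  have h1 : b ^ (-readExponent m L) = (b ^ (2 * L + 1) - 1) / b ^ (2 * L + 1) := by
    rw [readExponent, neg_neg, Real.rpow_logb (by linarith) hb.ne']
    exact div_pos (by linarith) (by linarith)
  rw [← neg_mul, Real.rpow_mul (by linarith), Real.rpow_natCast, h1, mul_comm q, pow_mul, ← mul_pow,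
    div_mul_cancel₀ _ (by linarith), Nat.cast_pow, Nat.cast_sub (Nat.one_le_pow _ _ (by omega))]
  push_cast
  rfl

theorem card_ball_half_le (hm : 1 < m) {t : ℕ} (ht : 0 < t) {δ : ℝ} (hδ : δ ≤ 1 / 2) :
    ((ball m (t / 2)).card : ℝ) ≤ 2 * ((2 * m - 1 : ℕ) : ℝ) * ((t : ℝ) + 1) *
      ((2 * m - 1 : ℕ) : ℝ) ^ (-(δ * t)) * ((2 * m - 1 : ℕ) : ℝ) ^ (t - 1) := by
  have hb := one_lt_base hm
  set b : ℝ := ((2 * m - 1 : ℕ) : ℝ) with hbdef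
  set T : ℝ := (t : ℝ) + 1 with hT
  set y : ℝ := b ^ (-(δ * t)) with hy
  have ht0 : (0 : ℝ) ≤ t := Nat.cast_nonneg t
  have hbt : b ^ t = b * b ^ (t - 1) := by
    rw [← pow_succ']; congr 1; omega
  have h2 : ((ball m (t / 2)).card : ℝ) ≤ ((t / 2 : ℕ) + 1) * (2 * b ^ (t / 2)) := by
    rw [hbdef]; exact_mod_cast card_ball_le hm (t / 2)
  have h3 : ((t / 2 : ℕ) : ℝ) ≤ t / 2 := Nat.cast_div_le
  have h4 : b ^ (t / 2) ≤ b ^ t * y := by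
    refine pow_le_pow_mul_rpow hb.le ?_
    nlinarith
  calc ((ball m (t / 2)).card : ℝ) ≤ ((t / 2 : ℕ) + 1) * (2 * b ^ (t / 2)) := h2
    _ ≤ T * (2 * (b ^ t * y)) := by
      refine mul_le_mul (by linarith) (by linarith) (by positivity) (by linarith)
    _ = _ := by rw [hbt]; ring

/-- Choosing generators and a coset costs about b^(2E(L + 1)) with E ≤ μt. Rarity gains b^(-σq) with
q about t / (4(2L + 1)). The bound on μ lets the cost use up at most half of the gain, and the other
half covers the factor with δ. -/
theorem card_readablePrefixes_mul_le (hm : 1 < m) {L t E q : ℕ} {μ δ : ℝ}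
    (hμ1 : μ ≤ 1) (hμ : μ * (16 * (2 * L + 1) * (L + 1)) ≤ readExponent m L)
    (hE1 : (E : ℝ) ≤ μ * t) (hqa : q * (2 * L + 1) + 1 ≤ t)
    (hq : t / 4 - 1 < q * (2 * L + 1) + (2 * L + 1))
    (hδ3 : δ ≤ readExponent m L / (8 * (2 * L + 1))) :
    ((readablePrefixes m L E q).card : ℝ) *
        ((2 * m - 1 : ℕ) : ℝ) ^ (t - (q * (2 * L + 1) + 1)) ≤
      4 ^ (L + 1) * ((2 * m - 1 : ℕ) : ℝ) ^ ((L : ℝ) + 1 + 3 * readExponent m L) * (2 * m) *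
        ((t : ℝ) + 1) ^ (L + 1) * ((2 * m - 1 : ℕ) : ℝ) ^ (-(δ * t)) *
        ((2 * m - 1 : ℕ) : ℝ) ^ (t - 1) := by
  have h4 : ((readablePrefixes m L E q).card : ℝ) ≤
      ((ball m (2 * E + 1)).card : ℝ) ^ (L + 1) *
        (2 * m * (((2 * m - 1) ^ (2 * L + 1) - 1) ^ q : ℕ)) := by
    have := card_readablePrefixes_le m L E q
    generalize ((2 * m - 1) ^ (2 * L + 1) - 1) ^ q = M at this ⊢
    exact_mod_cast this
  rw [pow_sub_one_eq hm] at h4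
  have hσ := readExponent_pos hm L
  set σ := readExponent m L with hσdef
  have hb := one_lt_base hm
  have hball := card_ball_le hm (2 * E + 1)
  have hball' : ((ball m (2 * E + 1)).card : ℝ) ≤
      ((2 * E + 1 : ℕ) + 1) * (2 * ((2 * m - 1 : ℕ) : ℝ) ^ (2 * E + 1)) := by
    exact_mod_cast hball
  generalize ((2 * m - 1 : ℕ) : ℝ) = b at *
  set T : ℝ := (t : ℝ) + 1 with hT
  set y : ℝ := b ^ (-(δ * t)) with hy
  have ht0 : (0 : ℝ) ≤ t := Nat.cast_nonneg t
  have h5 : ((ball m (2 * E + 1)).card : ℝ) ≤ 4 * T * b ^ (2 * E + 1) := by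
    have h7 : (E : ℝ) ≤ t := by nlinarith
    have h8 : (0 : ℝ) < b ^ (2 * E + 1) := pow_pos (by linarith) _
    push_cast at hball'
    nlinarith
  have h6 : (b ^ (2 * E + 1)) ^ (L + 1) * b ^ (-(σ * q)) ≤
      b ^ ((L : ℝ) + 1 + 3 * σ) * y := by
    rw [← pow_mul, ← Real.rpow_natCast, ← Real.rpow_add (by linarith), hy,
      ← Real.rpow_add (by linarith)]
    refine Real.rpow_le_rpow_of_exponent_le hb.le ?_
    push_cast
    have hN : (0 : ℝ) < 2 * L + 1 := by positivity
    set N : ℝ := 2 * L + 1 with hNdef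
    -- The 3 makes up for rounding in t/4 and in the number of blocks; it accounts for the constant
    -- 3σ in the exponent.
    have h7 : (t : ℝ) / (4 * N) - 3 ≤ q := by
      have h9 : t < 4 * (q * (2 * L + 1) + (2 * L + 1)) + 8 := by omega
      have h10 : (t : ℝ) < 4 * (q * N + N) + 8 := by rw [hNdef]; exact_mod_cast h9
      have hN1 : 1 ≤ N := by rw [hNdef]; linarith [Nat.cast_nonneg (α := ℝ) L]
      rw [sub_le_iff_le_add, div_le_iff₀ (by linarith)]
      nlinarith
    have h8 : 2 * (E : ℝ) * (L + 1) ≤ σ * (t / (8 * N)) := by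
      have h9 : 2 * (E : ℝ) * (L + 1) ≤ 2 * (μ * t) * (L + 1) := by gcongr
      refine h9.trans ?_
      rw [mul_div_assoc', le_div_iff₀ (by linarith)]
      calc 2 * (μ * t) * ((L : ℝ) + 1) * (8 * N) = (μ * (16 * N * (L + 1))) * t := by ring
        _ ≤ σ * t := mul_le_mul_of_nonneg_right hμ ht0
    have h9 : δ * t ≤ σ * (t / (8 * N)) := by
      refine (mul_le_mul_of_nonneg_right hδ3 ht0).trans (le_of_eq ?_)
      ring
    have h10 := mul_le_mul_of_nonneg_left h7 hσ.le
    have h11 : σ * ((t : ℝ) / (4 * N) - 3) = 2 * (σ * (t / (8 * N))) - 3 * σ := by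
      field_simp
      ring
    nlinarith
  have h7 : b ^ (q * (2 * L + 1)) * b ^ (t - (q * (2 * L + 1) + 1)) = b ^ (t - 1) := by
    rw [← pow_add]; congr 1; omega
  have h8 : (0 : ℝ) < b ^ (-(σ * q)) := Real.rpow_pos_of_pos (by linarith) _
  have hb0 : 0 < b := by linarith
  calc ((readablePrefixes m L E q).card : ℝ) * b ^ (t - (q * (2 * L + 1) + 1))
      ≤ ((4 * T * b ^ (2 * E + 1)) ^ (L + 1) *
        (2 * m * (b ^ (-(σ * q)) * b ^ (q * (2 * L + 1))))) *
          b ^ (t - (q * (2 * L + 1) + 1)) := by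
        refine mul_le_mul_of_nonneg_right (h4.trans ?_) (by positivity)
        refine mul_le_mul_of_nonneg_right ?_ (by positivity)
        exact pow_le_pow_left₀ (by positivity) h5 _
    _ = 4 ^ (L + 1) * (2 * m) * T ^ (L + 1) *
        ((b ^ (2 * E + 1)) ^ (L + 1) * b ^ (-(σ * q))) * b ^ (t - 1) := by
        rw [← h7, mul_pow, mul_pow]; ring
    _ ≤ 4 ^ (L + 1) * (2 * m) * T ^ (L + 1) *
        (b ^ ((L : ℝ) + 1 + 3 * σ) * y) * b ^ (t - 1) := by gcongr
    _ = _ := by ring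

/-- Collects the counts: all polynomial factors are absorbed in T^(L + 3), the largest coming from
readable words as T² · T^(L + 1). -/
theorem bad_estimate {B b T y C₃ p R s S A : ℝ} {n L : ℕ} (hb : 1 < b) (hT1 : 1 ≤ T) (hy0 : 0 < y)
    (hC₃ : 0 ≤ C₃) (hS : 0 < S) (hSA : S ≤ A) (h1 : B ≤ 2 * b * T * y * S)
    (h2 : p ≤ b ^ 2 * y * S) (h3 : R * s ≤ C₃ * T ^ (L + 1) * y * S) :
    n * (B + 2 * T * (T * (T * (4 * p))) + 2 * T * (T * (R * (2 * s)))) +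
        n * n * (2 * T * (T * (2 * T * (2 * p)))) ≤
      (n * (2 * b + 8 * b ^ 2 + 4 * C₃) + n * n * (8 * b ^ 2)) * T ^ (L + 3) * y * A := by
  have hT0 : 0 < T := by linarith
  have hP1 : T ≤ T ^ (L + 3) := le_self_pow₀ hT1 (by omega)
  have hP3 : T ^ 3 ≤ T ^ (L + 3) := pow_le_pow_right₀ hT1 (by omega)
  have hb0 : 0 < b := by linarith
  have e1 : B ≤ 2 * b * T ^ (L + 3) * y * S := h1.trans (by gcongr)
  have e2 : T ^ 3 * p ≤ T ^ (L + 3) * (b ^ 2 * y * S) :=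
    (mul_le_mul_of_nonneg_left h2 (by positivity)).trans (by gcongr)
  have e3 : T ^ 2 * (R * s) ≤ T ^ 2 * (C₃ * T ^ (L + 1) * y * S) := by gcongr
  calc _ = n * (B + 8 * (T ^ 3 * p) + 4 * (T ^ 2 * (R * s))) + n * n * (8 * (T ^ 3 * p)) := by ring
    _ ≤ n * (2 * b * T ^ (L + 3) * y * S + 8 * (T ^ (L + 3) * (b ^ 2 * y * S)) +
          4 * (T ^ 2 * (C₃ * T ^ (L + 1) * y * S))) +
          n * n * (8 * (T ^ (L + 3) * (b ^ 2 * y * S))) := by gcongr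
    _ = (n * (2 * b + 8 * b ^ 2 + 4 * C₃) + n * n * (8 * b ^ 2)) * T ^ (L + 3) * y * S := by ring
    _ ≤ _ := by gcongr

/-- The genericity bound on the proportion of bad tuples. -/
theorem exists_one_sub_proportion_le (hm : 1 < m) (hn : 0 < n) {L : ℕ} (hL : m ≤ L) {lam μ : ℝ}
    (hμ : μ * (16 * (2 * L + 1) * (L + 1)) ≤ readExponent m L)
    (hadm : AdmissibleParameters m L lam μ) :
    ∃ C δ : ℝ, 0 < δ ∧ ∀ t : ℕ, 4 ≤ t → 2 * m ≤ t → 1 - proportion (genericClass m n lam μ L) t ≤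
      C * ((t : ℝ) + 1) ^ (L + 3) * ((2 * m - 1 : ℕ) : ℝ) ^ (-(δ * t)) := by
  classical
  have hlam := lam_le_of_admissible hm hadm
  obtain ⟨-, hμ0, hμ1, hlam0, -⟩ := hadm
  have hσ := readExponent_pos hm L
  have hb := one_lt_base hm
  -- The three terms are the decay rates for short relators, for long repetitions and coincidences,
  -- and for readable words.
  set δ := min (1 / 2) (min (lam / 4) (readExponent m L / (8 * (2 * L + 1)))) with hδ
  have hδ1 : δ ≤ 1 / 2 := min_le_left _ _
  have hδ2 : δ ≤ lam / 4 := (min_le_right _ _).trans (min_le_left _ _)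
  have hδ3 : δ ≤ readExponent m L / (8 * (2 * L + 1)) :=
    (min_le_right _ _).trans (min_le_right _ _)
  have hδ0 : 0 < δ := lt_min (by norm_num) (lt_min (by linarith) (by positivity))
  set C₃ : ℝ := 4 ^ (L + 1) *
    ((2 * m - 1 : ℕ) : ℝ) ^ ((L : ℝ) + 1 + 3 * readExponent m L) * (2 * m) with hC₃
  have hC₃0 : 0 ≤ C₃ := by
    have := Real.rpow_pos_of_pos (zero_lt_one.trans hb) ((L : ℝ) + 1 + 3 * readExponent m L)
    positivity
  refine ⟨n * (2 * ((2 * m - 1 : ℕ) : ℝ) + 8 * ((2 * m - 1 : ℕ) : ℝ) ^ 2 + 4 * C₃) +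
    n * n * (8 * ((2 * m - 1 : ℕ) : ℝ) ^ 2), δ, hδ0, fun t ht hmt => ?_⟩
  have ht0 : (0 : ℝ) ≤ t := Nat.cast_nonneg t
  obtain ⟨k, hk1, hk2⟩ : ∃ k : ℕ, 4 * (k : ℝ) ≤ lam * t ∧ lam * t / 4 < k + 1 := by
    refine ⟨⌊lam * t / 4⌋₊, ?_, Nat.lt_floor_add_one _⟩
    have := Nat.floor_le (show 0 ≤ lam * t / 4 by positivity)
    linarith
  obtain ⟨E, hE1, hE2⟩ : ∃ E : ℕ, (E : ℝ) ≤ μ * t ∧ μ * t < E + 1 :=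
    ⟨⌊μ * t⌋₊, Nat.floor_le (by positivity), Nat.lt_floor_add_one _⟩
  -- The prefix to be examined has one free first letter and then as many blocks of length 2L + 1 as
  -- fit into t/4.
  obtain ⟨q, hq1, hq2⟩ : ∃ q : ℕ, q * (2 * L + 1) ≤ t / 4 - 1 ∧
      t / 4 - 1 < q * (2 * L + 1) + (2 * L + 1) :=
    ⟨(t / 4 - 1) / (2 * L + 1), Nat.div_mul_le_self _ _, Nat.lt_div_mul_add (by omega)⟩
  have hbad := card_bad_le (n := n) hm (L := L) hlam hk1
    (show 4 * (q * (2 * L + 1) + 1) ≤ t by omega) hmt (μ := μ)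
    (R := readablePrefixes m L E q) fun w hw hwa hwt h =>
      take_mem_readablePrefixes hm hL hw hwa (lt_of_le_of_lt
        (mul_le_mul_of_nonneg_left (by exact_mod_cast hwt) hμ0.le) hE2) h
  have hA := le_card_cyclicBall hm (show 2 ≤ t by omega)
  have h1 := card_ball_half_le hm (show 0 < t by omega) hδ1
  have h3 := card_readablePrefixes_mul_le hm hμ1 hμ hE1 (by omega) hq2 hδ3
  have h2 : ((2 * m - 1 : ℕ) : ℝ) ^ (t - k) ≤ ((2 * m - 1 : ℕ) : ℝ) ^ 2 *
      ((2 * m - 1 : ℕ) : ℝ) ^ (-(δ * t)) * ((2 * m - 1 : ℕ) : ℝ) ^ (t - 1) := by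
    have hkt : k ≤ t := by
      have : (k : ℝ) ≤ t := by nlinarith
      exact_mod_cast this
    have h3 : ((2 * m - 1 : ℕ) : ℝ) ^ (t - k) ≤
        ((2 * m - 1 : ℕ) : ℝ) ^ (2 + (t - 1)) * ((2 * m - 1 : ℕ) : ℝ) ^ (-(δ * t)) := by
      refine pow_le_pow_mul_rpow hb.le ?_
      rw [Nat.cast_sub hkt, show 2 + (t - 1) = t + 1 by omega]
      push_cast
      nlinarith
    refine h3.trans (le_of_eq ?_)
    rw [pow_add]
    ring
  have hS : (0 : ℝ) < ((2 * m - 1 : ℕ) : ℝ) ^ (t - 1) := pow_pos (zero_lt_one.trans hb) _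
  have hSA : ((2 * m - 1 : ℕ) : ℝ) ^ (t - 1) ≤ ((cyclicBall m t).card : ℝ) := by
    rw [← Nat.cast_pow]
    exact Nat.cast_le.2 hA
  have hX := bad_estimate (n := n) hb (by linarith : (1 : ℝ) ≤ (t : ℝ) + 1)
    (Real.rpow_pos_of_pos (zero_lt_one.trans hb) _) hC₃0 hS hSA h1 h2 h3
  have hA0 := hS.trans_le hSA
  rw [one_sub_proportion hm _ (by omega), div_le_iff₀ (pow_pos hA0 _)]
  refine (Nat.cast_le.2 hbad).trans ?_
  simp only [Nat.cast_mul, Nat.cast_add, Nat.cast_pow, Nat.cast_ofNat, Nat.cast_one]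
  generalize (cyclicBall m t).card = A at *
  have hAn : (A : ℝ) ^ n = (A : ℝ) ^ (n - 1) * A := by
    rw [← pow_succ]; congr 1; omega
  rw [hAn]
  refine (mul_le_mul_of_nonneg_left hX (by positivity)).trans (le_of_eq ?_)
  ring

/-- The threshold `μ₀` depends on m and L only: it makes the cost of choosing a coset at most half
of the gain from the rarity of readable words. -/
theorem exists_isExponentiallyGeneric (hm : 1 < m) (hn : 0 < n) {L : ℕ} (hL : m ≤ L) :
    ∃ μ₀ : ℝ, 0 < μ₀ ∧ ∀ lam μ : ℝ, μ ≤ μ₀ → AdmissibleParameters m L lam μ →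
      IsExponentiallyGeneric (genericClass m n lam μ L) := by
  have hpos : (0 : ℝ) < 16 * (2 * L + 1) * (L + 1) := by positivity
  refine ⟨readExponent m L / (16 * (2 * L + 1) * (L + 1)),
    div_pos (readExponent_pos hm L) hpos, fun lam μ hμ hadm => ?_⟩
  rw [le_div_iff₀ hpos] at hμ
  obtain ⟨C, δ, hδ, h⟩ := exists_one_sub_proportion_le hm hn hL hμ hadm
  have hb := one_lt_base hm
  refine isExponentiallyGeneric_of_le C (L + 3) (ρ := ((2 * m - 1 : ℕ) : ℝ) ^ (-δ))
    (Real.rpow_pos_of_pos (by linarith) _) (Real.rpow_lt_one_of_one_lt_of_neg hb (by linarith)) ?_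
  filter_upwards [eventually_ge_atTop (4 + 2 * m)] with t ht
  refine ⟨?_, ?_⟩
  · rw [one_sub_proportion hm _ (by omega)]
    positivity
  · refine (h t (by omega) (by omega)).trans (le_of_eq ?_)
    rw [← neg_mul, Real.rpow_mul (by linarith), Real.rpow_natCast]

end GenericGroups

end

open GenericGroups in
theorem mainTheorem4 (m n : ℕ) (hm : 1 < m) (hn : 0 < n) :
    -- the classes are exponentially generic, for all small enough `μ`
    (∀ L : ℕ, m ≤ L → ∃ μ₀ : ℝ, 0 < μ₀ ∧ ∀ lam μ : ℝ, μ ≤ μ₀ →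
      AdmissibleParameters m L lam μ → IsExponentiallyGeneric (genericClass m n lam μ L)) ∧
    -- and every group in such a class is rigid
    (∀ (L : ℕ) (lam μ : ℝ), AdmissibleParameters m L lam μ →
      ∀ r ∈ genericClass m n lam μ L,
        (∀ (H : Type*) [Group H], IsGeneratedBy m H → ∀ φ : H →* PresGroup r,
          φ.range = ⊤ ∨ IsFreeGroup φ.range) ∧
        (∀ K : Subgroup (PresGroup r), IsGeneratedBy m K ∧ ¬ IsFreeGroup K ↔ K = ⊤) ∧
        (∀ α : PresGroup r ≃* PresGroup r, IsFreelyInduced r α) ∧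
        IsCoHopfian (PresGroup r)) := by
  exact ⟨fun L hL => exists_isExponentiallyGeneric hm hn hL, fun L lam μ hadm r hr =>
    ⟨fun H _ hH φ => range_eq_top_or_isFreeGroup hm hn hadm hr hH φ,
    isGeneratedBy_and_not_isFreeGroup_iff hm hn hadm hr, isFreelyInduced hm hn hadm hr,
    isCoHopfian hm hn hadm hr⟩⟩
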